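/- **Notation.** Distributions are on the finite set $\{0,1\}^M$, and $d_{\mathrm{TV}}(p,q)=\sup_{A\subseteq\{0,1\}^M}|p(A)-q(A)|$. For a symmetric real matrix $\theta=(\theta_{ij})_{i,j\in[M]}$ with zero diagonal, the Ising model is $P_\theta(x)=Z(\theta)^{-1}\exp\big(\tfrac12\sum_{i,j\in[M]}(-1)^{x_i+x_j}\theta_{ij}\big)$, $x\in\{0,1\}^M$. For $S\subseteq[M]$ and $d\ge 0$, $Q_M^{S,d}$ is the Ising model with $\theta_{ij}=d$ for all $i\neq j$ in $S$ and $\theta_{ij}=0$ otherwise. A statistical query is a function $f:\{0,1\}^M\to[-1,1]$ with a tolerance $t>0$; an oracle for $\mathbf P$ answers it with a value $v$ such that $|v-\mathbf E_{X\sim\mathbf P}[f(X)]|\le t$. An SQ algorithm is a (possibly randomized, computationally unrestricted) algorithm that accesses $\mathbf P$ only through adaptive queries to such an oracle and then outputs a distribution. **Theorem (SQ lower bound for robust learning of an unknown Ising model).** There are universal constants $c_0,c_1,c_2>0$ such that for every $a>0$ there is $k_0\in\mathbb N$ such that for every $0<c\le c_0$ there is $C'>0$ for which the following holds. Let $k\ge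 k_0$ be an integer, let $0<\epsilon<1/2$, let $\delta=c\,\epsilon\log(1/\epsilon)/k^3$, let $m,M$ be nonnegative integers with $M=3m^{5/4}$ and $m>\max\big(C'/\epsilon,\;k^2/\log(1/\delta)\big)$, and let $\tau\ge a\,M^{-(k+1)/5}\delta$ (so that any $\tau=\Theta(M^{-(k+1)/5}\delta)$ is covered). Suppose that an SQ algorithm has the following property: for every $S\subseteq[M]$ with $|S|=m$, every distribution $\mathbf P$ on $\{0,1\}^M$ with $d_{\mathrm{TV}}\big(\mathbf P,Q_M^{S,\delta/m}\big)\le\epsilon$, and every oracle for $\mathbf P$, it outputs, with probability at least $2/3$, a distribution $\mathbf Q$ with $d_{\mathrm{TV}}(\mathbf Q,\mathbf P)\le c_1\delta$. Then there are such $S$, $\mathbf P$ and an oracle for $\mathbf P$ with which, with positive probability, the algorithm makes a query of tolerance smaller than $\sqrt{2\tau}$ or makes at least $2^{c_2M^{2/5}}M^{-(k+1)/5}$ queries. -/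

import Mathlib

open MeasureTheory

namespace SQIsing

/-- The hypercube `{0,1}^M`. -/
abbrev Cube (M : ℕ) : Type := Fin M → Fin 2

/-- The probability distributions on a finite set, as nonnegative mass functions of total mass
one. -/
abbrev Distr (α : Type) [Fintype α] : Type := stdSimplex ℝ α

/-- Total variation distance, `sup_A |p(A) - q(A)|` over all subsets `A` of the finite set `α`. -/
noncomputable def tvDist {α : Type} [Fintype α] (p q : Distr α) : ℝ :=
  ⨆ A : Finset α, |∑ x ∈ A, p.1 x - ∑ x ∈ A, q.1 x|

/-- The unnormalised mass `exp ((1/2) ∑_{i,j} (-1)^{x_i + x_j} θ_{ij})` of an Ising model on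
`{0,1}^M`. -/
noncomputable def isingWeight {M : ℕ} (θ : Matrix (Fin M) (Fin M) ℝ) (x : Cube M) : ℝ :=
  Real.exp ((1 / 2) * ∑ i, ∑ j, (-1 : ℝ) ^ ((x i : ℕ) + (x j : ℕ)) * θ i j)

/-- The partition function `Z(θ)`. -/
noncomputable def partitionFn {M : ℕ} (θ : Matrix (Fin M) (Fin M) ℝ) : ℝ :=
  ∑ x : Cube M, isingWeight θ x

theorem partitionFn_pos {M : ℕ} (θ : Matrix (Fin M) (Fin M) ℝ) : 0 < partitionFn θ :=
  Finset.sum_pos (fun _ _ => Real.exp_pos _) Finset.univ_nonempty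

/-- The Ising model `P_θ(x) = exp ((1/2) ∑_{i,j} (-1)^{x_i + x_j} θ_{ij}) / Z(θ)` on `{0,1}^M` with
interaction matrix `θ` (used below for symmetric matrices with zero diagonal). -/
noncomputable def isingModel {M : ℕ} (θ : Matrix (Fin M) (Fin M) ℝ) : Distr (Cube M) :=
  ⟨fun x => isingWeight θ x / partitionFn θ,
    fun _ => div_nonneg (Real.exp_pos _).le (partitionFn_pos θ).le, by
      rw [← Finset.sum_div]
      exact div_self (partitionFn_pos θ).ne'⟩

/-- The interaction matrix with `θ_{ij} = d` for all `i ≠ j` in `S` and `θ_{ij} = 0` otherwise. -/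
def cliqueInteraction {M : ℕ} (S : Finset (Fin M)) (d : ℝ) : Matrix (Fin M) (Fin M) ℝ :=
  Matrix.of fun i j => if i ≠ j ∧ i ∈ S ∧ j ∈ S then d else 0

/-- The Ising model `Q_M^{S,d}`. -/
noncomputable def Q {M : ℕ} (S : Finset (Fin M)) (d : ℝ) : Distr (Cube M) :=
  isingModel (cliqueInteraction S d)

/-- A statistical query `f : α → [-1,1]` together with the tolerance `tol > 0` that is requested
for it. -/
structure StatQuery (α : Type) where
  f : α → ℝ
  f_mem : ∀ x, f x ∈ Set.Icc (-1 : ℝ) 1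
  tol : ℝ
  tol_pos : 0 < tol

/-- `O` answers every statistical query `f` of tolerance `t` with a value `v` such that
`|v - E_{X ∼ P} f(X)| ≤ t`. -/
def IsStatOracle {α : Type} [Fintype α] (P : Distr α) (O : StatQuery α → ℝ) : Prop :=
  ∀ q : StatQuery α, |O q - ∑ x, P.1 x * q.f x| ≤ q.tol

/-- A deterministic adaptive statistical query algorithm with outputs in `β`: it either stops with
an output, or asks a query and continues in a way that depends on the answer. There is no
restriction on its computational resources. A randomised algorithm is a random element of this
type. -/
inductive SQTree (α β : Type) : Type where
  | output (h : β) : SQTree α β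
  | ask (q : StatQuery α) (next : ℝ → SQTree α β) : SQTree α β

/-- The output of the algorithm when its queries are answered by `O`. -/
def SQTree.run {α β : Type} (O : StatQuery α → ℝ) : SQTree α β → β
  | .output h => h
  | .ask q next => (next (O q)).run O

/-- The list of the queries that the algorithm makes when they are answered by `O`. -/
def SQTree.queries {α β : Type} (O : StatQuery α → ℝ) : SQTree α β → List (StatQuery α)
  | .output _ => []
  | .ask q next => q :: (next (O q)).queries O

/-- The admissible inputs: `P` is an `ε`-corruption (in total variation) of `Q_M^{S,d}` with
`|S| = m`, and `O` is a statistical query oracle for `P`. -/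
structure IsInput {M : ℕ} (m : ℕ) (ε d : ℝ) (S : Finset (Fin M)) (P : Distr (Cube M))
    (O : StatQuery (Cube M) → ℝ) : Prop where
  card_eq : S.card = m
  corrupted : tvDist P (Q S d) ≤ ε
  oracle : IsStatOracle P O

/-- The randomised algorithm `A`, with internal randomness `ω ∼ μ`, learns the corrupted
distribution within total variation distance `r` with probability at least `2/3`: on each
admissible input the event of failure has probability at most `1/3`. (If that event is not
measurable, this is its outer probability.) -/
def Learns {M : ℕ} {Ω : Type*} [MeasurableSpace Ω] (μ : Measure Ω)
    (A : Ω → SQTree (Cube M) (Distr (Cube M))) (m : ℕ) (ε d r : ℝ) : Prop :=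
  ∀ S P O, IsInput m ε d S P O → μ {ω | ¬ tvDist ((A ω).run O) P ≤ r} ≤ 1 / 3

end SQIsing

open SQIsing

/-! The bound comes from a large family of corrupted models that are pairwise almost uncorrelated
with respect to the uniform distribution. Integrality of `M = 3m^(5/4)` forces `m = b^4` and `M =
3b^5`, and the cliques are the graphs of the functions from `b^4` points to `3b` values. Two random
graphs meet in about `b^3/3` points; by a Chernoff bound (`card_agreements_gt_le`) at most a
fraction `exp(-b^3/8)` of the graphs meets a given one in more than `2b^3/3` points.

The density of a clique model depends only on the spin sum over the clique. A function of the spin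
sum over `S` is a combination of the elementary symmetric polynomials `e_l(S)`, and `e_l(S)`,
`e_l'(T)` have average product `choose |S ∩ T| l` if `l = l'` and `0` otherwise. So if a density is
`1 + h` with `h` orthogonal to all polynomials of degree at most `k` in the spin sum, only the terms
`l > k` survive and correlations gain the factor `(|S ∩ T|/m)^(k+1)` (`abs_avg_mul_le`). For `|S ∩
T| ≤ 2b^3/3` this is at most `(5/6)^(k+1) M^(-(k+1)/5)`.

The corruption has to supply the orthogonality: a signed measure of mass at most `ε`, pointwise at
most half of the binomial law, that cancels the moment defects of the clique model. By Hahn–Banach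
(`exists_weights`) it exists as soon as the functional `q ↦ E[(tilt - 1) q]` is bounded by a small
multiple of the `ℓ¹` norm of `q` on a lattice window of half-width `r`. The coefficients of `q` are
controlled by its `L¹` norm through Chebyshev polynomials of the second kind
(`abs_coeff_le_integral`). With `r` of order `√(m log(1/ε))` the binomial mass on the window is
still at least of order `ε/√m`, while the correction has mass of order `δ k^3 / log(1/ε)`; this
balance is the definition of `δ`.

The construction needs `log(1/ε)` much larger than `k^3`, which holds if `ε ≤ 37δ`. If `ε ≥ 37δ`,
the clique model is so close to uniform that the exactly uncorrelated densities `1 + δ χ_S`, with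
`χ_S` the parity of `S`, are admissible corruptions.

The statistical query argument is `exists_hard_input`: the oracle returns the uniform average
whenever the tolerance permits. Each query rules out few members (`card_correlated_le`), so after
few queries a third of the family shares one successful output, although two of its members are too
far apart for that. -/

namespace SQIsing

/-! ### Averages, characters and spin sums on the hypercube -/

/-- The average of a function over the hypercube. -/
noncomputable def avg {M : ℕ} (F : Cube M → ℝ) : ℝ := (∑ x, F x) / 2 ^ M

/-- The spin `(-1)^{x_i}`. -/
def spin {M : ℕ} (i : Fin M) (x : Cube M) : ℝ := (-1) ^ (x i : ℕ)

/-- The sum of the spins in `S`. -/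
def spinSum {M : ℕ} (S : Finset (Fin M)) (x : Cube M) : ℝ := ∑ i ∈ S, spin i x

/-- The character (product of spins) of `W`. -/
def chi {M : ℕ} (W : Finset (Fin M)) (x : Cube M) : ℝ := ∏ i ∈ W, spin i x

/-- The elementary symmetric polynomial of degree `l` of the spins in `S`. -/
def elemSymm {M : ℕ} (l : ℕ) (S : Finset (Fin M)) (x : Cube M) : ℝ :=
  ∑ W ∈ S.powersetCard l, chi W x

section
variable {M : ℕ}

theorem avg_add (F G : Cube M → ℝ) : avg (fun x => F x + G x) = avg F + avg G := by
  simp [avg, Finset.sum_add_distrib, add_div]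

theorem avg_sub (F G : Cube M → ℝ) : avg (fun x => F x - G x) = avg F - avg G := by
  simp [avg, Finset.sum_sub_distrib, sub_div]

theorem avg_const_mul (c : ℝ) (F : Cube M → ℝ) : avg (fun x => c * F x) = c * avg F := by
  unfold avg
  rw [← Finset.mul_sum, mul_div_assoc]

theorem avg_sum {ι : Type*} (s : Finset ι) (F : ι → Cube M → ℝ) :
    avg (fun x => ∑ i ∈ s, F i x) = ∑ i ∈ s, avg (F i) := by
  simp only [avg]
  rw [Finset.sum_comm, Finset.sum_div]

theorem avg_const (c : ℝ) : avg (fun _ : Cube M => c) = c := by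
  simp [avg]

theorem avg_mono {F G : Cube M → ℝ} (h : ∀ x, F x ≤ G x) : avg F ≤ avg G := by
  unfold avg
  gcongr with x
  exact h x

theorem avg_nonneg {F : Cube M → ℝ} (h : ∀ x, 0 ≤ F x) : 0 ≤ avg F :=
  div_nonneg (Finset.sum_nonneg fun x _ => h x) (by positivity)

theorem abs_avg_le (F : Cube M → ℝ) : |avg F| ≤ avg (fun x => |F x|) := by
  unfold avg
  rw [abs_div, abs_of_pos (by positivity : (0 : ℝ) < 2 ^ M)]
  gcongr
  exact Finset.abs_sum_le_sum_abs _ _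

theorem avg_mul_sq_le (F G : Cube M → ℝ) :
    avg (fun x => F x * G x) ^ 2 ≤ avg (fun x => F x ^ 2) * avg (fun x => G x ^ 2) := by
  unfold avg
  rw [div_pow, div_mul_div_comm, ← sq]
  gcongr
  exact Finset.sum_mul_sq_le_sq_mul_sq _ _ _

theorem spin_sq (i : Fin M) (x : Cube M) : spin i x * spin i x = 1 := by
  unfold spin
  rw [← mul_pow]; simp

/-- Flipping one coordinate of the cube. -/
def flip (a : Fin M) : Cube M ≃ Cube M where
  toFun x := Function.update x a (x a + 1)
  invFun x := Function.update x a (x a + 1)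
  left_inv x := by
    ext i
    by_cases h : i = a
    · subst h; simp [add_assoc]
    · simp [h]
  right_inv x := by
    ext i
    by_cases h : i = a
    · subst h; simp [add_assoc]
    · simp [h]

theorem spin_flip_self (a : Fin M) (x : Cube M) : spin a (flip a x) = -spin a x := by
  have : ∀ u : Fin 2, (-1 : ℝ) ^ ((u + 1 : Fin 2) : ℕ) = -(-1) ^ (u : ℕ) := by
    intro u; fin_cases u <;> simp
  simp [spin, flip, this]

theorem spin_flip_of_ne {a i : Fin M} (h : i ≠ a) (x : Cube M) : spin i (flip a x) = spin i x := by
  simp [spin, flip, h]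

theorem avg_flip (a : Fin M) (F : Cube M → ℝ) : avg (fun x => F (flip a x)) = avg F := by
  unfold avg
  rw [Equiv.sum_comp (flip a) F]

theorem avg_spin_mul {a : Fin M} {G : Cube M → ℝ} (hG : ∀ x, G (flip a x) = G x) :
    avg (fun x => spin a x * G x) = 0 := by
  have h := avg_flip a (fun x => spin a x * G x)
  simp only [spin_flip_self, hG, neg_mul] at h
  have h2 := avg_const_mul (-1) (fun x => spin a x * G x)
  simp only [neg_mul, one_mul] at h2
  linarith

theorem spinSum_flip {a : Fin M} {S : Finset (Fin M)} (ha : a ∉ S) (x : Cube M) :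
    spinSum S (flip a x) = spinSum S x :=
  Finset.sum_congr rfl fun _ hi => spin_flip_of_ne (ne_of_mem_of_not_mem hi ha) x

theorem chi_flip {a : Fin M} {S : Finset (Fin M)} (ha : a ∉ S) (x : Cube M) :
    chi S (flip a x) = chi S x :=
  Finset.prod_congr rfl fun _ hi => spin_flip_of_ne (ne_of_mem_of_not_mem hi ha) x

theorem chi_mul_self (W : Finset (Fin M)) (x : Cube M) : chi W x * chi W x = 1 := by
  unfold chi
  rw [← Finset.prod_mul_distrib]
  exact Finset.prod_eq_one fun i _ => spin_sq i x

theorem abs_chi (W : Finset (Fin M)) (x : Cube M) : |chi W x| = 1 := by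
  have h := chi_mul_self W x
  rw [← abs_mul_abs_self] at h
  nlinarith [abs_nonneg (chi W x)]

theorem avg_chi_mul_chi_of_mem {V W : Finset (Fin M)} {a : Fin M} (ha : a ∈ V) (hW : a ∉ W) :
    avg (fun x => chi V x * chi W x) = 0 := by
  have h : ∀ x : Cube M, chi V x * chi W x = spin a x * (chi (V.erase a) x * chi W x) := fun x => by
    rw [← mul_assoc]; congr 1
    exact (Finset.mul_prod_erase V _ ha).symm
  simp only [h]
  exact avg_spin_mul fun x => by rw [chi_flip (Finset.notMem_erase a V), chi_flip hW]

theorem avg_chi_mul_chi (V W : Finset (Fin M)) :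
    avg (fun x => chi V x * chi W x) = if V = W then 1 else 0 := by
  split_ifs with h
  · subst h
    simp only [chi_mul_self, avg_const]
  · by_cases h1 : V ⊆ W
    · obtain ⟨a, ha, ha'⟩ := Finset.exists_of_ssubset (h1.ssubset_of_ne h)
      simp only [mul_comm (chi V _)]
      exact avg_chi_mul_chi_of_mem ha ha'
    · obtain ⟨a, ha, ha'⟩ := Finset.not_subset.1 h1
      exact avg_chi_mul_chi_of_mem ha ha'

/-! ### Elementary symmetric polynomials of the spins and their recursion -/

theorem elemSymm_zero (S : Finset (Fin M)) (x : Cube M) : elemSymm 0 S x = 1 := by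
  simp [elemSymm, chi]

theorem elemSymm_insert {a : Fin M} {S : Finset (Fin M)} (ha : a ∉ S) (l : ℕ) (x : Cube M) :
    elemSymm (l + 1) (insert a S) x = elemSymm (l + 1) S x + spin a x * elemSymm l S x := by
  unfold elemSymm
  rw [Finset.powersetCard_succ_insert ha, Finset.sum_union, Finset.sum_image, Finset.mul_sum]
  · congr 1
    refine Finset.sum_congr rfl fun W hW => ?_
    exact Finset.prod_insert fun h => ha ((Finset.mem_powersetCard.1 hW).1 h)
  · intro V hV W hW h
    have hV' : a ∉ V := fun h => ha ((Finset.mem_powersetCard.1 hV).1 h)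
    have hW' : a ∉ W := fun h => ha ((Finset.mem_powersetCard.1 hW).1 h)
    rw [← Finset.erase_insert hV', h, Finset.erase_insert hW']
  · rw [Finset.disjoint_left]
    intro V hV hV'
    obtain ⟨W, -, rfl⟩ := Finset.mem_image.1 hV'
    exact ha ((Finset.mem_powersetCard.1 hV).1 (Finset.mem_insert_self a W))

theorem elemSymm_one (S : Finset (Fin M)) (x : Cube M) : elemSymm 1 S x = spinSum S x := by
  simp [elemSymm, spinSum, Finset.powersetCard_one, chi]

/-- Multiplying a monomial of degree `l + 1` by a spin either adds a new index, and each `(l+2)`-set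
arises `l + 2` times, or cancels an index since spins square to one, and each `l`-set arises `|S| -
l` times. -/
theorem spinSum_mul_elemSymm (S : Finset (Fin M)) (l : ℕ) (x : Cube M) :
    spinSum S x * elemSymm (l + 1) S x =
      (l + 2) * elemSymm (l + 2) S x + (S.card - l) * elemSymm l S x := by
  induction S using Finset.induction_on generalizing l with
  | empty =>
    have h : ∀ n, elemSymm (n + 1) (∅ : Finset (Fin M)) x = 0 := fun n => by
      rw [elemSymm, Finset.powersetCard_eq_empty.2 (by simp), Finset.sum_empty]
    cases l with
    | zero => simp [spinSum, h]
    | succ l => simp [h]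
  | insert a S ha ih =>
    have hs : spinSum (insert a S) x = spin a x + spinSum S x := Finset.sum_insert ha
    rw [hs, elemSymm_insert ha, elemSymm_insert ha, Finset.card_insert_of_notMem ha]
    have h1 := ih l
    have hsq := spin_sq a x
    cases l with
    | zero =>
      rw [elemSymm_zero, elemSymm_zero] at *
      simp only [zero_add, elemSymm_one] at *
      push_cast
      linear_combination h1 + hsq
    | succ l =>
      have h2 := ih l
      rw [elemSymm_insert ha]
      push_cast at *
      linear_combination h1 + spin a x * h2 + elemSymm (l+1) S x * hsq

end

/-! ### Expansion of functions of the spin sum and the correlation bound -/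

section
variable {M : ℕ}
-- The three-term recursion is solved for its top term. The polynomial depends on `S` only through
-- its size; it transfers orthogonality to low-degree polynomials into vanishing of low-degree
-- coefficients.
open Polynomial in
theorem exists_poly_elemSymm (M m l : ℕ) : ∃ p : ℝ[X], p.natDegree ≤ l ∧
    ∀ (S : Finset (Fin M)), S.card = m → ∀ x, elemSymm l S x = p.eval (spinSum S x) := by
  induction l using Nat.strong_induction_on with
  | _ l ih =>
    match l with
    | 0 => exact ⟨1, by simp, fun S _ x => by simp [elemSymm_zero]⟩
    | 1 => exact ⟨X, natDegree_X_le, fun S _ x => by simp [elemSymm_one]⟩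
    | l + 2 =>
      obtain ⟨p, hp, hp'⟩ := ih (l + 1) (by omega)
      obtain ⟨q, hq, hq'⟩ := ih l (by omega)
      refine ⟨C ((l + 2 : ℝ)⁻¹) * (X * p - C (m - l : ℝ) * q), ?_, fun S hS x => ?_⟩
      · refine (natDegree_C_mul_le _ _).trans ((natDegree_sub_le _ _).trans (max_le ?_ ?_))
        · exact natDegree_mul_le.trans (by have := natDegree_X_le (R := ℝ); omega)
        · exact (natDegree_C_mul_le _ _).trans (by omega)
      · have h := spinSum_mul_elemSymm S l x
        rw [hS, hp' S hS, hq' S hS] at h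
        have h2 : (l + 2 : ℝ) ≠ 0 := by positivity
        simp only [eval_mul, eval_C, eval_sub, eval_X]
        field_simp
        linear_combination -h

theorem exists_spinSum_eq (S : Finset (Fin M)) (x : Cube M) :
    ∃ i ∈ Finset.range (S.card + 1), spinSum S x = S.card - 2 * (i : ℝ) := by
  induction S using Finset.induction_on with
  | empty => exact ⟨0, by simp, by simp [spinSum]⟩
  | insert a S ha ih =>
    obtain ⟨i, hi, h⟩ := ih
    have hs : spinSum (insert a S) x = spin a x + spinSum S x := Finset.sum_insert ha
    rw [Finset.card_insert_of_notMem ha, hs, h]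
    rw [Finset.mem_range] at hi
    have : x a = 0 ∨ x a = 1 := by omega
    rcases this with h0 | h0
    · exact ⟨i, by rw [Finset.mem_range]; omega, by simp [spin, h0]; ring⟩
    · exact ⟨i + 1, by rw [Finset.mem_range]; omega, by simp [spin, h0]; ring⟩

theorem elemSymm_eq_zero {l : ℕ} {S : Finset (Fin M)} (h : S.card < l) (x : Cube M) :
    elemSymm l S x = 0 := by
  rw [elemSymm, Finset.powersetCard_eq_empty.2 h, Finset.sum_empty]

-- By the recursion, the span of the elementary symmetric polynomials is stable under multiplication
-- by the spin sum, so it contains every polynomial in the spin sum.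
open Polynomial in
theorem exists_coeff_eval (m : ℕ) (p : ℝ[X]) : ∃ a : ℕ → ℝ, ∀ (S : Finset (Fin M)), S.card = m →
    ∀ x, p.eval (spinSum S x) = ∑ l ∈ Finset.range (m + 1), a l * elemSymm l S x := by
  -- Working with functions of the pair `(S, x)` makes the coefficients common to all sets of size
  -- `m`.
  let Y := {S : Finset (Fin M) // S.card = m} × Cube M
  let e : ℕ → Y → ℝ := fun l y => elemSymm l y.1.1 y.2
  let V := Submodule.span ℝ (Set.range e)
  have hmul : ∀ f ∈ V, (fun y : Y => spinSum y.1.1 y.2 * f y) ∈ V := by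
    intro f hf
    induction hf using Submodule.span_induction with
    | mem f hf =>
      obtain ⟨l, rfl⟩ := hf
      match l with
      | 0 =>
        have : (fun y : Y => spinSum y.1.1 y.2 * e 0 y) = e 1 := by
          ext y
          simp [e, elemSymm_zero, elemSymm_one]
        rw [this]
        exact Submodule.subset_span (Set.mem_range_self 1)
      | l + 1 =>
        have : (fun y : Y => spinSum y.1.1 y.2 * e (l + 1) y) =
            ((l : ℝ) + 2) • e (l + 2) + ((m : ℝ) - l) • e l := by
          ext y
          have := spinSum_mul_elemSymm y.1.1 l y.2
          rw [y.1.2] at this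
          simpa [e] using this
        rw [this]
        exact V.add_mem (V.smul_mem _ (Submodule.subset_span ⟨_, rfl⟩))
          (V.smul_mem _ (Submodule.subset_span ⟨_, rfl⟩))
    | zero => simp only [Pi.zero_apply, mul_zero]; exact V.zero_mem
    | add f g _ _ hf hg =>
      convert V.add_mem hf hg using 1
      ext y; simp [mul_add]
    | smul c f _ hf =>
      convert V.smul_mem c hf using 1
      ext y; simp only [Pi.smul_apply, smul_eq_mul]; ring
  have hp : (fun y : Y => p.eval (spinSum y.1.1 y.2)) ∈ V := by
    induction p using Polynomial.induction_on with
    | C a =>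
      convert V.smul_mem a (Submodule.subset_span (Set.mem_range_self (f := e) 0)) using 1
      ext y; simp [e, elemSymm_zero]
    | add p q hp hq =>
      convert V.add_mem hp hq using 1
      ext y; simp
    | monomial n a h =>
      convert hmul _ h using 1
      ext y; simp only [eval_mul, eval_C, eval_pow, eval_X]; ring
  obtain ⟨a, ha⟩ := Finsupp.mem_span_range_iff_exists_finsupp.1 hp
  refine ⟨a, fun S hS x => ?_⟩
  have h := congrFun ha (⟨S, hS⟩, x)
  rw [Finsupp.sum, Finset.sum_apply] at h
  simp only [Pi.smul_apply, smul_eq_mul, e] at h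
  -- Both sums are compared with the sum over the union of the index sets: outside the support the
  -- coefficient vanishes, and for `l > m` the polynomial does.
  rw [← h, Finset.sum_subset (Finset.subset_union_left (s₂ := Finset.range (m + 1)))
    (fun l _ hl => by rw [Finsupp.notMem_support_iff.1 hl, zero_mul])]
  refine (Finset.sum_subset Finset.subset_union_right fun l _ hl => ?_).symm
  rw [elemSymm_eq_zero, mul_zero]
  rw [Finset.mem_range] at hl
  omega

/-- The spin sum takes only the `m + 1` values `m - 2i`, so `F` may be replaced by its Lagrange
interpolant there. -/
theorem exists_coeff (m : ℕ) (F : ℝ → ℝ) : ∃ a : ℕ → ℝ, ∀ (S : Finset (Fin M)), S.card = m →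
    ∀ x, F (spinSum S x) = ∑ l ∈ Finset.range (m + 1), a l * elemSymm l S x := by
  obtain ⟨a, ha⟩ := exists_coeff_eval (M := M) m
    (Lagrange.interpolate (Finset.range (m + 1)) (fun i : ℕ => (m : ℝ) - 2 * i)
      (fun i => F (m - 2 * i)))
  refine ⟨a, fun S hS x => ?_⟩
  rw [← ha S hS x]
  obtain ⟨i, hi, h⟩ := exists_spinSum_eq S x
  rw [hS] at hi h
  rw [h]
  refine (Lagrange.eval_interpolate_at_node (v := fun i : ℕ => (m : ℝ) - 2 * i)
    (fun i : ℕ => F (m - 2 * i)) (fun i _ j _ hij => ?_) hi).symm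
  have : (i : ℝ) = j := by simp only at hij; linarith
  exact_mod_cast this

/-- Characters are orthonormal, so only the sets common to both expansions contribute, and these are
the `l`-subsets of `S ∩ T`. -/
theorem avg_elemSymm_mul_elemSymm (S T : Finset (Fin M)) (l l' : ℕ) :
    avg (fun x => elemSymm l S x * elemSymm l' T x) =
      if l = l' then ((S ∩ T).card.choose l : ℝ) else 0 := by
  simp only [elemSymm, Finset.sum_mul_sum]
  rw [avg_sum]
  simp only [avg_sum]
  simp only [avg_chi_mul_chi, Finset.sum_ite_eq]
  split_ifs with h
  · subst h
    rw [← Finset.card_powersetCard, Finset.card_eq_sum_ones, Finset.sum_ite, Finset.sum_const_zero,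
      add_zero]
    push_cast
    refine Finset.sum_congr ?_ fun _ _ => rfl
    ext W
    simp only [Finset.mem_filter, Finset.mem_powersetCard, Finset.subset_inter_iff]
    tauto
  · refine Finset.sum_eq_zero fun W hW => if_neg fun hW' => h ?_
    rw [← (Finset.mem_powersetCard.1 hW).2, (Finset.mem_powersetCard.1 hW').2]

theorem avg_mul_eq_sum {m : ℕ} {F G : ℝ → ℝ} {a b : ℕ → ℝ} {S T : Finset (Fin M)}
    (ha : ∀ x, F (spinSum S x) = ∑ l ∈ Finset.range (m + 1), a l * elemSymm l S x)
    (hb : ∀ x, G (spinSum T x) = ∑ l ∈ Finset.range (m + 1), b l * elemSymm l T x) :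
    avg (fun x => F (spinSum S x) * G (spinSum T x)) =
      ∑ l ∈ Finset.range (m + 1), a l * b l * ((S ∩ T).card.choose l : ℝ) := by
  simp only [ha, hb, Finset.sum_mul_sum]
  rw [avg_sum]
  refine Finset.sum_congr rfl fun l hl => ?_
  rw [avg_sum]
  have : ∀ l', avg (fun x => a l * elemSymm l S x * (b l' * elemSymm l' T x)) =
      if l = l' then a l * b l' * ((S ∩ T).card.choose l : ℝ) else 0 := fun l' => by
    have h := avg_elemSymm_mul_elemSymm S T l l'
    have : (fun x => a l * elemSymm l S x * (b l' * elemSymm l' T x)) =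
      fun x => (a l * b l') * (elemSymm l S x * elemSymm l' T x) := by ext x; ring
    rw [this, avg_const_mul, h]
    split_ifs <;> simp
  simp only [this, Finset.sum_ite_eq, if_pos hl]

/-- The quotient of the two binomial coefficients is a product of factors `(t - i)/(m - i)`, each at
most `t/m`. -/
theorem pow_mul_choose_le {t m : ℕ} (h : t ≤ m) (l : ℕ) :
    m ^ l * t.choose l ≤ t ^ l * m.choose l := by
  induction l with
  | zero => simp
  | succ l ih =>
    refine Nat.le_of_mul_le_mul_right ?_ (Nat.succ_pos l)
    have h1 := Nat.choose_succ_right_eq t l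
    have h2 := Nat.choose_succ_right_eq m l
    have h3 : m * (t - l) ≤ t * (m - l) := by
      rw [Nat.mul_sub, Nat.mul_sub, mul_comm t m]
      exact Nat.sub_le_sub_left (Nat.mul_le_mul_right l h) _
    calc m ^ (l + 1) * t.choose (l + 1) * (l + 1)
        = (m * (t - l)) * (m ^ l * t.choose l) := by rw [mul_assoc, h1]; ring
      _ ≤ (t * (m - l)) * (t ^ l * m.choose l) := Nat.mul_le_mul h3 ih
      _ = t ^ (l + 1) * m.choose (l + 1) * (l + 1) := by rw [mul_assoc _ (m.choose _), h2]; ring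

open Polynomial in
/-- Two functions of the spin sums over `S` and `T`, one of which is orthogonal to the polynomials
of degree at most `k`, are nearly uncorrelated if `S` and `T` overlap little. -/
theorem abs_avg_mul_le {m k : ℕ} (F G : ℝ → ℝ) {S T : Finset (Fin M)} (hm : 0 < m)
    (hS : S.card = m) (hT : T.card = m)
    (hG : ∀ p : ℝ[X], p.natDegree ≤ k → avg (fun x => G (spinSum T x) * p.eval (spinSum T x)) = 0) :
    |avg (fun x => F (spinSum S x) * G (spinSum T x))| ≤
      (((S ∩ T).card : ℝ) / m) ^ (k + 1) * (√(avg fun x => F (spinSum S x) ^ 2) *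
        √(avg fun x => G (spinSum T x) ^ 2)) := by
  obtain ⟨a, ha⟩ := exists_coeff (M := M) m F
  obtain ⟨b, hb⟩ := exists_coeff (M := M) m G
  -- Pairing `G` with the degree `l` elementary symmetric polynomial, itself a polynomial of degree
  -- at most `k` in the spin sum, isolates `b l * choose m l`.
  have hb0 : ∀ l ≤ k, l ≤ m → b l = 0 := by
    intro l hl hlm
    obtain ⟨p, hp, hp'⟩ := exists_poly_elemSymm M m l
    have h := hG p (hp.trans hl)
    simp only [← hp' T hT, hb T hT, Finset.sum_mul] at h
    rw [avg_sum] at h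
    simp only [mul_assoc, avg_const_mul, avg_elemSymm_mul_elemSymm, mul_ite, mul_zero] at h
    rw [Finset.sum_ite_eq' , if_pos (Finset.mem_range.2 (by omega)), Finset.inter_self, hT] at h
    refine (mul_eq_zero.1 h).resolve_right ?_
    exact_mod_cast (Nat.choose_pos hlm).ne'
  have ht : (S ∩ T).card ≤ m := hS ▸ Finset.card_le_card Finset.inter_subset_left
  set t := (S ∩ T).card
  have hm' : (0 : ℝ) < m := by exact_mod_cast hm
  have hr1 : (t : ℝ) / m ≤ 1 := by rw [div_le_one hm']; exact_mod_cast ht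
  have hr0 : 0 ≤ (t : ℝ) / m := by positivity
  have hF2 : avg (fun x => F (spinSum S x) ^ 2) =
      ∑ l ∈ Finset.range (m + 1), (|a l| * √(m.choose l)) ^ 2 := by
    simp only [sq (F _)]
    rw [avg_mul_eq_sum (ha S hS) (ha S hS), Finset.inter_self, hS]
    refine Finset.sum_congr rfl fun l _ => ?_
    rw [mul_pow, sq_abs, Real.sq_sqrt (by positivity)]; ring
  have hG2 : avg (fun x => G (spinSum T x) ^ 2) =
      ∑ l ∈ Finset.range (m + 1), (|b l| * √(m.choose l)) ^ 2 := by
    simp only [sq (G _)]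
    rw [avg_mul_eq_sum (hb T hT) (hb T hT), Finset.inter_self, hT]
    refine Finset.sum_congr rfl fun l _ => ?_
    rw [mul_pow, sq_abs, Real.sq_sqrt (by positivity)]; ring
  rw [avg_mul_eq_sum (ha S hS) (hb T hT), hF2, hG2]
  refine (Finset.abs_sum_le_sum_abs _ _).trans ?_
  -- Cauchy–Schwarz for the coefficients weighted by `√(choose m l)`; what remains is a termwise
  -- comparison, where the terms `l ≤ k` vanish.
  refine le_trans ?_ (mul_le_mul_of_nonneg_left (Real.sum_mul_le_sqrt_mul_sqrt _ _ _)
    (pow_nonneg hr0 _))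
  rw [Finset.mul_sum]
  refine Finset.sum_le_sum fun l hl => ?_
  rw [Finset.mem_range] at hl
  by_cases hlk : l ≤ k
  · simp [hb0 l hlk (by omega)]
  · have h1 : (t.choose l : ℝ) ≤ ((t : ℝ) / m) ^ l * m.choose l := by
      rw [div_pow, div_mul_eq_mul_div, le_div_iff₀ (by positivity), mul_comm]
      exact_mod_cast pow_mul_choose_le ht l
    have h2 : ((t : ℝ) / m) ^ l ≤ ((t : ℝ) / m) ^ (k + 1) :=
      pow_le_pow_of_le_one hr0 hr1 (by omega)
    have h3 : √(m.choose l : ℝ) * √(m.choose l) = m.choose l := Real.mul_self_sqrt (by positivity)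
    rw [abs_mul, abs_mul, Nat.abs_cast]
    calc |a l| * |b l| * (t.choose l : ℝ)
        ≤ |a l| * |b l| * (((t : ℝ) / m) ^ (k + 1) * m.choose l) := by
          gcongr
          exact h1.trans (by gcongr)
      _ = ((t : ℝ) / m) ^ (k + 1) * (|a l| * √(m.choose l) * (|b l| * √(m.choose l))) := by
          linear_combination (-(|a l| * |b l| * ((t : ℝ) / m) ^ (k + 1))) * h3

end

/-! ### The law of the spin sum -/

section
variable {M : ℕ}

theorem avg_spinSum_insert (F : ℝ → ℝ) {a : Fin M} {S : Finset (Fin M)} (ha : a ∉ S) :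
    avg (fun x => F (spinSum (insert a S) x)) =
      (avg (fun x => F (spinSum S x + 1)) + avg (fun x => F (spinSum S x - 1))) / 2 := by
  have h : ∀ x, F (spinSum (insert a S) x) = (1 / 2) * (F (spinSum S x + 1) + F (spinSum S x - 1)) +
      spin a x * ((1 / 2) * (F (spinSum S x + 1) - F (spinSum S x - 1))) := fun x => by
    have hs : spinSum (insert a S) x = spin a x + spinSum S x := Finset.sum_insert ha
    rw [hs]
    have : x a = 0 ∨ x a = 1 := by omega
    rcases this with h0 | h0
    · simp only [spin, h0]; norm_num; rw [add_comm]; ring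
    · simp only [spin, h0]; norm_num
      rw [show -1 + spinSum S x = spinSum S x - 1 by ring]; ring
  simp only [h]
  rw [avg_add, avg_const_mul, avg_add, avg_spin_mul (fun x => by rw [spinSum_flip ha])]
  ring

/-- The spin sum over `S` has a centred binomial law. -/
theorem avg_spinSum_eq_sum (F : ℝ → ℝ) (S : Finset (Fin M)) :
    avg (fun x => F (spinSum S x)) =
      ∑ i ∈ Finset.range (S.card + 1), (S.card.choose i : ℝ) / 2 ^ S.card * F (S.card - 2 * i) := by
  induction S using Finset.induction_on generalizing F with
  | empty => simp [spinSum, avg_const]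
  | insert a S ha ih =>
    rw [avg_spinSum_insert F ha, ih (fun s => F (s + 1)), ih (fun s => F (s - 1)),
      Finset.card_insert_of_notMem ha]
    set m := S.card
    rw [Finset.sum_range_succ' _ (m + 1)]
    have h1 : ∑ i ∈ Finset.range (m + 1), (m.choose i : ℝ) / 2 ^ m * F (m - 2 * i + 1) =
        ∑ i ∈ Finset.range (m + 1), (m.choose (i + 1) : ℝ) / 2 ^ m * F (m - 2 * (i + 1 : ℕ) + 1) +
          1 / 2 ^ m * F (m + 1) := by
      have := Finset.sum_range_succ' (fun i : ℕ => (m.choose i : ℝ) / 2 ^ m * F (m - 2 * i + 1))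
        (m + 1)
      rw [Finset.sum_range_succ, Nat.choose_succ_self] at this
      simpa using this
    rw [h1, add_right_comm, ← Finset.sum_add_distrib, add_div, Finset.sum_div]
    congr 1
    · refine Finset.sum_congr rfl fun i _ => ?_
      rw [Nat.choose_succ_succ]
      push_cast
      rw [show (m : ℝ) - 2 * (i + 1) + 1 = m + 1 - 2 * (i + 1) by ring,
        show (m : ℝ) - 2 * i - 1 = m + 1 - 2 * (i + 1) by ring]
      field_simp
      ring
    · simp
      field_simp
      ring

end

/-- The expectation of `F (s)` for the sum `s` of `m` independent uniform signs. -/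
noncomputable def binE (m : ℕ) (F : ℝ → ℝ) : ℝ := avg fun x : Cube m => F (spinSum Finset.univ x)

theorem binE_eq_sum (m : ℕ) (F : ℝ → ℝ) :
    binE m F = ∑ i ∈ Finset.range (m + 1), (m.choose i : ℝ) / 2 ^ m * F (m - 2 * i) := by
  rw [binE, avg_spinSum_eq_sum, Finset.card_univ, Fintype.card_fin]

theorem avg_spinSum {M : ℕ} (F : ℝ → ℝ) (S : Finset (Fin M)) :
    avg (fun x => F (spinSum S x)) = binE S.card F := by
  rw [binE_eq_sum, avg_spinSum_eq_sum]

section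
variable {m : ℕ}

theorem binE_add (F G : ℝ → ℝ) : binE m (fun s => F s + G s) = binE m F + binE m G := avg_add _ _

theorem binE_sub (F G : ℝ → ℝ) : binE m (fun s => F s - G s) = binE m F - binE m G := avg_sub _ _

theorem binE_const_mul (c : ℝ) (F : ℝ → ℝ) : binE m (fun s => c * F s) = c * binE m F :=
  avg_const_mul _ _

theorem binE_const (c : ℝ) : binE m (fun _ => c) = c := avg_const c

theorem binE_mono {F G : ℝ → ℝ} (h : ∀ s, F s ≤ G s) : binE m F ≤ binE m G :=
  avg_mono fun _ => h _

theorem binE_nonneg {F : ℝ → ℝ} (h : ∀ s, 0 ≤ F s) : 0 ≤ binE m F := avg_nonneg fun _ => h _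

theorem abs_binE_le (F : ℝ → ℝ) : |binE m F| ≤ binE m (fun s => |F s|) := abs_avg_le _

theorem binE_mul_le {F G : ℝ → ℝ} {a b : ℝ} (ha : 0 ≤ a) (hb : 0 ≤ b)
    (hF : binE m (fun s => F s ^ 2) ≤ a ^ 2) (hG : binE m (fun s => G s ^ 2) ≤ b ^ 2) :
    binE m (fun s => F s * G s) ≤ a * b := by
  refine le_of_sq_le_sq ?_ (by positivity)
  calc _ ≤ binE m (fun s => F s ^ 2) * binE m (fun s => G s ^ 2) := avg_mul_sq_le _ _
    _ ≤ a ^ 2 * b ^ 2 := mul_le_mul hF hG (binE_nonneg fun _ => sq_nonneg _) (sq_nonneg _)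
    _ = (a * b) ^ 2 := by ring

theorem binE_sum {ι : Type*} (t : Finset ι) (F : ι → ℝ → ℝ) :
    binE m (fun s => ∑ i ∈ t, F i s) = ∑ i ∈ t, binE m (F i) :=
  avg_sum t fun i x => F i (spinSum Finset.univ x)

theorem binE_neg (F : ℝ → ℝ) : binE m (fun s => F (-s)) = binE m F := by
  rw [binE_eq_sum, binE_eq_sum, ← Finset.sum_range_reflect]
  refine Finset.sum_congr rfl fun i hi => ?_
  have hi' : i ≤ m := by rw [Finset.mem_range] at hi; omega
  rw [show m + 1 - 1 - i = m - i by omega, Nat.choose_symm hi', Nat.cast_sub hi']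
  congr 2
  ring

theorem binE_eq_zero_of_odd {F : ℝ → ℝ} (h : ∀ s, F (-s) = -F s) : binE m F = 0 := by
  have h1 := binE_neg (m := m) F
  simp only [h] at h1
  have h2 := binE_const_mul (m := m) (-1) F
  simp only [neg_mul, one_mul] at h2
  linarith

/-! ### Moments and exponential moments of the spin sum -/

theorem avg_exp_spinSum {M : ℕ} (l : ℝ) (S : Finset (Fin M)) :
    avg (fun x => Real.exp (l * spinSum S x)) = Real.cosh l ^ S.card := by
  induction S using Finset.induction_on with
  | empty => simp [spinSum, avg_const]
  | insert a S ha ih =>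
    rw [avg_spinSum_insert (fun s => Real.exp (l * s)) ha, Finset.card_insert_of_notMem ha, pow_succ,
      ← ih, Real.cosh_eq]
    have h1 : ∀ x, Real.exp (l * (spinSum S x + 1)) = Real.exp l * Real.exp (l * spinSum S x) :=
      fun x => by rw [← Real.exp_add]; ring_nf
    have h2 : ∀ x, Real.exp (l * (spinSum S x - 1)) = Real.exp (-l) * Real.exp (l * spinSum S x) :=
      fun x => by rw [← Real.exp_add]; ring_nf
    simp only [h1, h2, avg_const_mul]
    ring

theorem binE_exp_le (l : ℝ) : binE m (fun s => Real.exp (l * s)) ≤ Real.exp (m * l ^ 2 / 2) := by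
  rw [binE, avg_exp_spinSum, Finset.card_univ, Fintype.card_fin]
  calc Real.cosh l ^ m ≤ Real.exp (l ^ 2 / 2) ^ m := by
        gcongr
        exact Real.cosh_le_exp_half_sq l
    _ = _ := by rw [← Real.exp_nat_mul]; ring_nf

theorem binE_pow_le (hm : 0 < m) (j : ℕ) : binE m (fun s => s ^ (2 * j)) ≤ 2 * (6 * j * m) ^ j := by
  rcases Nat.eq_zero_or_pos j with rfl | hj
  · simp [binE_const]
  have hm' : (0 : ℝ) < m := by exact_mod_cast hm
  have hj' : (0 : ℝ) < j := by exact_mod_cast hj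
  -- This choice makes the sub-Gaussian bound `exp (m * l ^ 2 / 2)` equal to `exp j`, while `s ^
  -- (2j)` is bounded by `(2j)! * l ^ (-2j)` times `exp (l * |s|)`.
  set l := √(2 * j / m) with hl
  have hl2 : l ^ 2 = 2 * j / m := Real.sq_sqrt (by positivity)
  have hpt : ∀ s : ℝ, s ^ (2 * j) ≤
      (2 * j * m) ^ j * (Real.exp (l * s) + Real.exp (-l * s)) := fun s => by
    have h1 : (l * |s|) ^ (2 * j) / (2 * j).factorial ≤ Real.exp (l * |s|) :=
      Real.pow_div_factorial_le_exp _ (by positivity) _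
    have h2 : Real.exp (l * |s|) ≤ Real.exp (l * s) + Real.exp (-l * s) := by
      rcases abs_cases s with ⟨h, -⟩ | ⟨h, -⟩ <;> rw [h]
      · linarith [Real.exp_pos (-l * s)]
      · rw [mul_neg, ← neg_mul]; linarith [Real.exp_pos (l * s)]
    have h3 : ((2 * j).factorial : ℝ) ≤ (2 * j) ^ (2 * j) := by
      exact_mod_cast Nat.factorial_le_pow (2 * j)
    rw [mul_pow, pow_mul l, hl2, pow_mul |s|, sq_abs, ← pow_mul, div_le_iff₀ (by positivity)] at h1
    have h4 : s ^ (2 * j) = (2 * j / m : ℝ) ^ j * s ^ (2 * j) * (m / (2 * j)) ^ j := by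
      rw [mul_right_comm, ← mul_pow]
      rw [show (2 * j / m : ℝ) * (m / (2 * j)) = 1 by field_simp]
      simp
    rw [h4]
    calc _ ≤ Real.exp (l * |s|) * (2 * j).factorial * (m / (2 * j)) ^ j := by gcongr
      _ ≤ (Real.exp (l * s) + Real.exp (-l * s)) * (2 * j) ^ (2 * j) * (m / (2 * j)) ^ j := by
          gcongr
      _ = _ := by
          rw [pow_mul, mul_assoc, ← mul_pow, mul_comm]
          congr 2
          field_simp
  refine (binE_mono hpt).trans ?_
  rw [binE_const_mul, binE_add]
  have h1 := binE_exp_le (m := m) l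
  have h2 := binE_exp_le (m := m) (-l)
  rw [neg_sq] at h2
  have h3 : (m : ℝ) * l ^ 2 / 2 = j * 1 := by rw [hl2]; field_simp
  rw [h3, Real.exp_nat_mul] at h1 h2
  have h4 : Real.exp 1 ^ j ≤ 3 ^ j := by
    gcongr
    exact Real.exp_one_lt_three.le
  calc _ ≤ (2 * j * m : ℝ) ^ j * (3 ^ j + 3 ^ j) := by gcongr <;> linarith
    _ = 2 * ((2 * j * m) * 3) ^ j := by rw [mul_pow _ (3 : ℝ)]; ring
    _ = _ := by ring_nf

/-- The exponential series is bounded term by term by the moment bound and `n^n / n! ≤ 3^n`. The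
`n`-th term is at most `2 * (18 d)^n`, and `d ≤ 1/36` makes the series geometric of ratio `1/2`. -/
theorem binE_exp_sq_le (hm : 0 < m) {d : ℝ} (hd0 : 0 ≤ d) (hd : d ≤ 1 / 36) :
    binE m (fun s => Real.exp (d * (s ^ 2 / m))) ≤ 4 := by
  have hm' : (0 : ℝ) < m := by exact_mod_cast hm
  have h1 : HasSum (fun n : ℕ => binE m (fun s => (d * (s ^ 2 / m)) ^ n / n.factorial))
      (binE m (fun s => Real.exp (d * (s ^ 2 / m)))) := by
    unfold binE avg
    refine HasSum.div_const (hasSum_sum fun x _ => ?_) _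
    rw [Real.exp_eq_exp_ℝ]
    exact NormedSpace.expSeries_div_hasSum_exp _
  have h2 : HasSum (fun n : ℕ => 2 * (1 / 2 : ℝ) ^ n) (2 * (1 - 1 / 2)⁻¹) :=
    (hasSum_geometric_of_lt_one (by norm_num) (by norm_num)).mul_left _
  have h3 := hasSum_le (fun n => ?_) h1 h2
  · norm_num at h3; exact h3
  have h4 : (fun s : ℝ => (d * (s ^ 2 / m)) ^ n / n.factorial) =
      fun s => (d / m) ^ n / n.factorial * s ^ (2 * n) := by
    ext s; rw [pow_mul]; ring
  rw [h4, binE_const_mul]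
  have h5 : (n : ℝ) ^ n / n.factorial ≤ 3 ^ n := by
    refine (Real.pow_div_factorial_le_exp n (by positivity) n).trans ?_
    rw [← mul_one (n : ℝ), Real.exp_nat_mul]
    gcongr
    exact Real.exp_one_lt_three.le
  calc (d / m) ^ n / n.factorial * binE m (fun s => s ^ (2 * n))
      ≤ (d / m) ^ n / n.factorial * (2 * (6 * n * m) ^ n) := by gcongr; exact binE_pow_le hm n
    _ = 2 * ((6 * d) ^ n * ((n : ℝ) ^ n / n.factorial)) := by
        simp only [mul_pow, div_pow]; field_simp
    _ ≤ 2 * ((6 * (1 / 36)) ^ n * 3 ^ n) := by gcongr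
    _ = 2 * (1 / 2) ^ n := by rw [← mul_pow]; norm_num

/-- Cauchy–Schwarz separates the power from the exponential; squaring the latter removes the factor
`1/2` from its exponent. -/
theorem binE_pow_mul_exp_le (hm : 0 < m) {d : ℝ} (hd0 : 0 ≤ d) (hd : d ≤ 1 / 36) (i : ℕ) :
    binE m (fun s => s ^ (2 * i) * Real.exp (d * (s ^ 2 / m) / 2)) ≤ 3 * (12 * i * m) ^ i := by
  have h := binE_mul_le (m := m) (F := fun s => s ^ (2 * i))
    (G := fun s => Real.exp (d * (s ^ 2 / m) / 2)) (a := (3 / 2) * (12 * i * m) ^ i) (b := 2)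
    (by positivity) (by norm_num) ?_ ?_
  · linarith
  · have h := binE_pow_le hm (2 * i)
    have e : (fun s : ℝ => (s ^ (2 * i)) ^ 2) = fun s => s ^ (2 * (2 * i)) := by
      ext s; rw [← pow_mul]; ring_nf
    rw [e]
    refine h.trans ?_
    rw [mul_pow (3 / 2 : ℝ), ← pow_mul, mul_comm i 2, Nat.cast_mul,
      show (6 * ((2 : ℕ) * i) * m : ℝ) = 12 * i * m by push_cast; ring]
    gcongr
    norm_num
  · have e : (fun s : ℝ => Real.exp (d * (s ^ 2 / m) / 2) ^ 2) =
        fun s => Real.exp (d * (s ^ 2 / m)) := by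
      ext s; rw [← Real.exp_nat_mul]; ring_nf
    rw [e]
    exact (binE_exp_sq_le hm hd0 hd).trans (by norm_num)

end

/-! ### The density of the Ising model on a clique -/

/-- The normalising constant of `tilt`. -/
noncomputable def tiltZ (m : ℕ) (d : ℝ) : ℝ := binE m fun s => Real.exp (d * (s ^ 2 / m) / 2)

/-- The density of the clique Ising model with interaction `d / m` with respect to the uniform
distribution, as a function of the sum of the `m` spins in the clique. -/
noncomputable def tilt (m : ℕ) (d s : ℝ) : ℝ := Real.exp (d * (s ^ 2 / m) / 2) / tiltZ m d

section
variable {m : ℕ} {d : ℝ}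

theorem exp_sub_one_le (y : ℝ) : Real.exp y - 1 ≤ y * Real.exp y := by
  have h := Real.add_one_le_exp (-y)
  have h2 := mul_le_mul_of_nonneg_right h (Real.exp_pos y).le
  rw [← Real.exp_add, neg_add_cancel, Real.exp_zero] at h2
  linarith

theorem one_le_exp_tilt (hd0 : 0 ≤ d) (s : ℝ) : 1 ≤ Real.exp (d * (s ^ 2 / m) / 2) :=
  Real.one_le_exp (by positivity)

theorem one_le_tiltZ (hd0 : 0 ≤ d) : 1 ≤ tiltZ m d := by
  rw [← binE_const (m := m) 1]
  exact binE_mono fun s => one_le_exp_tilt hd0 s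

/-- The inequality `exp y - 1 ≤ y * exp y` trades one factor `s ^ 2 / m` for the factor `d`, so that
moment defects are linear in `d`. -/
theorem binE_exp_sub_one_mul_pow_le (hm : 0 < m) (hd0 : 0 ≤ d) (hd : d ≤ 1 / 36) (i : ℕ) :
    binE m (fun s => (Real.exp (d * (s ^ 2 / m) / 2) - 1) * s ^ (2 * i)) ≤
      3 / 2 * d * (12 * (i + 1) * m) ^ (i + 1) / m := by
  have hm' : (0 : ℝ) < m := by exact_mod_cast hm
  have h := binE_pow_mul_exp_le hm hd0 hd (i + 1)
  calc _ ≤ binE m (fun s => d / (2 * m) * (s ^ (2 * (i + 1)) * Real.exp (d * (s ^ 2 / m) / 2))) := by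
        refine binE_mono fun s => ?_
        have h0 := exp_sub_one_le (d * (s ^ 2 / m) / 2)
        have h1 : 0 ≤ s ^ (2 * i) := by rw [pow_mul]; positivity
        calc _ ≤ (d * (s ^ 2 / m) / 2) * Real.exp (d * (s ^ 2 / m) / 2) * s ^ (2 * i) := by gcongr
          _ = _ := by rw [mul_add, pow_add]; ring
    _ ≤ d / (2 * m) * (3 * (12 * (i + 1 : ℕ) * m) ^ (i + 1)) := by
        rw [binE_const_mul]
        gcongr
    _ = _ := by push_cast; ring

theorem tiltZ_le (hm : 0 < m) (hd0 : 0 ≤ d) (hd : d ≤ 1 / 36) : tiltZ m d ≤ 1 + 18 * d := by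
  have hm' : (0 : ℝ) < m := by exact_mod_cast hm
  have h := binE_exp_sub_one_mul_pow_le hm hd0 hd 0
  simp only [mul_zero, pow_zero, mul_one, CharP.cast_eq_zero, zero_add, pow_one] at h
  rw [binE_sub, binE_const] at h
  have : 3 / 2 * d * (12 * m) / m = 18 * d := by field_simp; ring
  unfold tiltZ
  linarith

theorem binE_tilt (hd0 : 0 ≤ d) : binE m (tilt m d) = 1 := by
  have h : tilt m d = fun s => (tiltZ m d)⁻¹ * Real.exp (d * (s ^ 2 / m) / 2) := by
    ext s; rw [tilt, div_eq_inv_mul]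
  rw [h, binE_const_mul]
  exact inv_mul_cancel₀ (by linarith [one_le_tiltZ (m := m) hd0])

theorem half_le_tilt (hm : 0 < m) (hd0 : 0 ≤ d) (hd : d ≤ 1 / 36) (s : ℝ) : 1 / 2 ≤ tilt m d s := by
  have h1 := one_le_tiltZ (m := m) hd0
  have h2 := tiltZ_le hm hd0 hd
  have h3 := one_le_exp_tilt (m := m) hd0 s
  rw [tilt, le_div_iff₀ (by linarith)]
  linarith

theorem abs_tilt_sub_one_le (hd0 : 0 ≤ d) (s : ℝ) :
    |tilt m d s - 1| ≤ (Real.exp (d * (s ^ 2 / m) / 2) - 1) + (tiltZ m d - 1) := by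
  have h1 := one_le_tiltZ (m := m) hd0
  have h3 := one_le_exp_tilt (m := m) hd0 s
  rw [tilt, div_sub_one (by linarith), abs_div, abs_of_pos (by linarith : 0 < tiltZ m d)]
  refine (div_le_self (abs_nonneg _) h1).trans ?_
  rw [abs_le]
  constructor <;> linarith

theorem binE_abs_tilt_sub_one_le (hm : 0 < m) (hd0 : 0 ≤ d) (hd : d ≤ 1 / 36) :
    binE m (fun s => |tilt m d s - 1|) ≤ 36 * d := by
  refine (binE_mono (abs_tilt_sub_one_le hd0)).trans ?_
  rw [binE_add, binE_sub, binE_const, binE_const]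
  have := tiltZ_le hm hd0 hd
  change tiltZ m d - 1 + _ ≤ _
  linarith

/-- The moment defects of the clique Ising model. -/
theorem abs_binE_tilt_sub_one_mul_pow_le (hm : 0 < m) (hd0 : 0 ≤ d) (hd : d ≤ 1 / 36) (i : ℕ) :
    |binE m (fun s => (tilt m d s - 1) * s ^ (2 * i))| ≤
      5 * d * (12 * (i + 1) * m) ^ (i + 1) / m := by
  have hm' : (0 : ℝ) < m := by exact_mod_cast hm
  calc _ ≤ binE m (fun s => |(tilt m d s - 1) * s ^ (2 * i)|) := abs_binE_le _
    _ ≤ binE m (fun s => (Real.exp (d * (s ^ 2 / m) / 2) - 1) * s ^ (2 * i) +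
          (tiltZ m d - 1) * s ^ (2 * i)) := by
        refine binE_mono fun s => ?_
        have h1 : 0 ≤ s ^ (2 * i) := by rw [pow_mul]; positivity
        rw [abs_mul, abs_of_nonneg h1, ← add_mul]
        gcongr
        exact abs_tilt_sub_one_le hd0 s
    _ ≤ 3 / 2 * d * (12 * (i + 1) * m) ^ (i + 1) / m + 18 * d * (2 * (6 * i * m) ^ i) := by
        rw [binE_add, binE_const_mul]
        have h1 := tiltZ_le hm hd0 hd
        have h2 := one_le_tiltZ (m := m) hd0
        gcongr
        · exact binE_exp_sub_one_mul_pow_le hm hd0 hd i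
        · exact binE_nonneg fun s => by rw [pow_mul]; positivity
        · linarith
        · exact binE_pow_le hm i
    -- The contribution of the normalising constant is a lower-order moment, absorbed into the main
    -- term.
    _ ≤ 3 / 2 * d * (12 * (i + 1) * m) ^ (i + 1) / m +
          18 * d * (2 * ((12 * (i + 1) * m) ^ (i + 1) / (12 * m))) := by
        have h : (6 * i * m : ℝ) ^ i ≤ (12 * (i + 1) * m) ^ (i + 1) / (12 * m) := by
          rw [le_div_iff₀ (by positivity), pow_succ]
          gcongr
          · norm_num
          · linarith
          · have : (0 : ℝ) ≤ i := by positivity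
            linarith
        gcongr
    _ ≤ _ := by
        have : 0 ≤ d * (12 * (i + 1) * m) ^ (i + 1) / m := by positivity
        have e : 18 * d * (2 * ((12 * (i + 1) * m) ^ (i + 1) / (12 * m))) =
          3 * (d * (12 * (i + 1) * m) ^ (i + 1) / m) := by ring
        have e' : ∀ c, c * d * (12 * (i + 1) * m) ^ (i + 1) / m =
          c * (d * (12 * (i + 1) * m) ^ (i + 1) / m) := fun c => by ring
        rw [e, e', e']
        linarith

theorem binE_tilt_sub_one_mul_pow_odd (i : ℕ) :
    binE m (fun s => (tilt m d s - 1) * s ^ (2 * i + 1)) = 0 :=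
  binE_eq_zero_of_odd fun s => by
    rw [Odd.neg_pow ⟨i, rfl⟩, tilt, tilt, neg_sq]; ring

theorem binE_tilt_sub_one_sq_le (hm : 0 < m) (hd0 : 0 ≤ d) (hd : d ≤ 1 / 72) :
    binE m (fun s => (tilt m d s - 1) ^ 2) ≤ 1600 * d ^ 2 := by
  have hm' : (0 : ℝ) < m := by exact_mod_cast hm
  have h1 := tiltZ_le hm hd0 (by linarith)
  have h2 := one_le_tiltZ (m := m) hd0
  -- Squaring doubles the exponent, so the moment bound is applied with `2 * d`; hence the threshold
  -- `1/72`.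
  have hpt : ∀ s, (tilt m d s - 1) ^ 2 ≤
      d ^ 2 / (2 * m ^ 2) * (s ^ (2 * 2) * Real.exp ((2 * d) * (s ^ 2 / m) / 2)) +
        2 * (18 * d) ^ 2 := fun s => by
    have h3 := one_le_exp_tilt (m := m) hd0 s
    have h4 := abs_tilt_sub_one_le (m := m) hd0 s
    have h5 := exp_sub_one_le (d * (s ^ 2 / m) / 2)
    have e : Real.exp ((2 * d) * (s ^ 2 / m) / 2) = Real.exp (d * (s ^ 2 / m) / 2) ^ 2 := by
      rw [← Real.exp_nat_mul]; ring_nf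
    rw [e, ← sq_abs]
    set E := Real.exp (d * (s ^ 2 / m) / 2)
    calc |tilt m d s - 1| ^ 2 ≤ ((d * (s ^ 2 / m) / 2) * E + 18 * d) ^ 2 := by
          gcongr; linarith
      _ ≤ 2 * ((d * (s ^ 2 / m) / 2) * E) ^ 2 + 2 * (18 * d) ^ 2 := by
          nlinarith [sq_nonneg ((d * (s ^ 2 / m) / 2) * E - 18 * d)]
      _ = _ := by field_simp; ring
  refine (binE_mono hpt).trans ?_
  rw [binE_add, binE_const, binE_const_mul]
  have h := binE_pow_mul_exp_le hm (by linarith : 0 ≤ 2 * d) (by linarith) 2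
  calc _ ≤ d ^ 2 / (2 * m ^ 2) * (3 * (12 * (2 : ℕ) * m) ^ 2) + 2 * (18 * d) ^ 2 := by gcongr
    _ = 1512 * d ^ 2 := by push_cast; field_simp; ring
    _ ≤ _ := by nlinarith [sq_nonneg d]

/-- A second moment bounded below and a fourth moment bounded above force a lower bound on the first
absolute moment. -/
theorem le_binE_abs_sq_sub_one (hm : 2 ≤ m) :
    1 / 8192 ≤ binE m (fun s => |s ^ 2 / m - 1|) := by
  have hm' : (2 : ℝ) ≤ m := by exact_mod_cast hm
  have h2 : 1 ≤ binE m (fun s => (s ^ 2 / m - 1) ^ 2) := by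
    -- Up to the factor `2/m` the variable is the degree-two elementary symmetric polynomial, so its
    -- second moment is `2(m - 1)/m`, at least `1` for `m ≥ 2`.
    have e : ∀ x : Cube m, (spinSum Finset.univ x ^ 2 / m - 1) ^ 2 =
        4 / m ^ 2 * (elemSymm 2 Finset.univ x * elemSymm 2 Finset.univ x) := fun x => by
      have h := spinSum_mul_elemSymm Finset.univ 0 x
      simp only [zero_add, elemSymm_one, elemSymm_zero, Finset.card_univ, Fintype.card_fin] at h
      rw [sq (spinSum _ x), h]
      push_cast
      field_simp
      ring
    rw [binE]
    simp only [e]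
    rw [avg_const_mul, avg_elemSymm_mul_elemSymm, if_pos rfl, Finset.inter_self, Finset.card_univ,
      Fintype.card_fin, Nat.cast_choose_two]
    rw [div_mul_div_comm, le_div_iff₀ (by positivity)]
    nlinarith
  have h4 : binE m (fun s => (s ^ 2 / m - 1) ^ 4) ≤ 4096 ^ 2 / 2 := by
    have hpt : ∀ s : ℝ, (s ^ 2 / m - 1) ^ 4 ≤ 8 / m ^ 4 * s ^ (2 * 4) + 8 := fun s => by
      have e : 8 / (m : ℝ) ^ 4 * s ^ (2 * 4) + 8 = 8 * ((s ^ 2 / m) ^ 4 + 1) := by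
        field_simp
      rw [e]
      set u := s ^ 2 / (m : ℝ)
      nlinarith [sq_nonneg (u + 1), sq_nonneg (u ^ 2 - 1), sq_nonneg (u - 1),
        sq_nonneg ((u - 1) ^ 2), sq_nonneg (u * (u + 1)), sq_nonneg (u ^ 2 - (1 : ℝ)),
        sq_nonneg ((u + 1) * (u - 1)), sq_nonneg ((u + 1) ^ 2)]
    refine (binE_mono hpt).trans ?_
    rw [binE_add, binE_const, binE_const_mul]
    have h := binE_pow_le (m := m) (by omega) 4
    calc _ ≤ 8 / (m : ℝ) ^ 4 * (2 * (6 * (4 : ℕ) * m) ^ 4) + 8 := by gcongr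
      _ = 8 * 2 * 24 ^ 4 + 8 := by push_cast; field_simp; ring
      _ ≤ _ := by norm_num
  -- The two terms cover the cases below and above the cutoff `4096`, large enough that the
  -- fourth-power term averages to at most `1/2`.
  have hpt : ∀ s : ℝ, (s ^ 2 / m - 1) ^ 2 ≤
      4096 * |s ^ 2 / m - 1| + 1 / 4096 ^ 2 * (s ^ 2 / m - 1) ^ 4 := fun s => by
    set u := s ^ 2 / (m : ℝ) - 1
    have e : u ^ 4 = |u| ^ 4 := by rw [show 4 = 2 * 2 by rfl, pow_mul, pow_mul, sq_abs]
    rw [e, ← sq_abs]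
    have h0 := abs_nonneg u
    set v := |u|
    by_cases hv : v ≤ 4096
    · have : v ^ 2 ≤ 4096 * v := by nlinarith
      have : 0 ≤ 1 / 4096 ^ 2 * v ^ 4 := by positivity
      linarith
    · have : 4096 ^ 2 * v ^ 2 ≤ v ^ 2 * v ^ 2 := by gcongr; linarith
      have e : v ^ 4 = v ^ 2 * v ^ 2 := by ring
      rw [e]
      linarith
  have := binE_mono (m := m) hpt
  rw [binE_add, binE_const_mul, binE_const_mul] at this
  linarith

/-- To first order in `d` the density is `1 + (d/2)(s^2/m - 1)`. The remainder `r` is nonnegative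
with average `O(d^2)`, negligible for `d` this small. This keeps different members of the family
apart. -/
theorem le_binE_abs_tilt_sub_one (hm : 2 ≤ m) (hd0 : 0 ≤ d) (hd : d ≤ 1 / 2 ^ 26) :
    d / 2 ^ 17 ≤ binE m (fun s => |tilt m d s - 1|) := by
  have hm' : (2 : ℝ) ≤ m := by exact_mod_cast hm
  have hm0 : 0 < m := by omega
  have h1 := tiltZ_le hm0 hd0 (by linarith)
  have h2 := one_le_tiltZ (m := m) hd0
  set r : ℝ → ℝ := fun s => Real.exp (d * (s ^ 2 / m) / 2) - 1 - d * (s ^ 2 / m) / 2 with hr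
  have hr0 : ∀ s, 0 ≤ r s := fun s => by
    have := Real.add_one_le_exp (d * (s ^ 2 / m) / 2)
    simp only [hr]; linarith
  have hr1 : binE m r ≤ 432 * d ^ 2 := by
    have hpt : ∀ s, r s ≤ d ^ 2 / (4 * m ^ 2) * (s ^ (2 * 2) * Real.exp (d * (s ^ 2 / m) / 2)) := by
      intro s
      have h5 := exp_sub_one_le (d * (s ^ 2 / m) / 2)
      have h0 : 0 ≤ d * (s ^ 2 / m) / 2 := by positivity
      have e : d ^ 2 / (4 * m ^ 2) * (s ^ (2 * 2) * Real.exp (d * (s ^ 2 / m) / 2)) =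
        (d * (s ^ 2 / m) / 2) * ((d * (s ^ 2 / m) / 2) * Real.exp (d * (s ^ 2 / m) / 2)) := by
        field_simp; ring
      rw [e]
      simp only [hr]
      set y := d * (s ^ 2 / m) / 2
      nlinarith [mul_le_mul_of_nonneg_left h5 h0]
    refine (binE_mono hpt).trans ?_
    rw [binE_const_mul]
    have h := binE_pow_mul_exp_le hm0 hd0 (by linarith) 2
    calc _ ≤ d ^ 2 / (4 * m ^ 2) * (3 * (12 * (2 : ℕ) * m) ^ 2) := by gcongr
      _ = 432 * d ^ 2 := by push_cast; field_simp; ring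
  have hE2 : binE m (fun s => s ^ 2 / m) = 1 := by
    have e : ∀ x : Cube m, spinSum Finset.univ x ^ 2 / m =
        (m : ℝ)⁻¹ * (elemSymm 1 Finset.univ x * elemSymm 1 Finset.univ x) := fun x => by
      rw [elemSymm_one]; ring
    rw [binE]
    simp only [e]
    rw [avg_const_mul, avg_elemSymm_mul_elemSymm, if_pos rfl, Finset.inter_self, Finset.card_univ,
      Fintype.card_fin, Nat.choose_one_right]
    field_simp
  have hZ : tiltZ m d = binE m r + d / 2 + 1 := by
    have e : ∀ s, Real.exp (d * (s ^ 2 / m) / 2) = (r s + d / 2 * (s ^ 2 / m)) + 1 := fun s => by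
      simp only [hr]; ring
    unfold tiltZ
    simp only [e]
    rw [binE_add, binE_add, binE_const_mul, hE2, binE_const]
    ring
  have hpt : ∀ s : ℝ, d / 2 * |s ^ 2 / m - 1| - r s - binE m r ≤ 2 * |tilt m d s - 1| := fun s => by
    have e : tilt m d s - 1 = (d / 2 * (s ^ 2 / m - 1) + r s - binE m r) / tiltZ m d := by
      rw [tilt, div_sub_one (by linarith)]
      congr 1
      rw [hZ]; simp only [hr]; ring
    have hb : 0 ≤ binE m r := binE_nonneg hr0
    have h6 : |d / 2 * (s ^ 2 / m - 1) + r s - binE m r| = tiltZ m d * |tilt m d s - 1| := by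
      rw [e, abs_div, abs_of_pos (by linarith : 0 < tiltZ m d)]; field_simp
    have h7 : d / 2 * |s ^ 2 / m - 1| = |d / 2 * (s ^ 2 / m - 1)| := by
      rw [abs_mul, abs_of_nonneg (by linarith : 0 ≤ d / 2)]
    have h8 : tiltZ m d * |tilt m d s - 1| ≤ 2 * |tilt m d s - 1| := by
      gcongr; linarith
    have h9 := hr0 s
    rw [h7]
    rw [← h6] at h8
    refine le_trans ?_ h8
    have := abs_sub_abs_le_abs_sub (d / 2 * (s ^ 2 / m - 1)) (-(r s - binE m r))
    have h10 : |-(r s - binE m r)| ≤ r s + binE m r := by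
      rw [abs_neg, abs_le]; constructor <;> linarith
    have h11 : d / 2 * (s ^ 2 / m - 1) - -(r s - binE m r) =
      d / 2 * (s ^ 2 / m - 1) + r s - binE m r := by ring
    rw [h11] at this
    linarith
  have h := binE_mono (m := m) hpt
  rw [binE_sub, binE_sub, binE_const_mul, binE_const, binE_const_mul] at h
  have h3 := le_binE_abs_sq_sub_one hm
  have h4 : d / 2 * (1 / 8192) ≤ d / 2 * binE m (fun s => |s ^ 2 / m - 1|) := by gcongr
  nlinarith

end

/-! ### The coefficients of a polynomial in terms of its `L¹` norm -/

section
open Polynomial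

theorem abs_coeff_chebyshevU_le (l j : ℕ) :
    |(Chebyshev.U ℝ (l : ℤ)).coeff j| ≤ (2 * ((l : ℝ) + 1)) ^ j := by
  induction l using Nat.strong_induction_on generalizing j with
  | _ l ih =>
    match l with
    | 0 =>
      simp only [CharP.cast_eq_zero, Chebyshev.U_zero, coeff_one]
      split_ifs with h
      · simp [h]
      · simp
    | 1 =>
      rw [Nat.cast_one, Chebyshev.U_one, show (2 : ℝ[X]) * X = C 2 * X by rfl, coeff_C_mul, coeff_X]
      split_ifs with h
      · rw [← h]; norm_num
      · rw [mul_zero, abs_zero]; positivity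
    | l + 2 =>
      have h1 := ih (l + 1) (by omega)
      have h0 := ih l (by omega)
      push_cast at *
      rw [Chebyshev.U_add_two, coeff_sub, show (2 : ℝ[X]) * X * Chebyshev.U ℝ ((l : ℤ) + 1) =
        C 2 * (X * Chebyshev.U ℝ ((l : ℤ) + 1)) by rw [mul_assoc]; rfl, coeff_C_mul]
      cases j with
      | zero => simpa using h0 0
      | succ j =>
        rw [coeff_X_mul]
        refine (abs_sub _ _).trans ?_
        rw [abs_mul, abs_two]
        have hl : (0 : ℝ) ≤ l := by positivity
        calc 2 * |(Chebyshev.U ℝ ((l : ℤ) + 1)).coeff j| + |(Chebyshev.U ℝ (l : ℤ)).coeff (j + 1)|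
            ≤ 2 * (2 * (l + 1 + 1)) ^ j + (2 * (l + 1)) ^ (j + 1) :=
              add_le_add (mul_le_mul_of_nonneg_left (h1 j) (by norm_num)) (h0 (j + 1))
          _ ≤ 2 * (2 * (l + 1 + 1)) ^ j + (2 * (l + 1 + 1)) ^ j * (2 * (l + 1)) := by
              rw [pow_succ]; gcongr; linarith
          _ = (2 * (l + 1 + 1)) ^ (j + 1) := by rw [pow_succ]; ring
          _ ≤ (2 * ((l : ℝ) + 2 + 1)) ^ (j + 1) := by gcongr; norm_num

theorem exists_eq_sum_chebyshevU (k : ℕ) : ∀ q : ℝ[X], q.natDegree ≤ k →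
    ∃ b : ℕ → ℝ, q = ∑ l ∈ Finset.range (k + 1), C (b l) * Chebyshev.U ℝ (l : ℤ) := by
  induction k with
  | zero =>
    intro q hq
    refine ⟨fun _ => q.coeff 0, ?_⟩
    simpa using eq_C_of_natDegree_le_zero hq
  | succ k ih =>
    intro q hq
    set u := Chebyshev.U ℝ ((k + 1 : ℕ) : ℤ) with hu
    have hdeg : u.natDegree = k + 1 := by
      have := Chebyshev.degree_U_natCast ℝ (k + 1)
      exact natDegree_eq_of_degree_eq_some this
    have hc : u.coeff (k + 1) ≠ 0 := by
      rw [← hdeg, coeff_natDegree, leadingCoeff_ne_zero]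
      intro h; rw [h, natDegree_zero] at hdeg; omega
    obtain ⟨b, hb⟩ := ih (q - C (q.coeff (k + 1) / u.coeff (k + 1)) * u) <| by
      rw [natDegree_le_iff_coeff_eq_zero]
      intro N hN
      rw [coeff_sub, coeff_C_mul]
      rcases Nat.lt_or_ge (k + 1) N with h | h
      · rw [coeff_eq_zero_of_natDegree_lt (by omega), coeff_eq_zero_of_natDegree_lt (p := u) (hdeg.trans_lt h)]
        simp
      · rw [show N = k + 1 by omega, div_mul_cancel₀ _ hc, sub_self]
    refine ⟨Function.update b (k + 1) (q.coeff (k + 1) / u.coeff (k + 1)), ?_⟩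
    rw [Finset.sum_range_succ, Function.update_self, ← hu]
    rw [Finset.sum_congr rfl fun l hl => by
      rw [Function.update_of_ne (Finset.mem_range.1 hl).ne], ← hb]
    ring

theorem integral_cos_int_mul (n : ℤ) :
    ∫ t in (0 : ℝ)..Real.pi, Real.cos (n * t) = if n = 0 then Real.pi else 0 := by
  split_ifs with h
  · simp [h]
  · have hn : (n : ℝ) ≠ 0 := by exact_mod_cast h
    rw [intervalIntegral.integral_comp_mul_left _ hn, integral_cos]
    simp [Real.sin_int_mul_pi]

theorem integral_sin_mul_sin (a b : ℕ) :
    ∫ t in (0 : ℝ)..Real.pi, Real.sin (((a : ℤ) + 1) * t) * Real.sin (((b : ℤ) + 1) * t) =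
      if a = b then Real.pi / 2 else 0 := by
  have h : ∀ t : ℝ, Real.sin (((a : ℤ) + 1) * t) * Real.sin (((b : ℤ) + 1) * t) =
      (1 / 2) * (Real.cos (((a - b : ℤ) : ℝ) * t) - Real.cos (((a + b + 2 : ℤ) : ℝ) * t)) := by
    intro t
    have h1 : ((a - b : ℤ) : ℝ) * t = ((a : ℤ) + 1) * t - ((b : ℤ) + 1) * t := by push_cast; ring
    have h2 : ((a + b + 2 : ℤ) : ℝ) * t = ((a : ℤ) + 1) * t + ((b : ℤ) + 1) * t := by
      push_cast; ring
    rw [h1, h2, Real.cos_sub, Real.cos_add]; ring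
  simp only [h]
  rw [intervalIntegral.integral_const_mul, intervalIntegral.integral_sub
    (Continuous.intervalIntegrable (by fun_prop) _ _)
    (Continuous.intervalIntegrable (by fun_prop) _ _), integral_cos_int_mul, integral_cos_int_mul,
    if_neg (by omega : ¬ ((a : ℤ) + b + 2 = 0))]
  by_cases hab : a = b
  · simp [hab]; ring
  · rw [if_neg (by omega), if_neg hab]; simp

theorem integral_comp_cos_mul_sin {f : ℝ → ℝ} (hf : Continuous f) :
    ∫ t in (0 : ℝ)..Real.pi, f (Real.cos t) * Real.sin t = ∫ x in (-1 : ℝ)..1, f x := by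
  have h := intervalIntegral.integral_comp_mul_deriv (a := 0) (b := Real.pi) (f := Real.cos)
    (f' := fun t => -Real.sin t) (g := f) (fun t _ => Real.hasDerivAt_cos t)
    (by fun_prop) hf
  simp only [Function.comp_apply, Real.cos_zero, Real.cos_pi, mul_neg,
    intervalIntegral.integral_neg] at h
  rw [intervalIntegral.integral_symm 1 (-1), ← h, neg_neg]

/-- Since `U_l(cos t) sin t = sin((l+1)t)`, the Chebyshev coefficients of `q` are sine Fourier
coefficients of `q(cos t) sin t`. The surviving weight `sin t` is the Jacobian of `x = cos t`, so
these coefficients are bounded by the unweighted `L¹` norm of `q`. -/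
theorem abs_coeff_le_integral {k : ℕ} {q : ℝ[X]} (hq : q.natDegree ≤ k) (j : ℕ) :
    |q.coeff j| ≤ (k + 1) * (2 * ((k : ℝ) + 1)) ^ j * ∫ x in (-1 : ℝ)..1, |q.eval x| := by
  obtain ⟨b, hb⟩ := exists_eq_sum_chebyshevU k q hq
  set I := ∫ x in (-1 : ℝ)..1, |q.eval x| with hI
  have hI0 : 0 ≤ I := intervalIntegral.integral_nonneg (by norm_num) fun _ _ => abs_nonneg _
  have hbl : ∀ l ∈ Finset.range (k + 1), |b l| ≤ I := by
    intro l hl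
    have h1 : ∫ t in (0 : ℝ)..Real.pi, q.eval (Real.cos t) * Real.sin t *
        Real.sin (((l : ℤ) + 1) * t) = b l * (Real.pi / 2) := by
      have e : ∀ t : ℝ, q.eval (Real.cos t) * Real.sin t * Real.sin (((l : ℤ) + 1) * t) =
          ∑ i ∈ Finset.range (k + 1), b i *
            (Real.sin (((i : ℤ) + 1) * t) * Real.sin (((l : ℤ) + 1) * t)) := fun t => by
        conv_lhs => rw [hb]
        rw [eval_finsetSum, Finset.sum_mul, Finset.sum_mul]
        refine Finset.sum_congr rfl fun i _ => ?_
        rw [eval_mul, eval_C, mul_assoc (b i), Chebyshev.U_real_cos, mul_assoc]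
      simp only [e]
      rw [intervalIntegral.integral_finsetSum
        fun i _ => Continuous.intervalIntegrable (by fun_prop) _ _]
      simp only [intervalIntegral.integral_const_mul, integral_sin_mul_sin, mul_ite, mul_zero,
        Finset.sum_ite_eq', if_pos hl]
    have h2 : |b l * (Real.pi / 2)| ≤ I := by
      rw [← h1, hI, ← integral_comp_cos_mul_sin (f := fun x => |q.eval x|) (by fun_prop)]
      refine (intervalIntegral.abs_integral_le_integral_abs Real.pi_pos.le).trans ?_
      refine intervalIntegral.integral_mono_on Real.pi_pos.le
        (Continuous.intervalIntegrable (by fun_prop) _ _)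
        (Continuous.intervalIntegrable (by fun_prop) _ _) fun t ht => ?_
      rw [abs_mul, abs_mul, abs_of_nonneg (Real.sin_nonneg_of_mem_Icc ht)]
      exact mul_le_of_le_one_right (mul_nonneg (abs_nonneg _) (Real.sin_nonneg_of_mem_Icc ht))
        (Real.abs_sin_le_one _)
    rw [abs_mul, abs_of_pos (by positivity : 0 < Real.pi / 2)] at h2
    nlinarith [Real.pi_gt_three, abs_nonneg (b l)]
  have hcoeff : q.coeff j = ∑ l ∈ Finset.range (k + 1), b l * (Chebyshev.U ℝ (l : ℤ)).coeff j := by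
    conv_lhs => rw [hb]
    rw [finsetSum_coeff]
    simp only [coeff_C_mul]
  rw [hcoeff]
  refine (Finset.abs_sum_le_sum_abs _ _).trans ?_
  refine (Finset.sum_le_card_nsmul _ _ (I * (2 * ((k : ℝ) + 1)) ^ j) fun l hl => ?_).trans
    (le_of_eq ?_)
  · rw [abs_mul]
    have : (l : ℝ) ≤ k := by rw [Finset.mem_range] at hl; exact_mod_cast Nat.lt_succ_iff.1 hl
    gcongr
    · exact hbl l hl
    · refine (abs_coeff_chebyshevU_le l j).trans ?_
      gcongr
  · rw [Finset.card_range, nsmul_eq_mul]; push_cast; ring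

end

/-! ### A lower bound on the central binomial probabilities -/

/-- The induction rests on `4n(n + 1) ≤ (2n + 1)^2` and the ratio of successive central binomial
coefficients. -/
theorem sixteen_pow_le (n : ℕ) (hn : 1 ≤ n) : 16 ^ n ≤ 4 * n * n.centralBinom ^ 2 := by
  induction n, hn using Nat.le_induction with
  | base => decide
  | succ n hn ih =>
    have h := Nat.succ_mul_centralBinom_succ n
    refine Nat.le_of_mul_le_mul_left ?_ (Nat.succ_pos n)
    calc (n + 1) * 16 ^ (n + 1) = 16 * (n + 1) * 16 ^ n := by ring
      _ ≤ 16 * (n + 1) * (4 * n * n.centralBinom ^ 2) := Nat.mul_le_mul_left _ ih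
      _ ≤ 16 * (2 * n + 1) ^ 2 * n.centralBinom ^ 2 := by
          rw [← mul_assoc]
          exact Nat.mul_le_mul_right _ (by nlinarith)
      _ = 4 * (2 * (2 * n + 1) * n.centralBinom) ^ 2 := by ring
      _ = (n + 1) * (4 * (n + 1) * (n + 1).centralBinom ^ 2) := by rw [← h]; ring

theorem le_centralBinom (n : ℕ) (hn : 1 ≤ n) : (4 : ℝ) ^ n / (2 * √n) ≤ n.centralBinom := by
  have h : (16 : ℝ) ^ n ≤ 4 * n * n.centralBinom ^ 2 := by exact_mod_cast sixteen_pow_le n hn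
  have hn' : (0 : ℝ) < n := by exact_mod_cast hn
  rw [div_le_iff₀ (by positivity)]
  refine le_of_sq_le_sq ?_ (by positivity)
  rw [mul_pow, mul_pow, Real.sq_sqrt hn'.le, ← pow_mul, mul_comm n, pow_mul]
  norm_num
  linarith

theorem le_choose_middle {m : ℕ} (hm : 1 ≤ m) :
    (2 : ℝ) ^ m / (2 * √m) ≤ m.choose ((m + 1) / 2) := by
  have hm' : (0 : ℝ) < m := by exact_mod_cast hm
  rcases Nat.even_or_odd' m with ⟨n, rfl | rfl⟩
  · rw [show (2 * n + 1) / 2 = n by omega]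
    refine le_trans ?_ (le_centralBinom n (by omega))
    rw [pow_mul]
    norm_num
    have : (0 : ℝ) < n := by exact_mod_cast (by omega : 0 < n)
    gcongr
    have : (1 : ℝ) ≤ √2 := by rw [Real.one_le_sqrt]; norm_num
    nlinarith [Real.sqrt_nonneg (n : ℝ)]
  · rw [show (2 * n + 1 + 1) / 2 = n + 1 by omega]
    have h := le_centralBinom (n + 1) (by omega)
    have h2 : (n + 1).centralBinom = 2 * (2 * n + 1).choose (n + 1) := by
      rw [Nat.centralBinom, show 2 * (n + 1) = 2 * n + 1 + 1 by ring, Nat.choose_succ_succ,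
        Nat.choose_symm_half]
      ring
    rw [h2] at h
    push_cast at h
    have h3 : (2 : ℝ) ^ (2 * n + 1) / (2 * √((2 * n + 1 : ℕ) : ℝ)) ≤
        2 ^ (2 * n + 1) / (2 * √((n : ℝ) + 1)) := by
      have : (n : ℝ) + 1 ≤ (2 * n + 1 : ℕ) := by push_cast; linarith [n.cast_nonneg (α := ℝ)]
      gcongr
    have h4 : (4 : ℝ) ^ (n + 1) / (2 * √((n : ℝ) + 1)) =
        2 * (2 ^ (2 * n + 1) / (2 * √((n : ℝ) + 1))) := by
      rw [pow_succ 2 (2 * n), pow_mul]; norm_num; ring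
    linarith

/-- The ratio of consecutive binomial coefficients at distance `t` from the middle is at least `1 -
x` with `x = 4(t+1)/m`, and `1 - x ≥ exp(-2x)` as `x ≤ 1/2`. The exponents `8(t+1)/m` add up to
`4t(t+1)/m`. -/
theorem choose_middle_add_ge {m : ℕ} (hm : 1 ≤ m) (t : ℕ) (ht : 8 * t ≤ m) :
    (m.choose ((m + 1) / 2) : ℝ) * Real.exp (-(4 * t * (t + 1) / m)) ≤
      m.choose ((m + 1) / 2 + t) := by
  have hm' : (0 : ℝ) < m := by exact_mod_cast hm
  set c := (m + 1) / 2 with hc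
  induction t with
  | zero => simp
  | succ t ih =>
    have ih := ih (by omega)
    have h := Nat.choose_succ_right_eq m (c + t)
    have hct : c + t ≤ m := by omega
    have h' : (m.choose (c + t + 1) : ℝ) * (c + t + 1) = m.choose (c + t) * (m - c - t) := by
      have := congrArg (Nat.cast (R := ℝ)) h
      push_cast [Nat.cast_sub hct] at this
      rw [this]; ring
    have hc2 : 2 * (c : ℝ) ≤ m + 1 := by exact_mod_cast (by omega : 2 * c ≤ m + 1)
    have ht' : 8 * ((t : ℝ) + 1) ≤ m := by exact_mod_cast ht
    set x := 4 * ((t : ℝ) + 1) / m with hx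
    have hx0 : 0 ≤ x := by positivity
    have hx1 : x ≤ 1 / 2 := by rw [hx, div_le_iff₀ hm']; linarith
    have hexp : Real.exp (-(2 * x)) ≤ 1 - x := by
      rw [Real.exp_neg]
      have h1 := Real.add_one_le_exp (2 * x)
      rw [inv_le_comm₀ (Real.exp_pos _) (by linarith)]
      refine le_trans ?_ h1
      rw [inv_le_iff_one_le_mul₀ (by linarith)]
      nlinarith
    have hratio : (1 - x) * (c + t + 1) ≤ m - c - t := by
      have h0 : x * m = 4 * (t + 1) := by rw [hx]; field_simp
      have ht0 : (0 : ℝ) ≤ t := by positivity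
      have h1 : (1 - x) * (c + t + 1) ≤ (1 - x) * ((m + 1) / 2 + t + 1) := by
        gcongr
        · linarith
        · linarith
      nlinarith
    have hpos : (0 : ℝ) < c + t + 1 := by positivity
    rw [← add_assoc, ← mul_le_mul_iff_of_pos_right hpos, h']
    have e : Real.exp (-(4 * (t + 1 : ℕ) * ((t + 1 : ℕ) + 1) / m)) =
        Real.exp (-(4 * t * (t + 1) / m)) * Real.exp (-(2 * x)) := by
      rw [← Real.exp_add]; congr 1; rw [hx]; push_cast; ring
    rw [e]
    calc _ = (m.choose c * Real.exp (-(4 * t * (t + 1) / m))) *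
          (Real.exp (-(2 * x)) * (c + t + 1)) := by ring
      _ ≤ m.choose (c + t) * ((1 - x) * (c + t + 1)) := by gcongr
      _ ≤ _ := by gcongr

/-- The mass of the centred binomial law at a point of a central window. -/
theorem le_choose_div_two_pow {m r i : ℕ} (hm : 1 ≤ m) (hr : 4 * r ≤ m) (h1 : m ≤ 2 * i + r)
    (h2 : 2 * i ≤ m + r) :
    Real.exp (-(2 * (r : ℝ) ^ 2 / m)) / (2 * √m) ≤ (m.choose i : ℝ) / 2 ^ m := by
  wlog h : m ≤ 2 * i generalizing i
  · have := this (i := m - i) (by omega) (by omega) (by omega)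
    rwa [Nat.choose_symm (by omega)] at this
  have hm' : (0 : ℝ) < m := by exact_mod_cast hm
  obtain ⟨t, rfl⟩ : ∃ t, i = (m + 1) / 2 + t := ⟨i - (m + 1) / 2, by omega⟩
  have ht : 2 * t ≤ r := by omega
  have h3 := choose_middle_add_ge hm t (by omega)
  have h4 := le_choose_middle hm
  rw [le_div_iff₀ (by positivity)]
  refine le_trans ?_ h3
  have h5 : 4 * (t : ℝ) * (t + 1) / m ≤ 2 * (r : ℝ) ^ 2 / m := by
    gcongr ?_ / _
    have : 4 * t * (t + 1) ≤ 2 * r ^ 2 := by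
      rcases Nat.eq_zero_or_pos t with rfl | ht0
      · simp
      · nlinarith
    exact_mod_cast this
  calc _ = (2 : ℝ) ^ m / (2 * √m) * Real.exp (-(2 * (r : ℝ) ^ 2 / m)) := by ring
    _ ≤ _ := by gcongr

/-! ### Representing functionals by signed measures with bounded masses -/

/-- A linear functional that is bounded by `β ∑ |v i|` along a linear map to `ι → ℝ` is given by
weights of absolute value at most `β`. -/
theorem exists_weights {V ι : Type*} [AddCommGroup V] [Module ℝ V] [Fintype ι] [DecidableEq ι]
    (E : V →ₗ[ℝ] (ι → ℝ)) (Λ : V →ₗ[ℝ] ℝ) {β : ℝ} (hβ : 0 ≤ β)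
    (h : ∀ v, |Λ v| ≤ β * ∑ i, |E v i|) :
    ∃ ν : ι → ℝ, (∀ i, |ν i| ≤ β) ∧ ∀ v, Λ v = ∑ i, ν i * E v i := by
  -- The bound forces `Λ` to vanish on the kernel of `E`, so it factors through the range of `E`.
  have hker : Λ ∈ (LinearMap.ker E).dualAnnihilator := by
    rw [Submodule.mem_dualAnnihilator]
    intro v hv
    have := h v
    rw [LinearMap.mem_ker.1 hv] at this
    simpa using this
  rw [← LinearMap.range_dualMap_eq_dualAnnihilator_ker] at hker
  obtain ⟨Λ', hΛ'⟩ := hker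
  have hΛ'' : ∀ v, Λ' (E v) = Λ v := fun v => by rw [← hΛ']; rfl
  -- Hahn–Banach with the sublinear function `β` times the `ℓ¹` norm; the values of the extension at
  -- the basis vectors are the weights.
  obtain ⟨g, hg, hgN⟩ := exists_extension_of_le_sublinear
    (⟨LinearMap.range E, Λ'.domRestrict _⟩ : (ι → ℝ) →ₗ.[ℝ] ℝ) (fun v => β * ∑ i, |v i|)
    (fun c hc v => by simp only [Pi.smul_apply, smul_eq_mul, abs_mul, abs_of_pos hc,
                        ← Finset.mul_sum]; ring)
    (fun v w => by
      rw [← mul_add, ← Finset.sum_add_distrib]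
      gcongr
      exact abs_add_le _ _)
    (by
      rintro ⟨_, v, rfl⟩
      change Λ' (E v) ≤ _
      rw [hΛ'']
      exact (le_abs_self _).trans (h v))
  refine ⟨fun i => g (Pi.single i 1), fun i => ?_, fun v => ?_⟩
  · have h1 := hgN (Pi.single i 1)
    have h2 := hgN (-Pi.single i 1)
    have e : ∑ j, |(Pi.single i (1 : ℝ) : ι → ℝ) j| = 1 := by
      rw [Finset.sum_eq_single i (fun j _ hj => by simp [hj]) (by simp)]
      simp
    simp only [map_neg, Pi.neg_apply, abs_neg, e, mul_one] at h1 h2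
    rw [abs_le]
    constructor <;> linarith
  · have h1 := hg ⟨E v, v, rfl⟩
    rw [← hΛ'', ← show g (E v) = Λ' (E v) from h1, LinearMap.pi_apply_eq_sum_univ g (E v)]
    refine Finset.sum_congr rfl fun i _ => ?_
    rw [smul_eq_mul, mul_comm]
    congr 2
    ext j
    simp [Pi.single_apply, eq_comm]


section
open Polynomial

/-! ### The `L¹` norm of a polynomial on a lattice -/

theorem integral_abs_le_riemann {f : ℝ → ℝ} (hf : Continuous f) {K : ℝ} (r : ℕ) (hr : 0 < r)
    (hK : ∀ x ∈ Set.Icc (-1 : ℝ) 1, ∀ y ∈ Set.Icc (-1 : ℝ) 1, |f x - f y| ≤ K * |x - y|) :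
    ∫ x in (-1 : ℝ)..1, |f x| ≤
      2 / r * ∑ i ∈ Finset.range r, |f (-1 + 2 * i / r)| + 4 * K / r := by
  have hr' : (0 : ℝ) < r := by exact_mod_cast hr
  set a : ℕ → ℝ := fun i => -1 + 2 * i / r with ha
  have ha0 : a 0 = -1 := by simp [ha]
  have har : a r = 1 := by simp only [ha]; field_simp; norm_num
  have hint : ∀ u v : ℝ, IntervalIntegrable (fun x => |f x|) volume u v :=
    fun u v => hf.abs.intervalIntegrable u v
  have hsplit := intervalIntegral.sum_integral_adjacent_intervals (a := a) (n := r)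
    fun i _ => hint _ _
  rw [ha0, har] at hsplit
  rw [← hsplit]
  have hmem : ∀ i ≤ r, ∀ x, a i ≤ x → x ≤ 1 → x ∈ Set.Icc (-1 : ℝ) 1 := fun i _ x h1 h2 => by
    refine ⟨le_trans ?_ h1, h2⟩
    simp only [ha]
    have : (0 : ℝ) ≤ 2 * i / r := by positivity
    linarith
  have hstep : ∀ i, a (i + 1) = a i + 2 / r := fun i => by
    simp only [ha]; push_cast; ring
  have hK0 : 0 ≤ K := by
    have := hK 1 (by norm_num) (-1) (by norm_num)
    have h2 := abs_nonneg (f 1 - f (-1))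
    norm_num at this
    linarith
  have h1 : ∀ i ∈ Finset.range r, ∫ x in a i..a (i + 1), |f x| ≤
      2 / r * |f (a i)| + 2 / r * (K * (2 / r)) := by
    intro i hi
    have hi' : i + 1 ≤ r := Finset.mem_range.1 hi
    have hle : a i ≤ a (i + 1) := by rw [hstep]; linarith [div_pos two_pos hr']
    have hle1 : a (i + 1) ≤ 1 := by
      rw [← har]; simp only [ha]
      have : ((i + 1 : ℕ) : ℝ) ≤ r := by exact_mod_cast hi'
      gcongr
    calc ∫ x in a i..a (i + 1), |f x| ≤ ∫ _x in a i..a (i + 1), (|f (a i)| + K * (2 / r)) := by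
          refine intervalIntegral.integral_mono_on hle (hint _ _)
            (continuous_const.intervalIntegrable _ _) fun x hx => ?_
          have h2 := hK x (hmem i (by omega) x hx.1 (hx.2.trans hle1)) (a i)
            (hmem i (by omega) _ le_rfl (hle.trans hle1))
          have h3 := abs_sub_abs_le_abs_sub (f x) (f (a i))
          have h4 : |x - a i| ≤ 2 / r := by
            rw [abs_of_nonneg (by linarith [hx.1])]
            have := hx.2; rw [hstep] at this; linarith
          have h5 : K * |x - a i| ≤ K * (2 / r) := by gcongr
          linarith
      _ = _ := by
          rw [intervalIntegral.integral_const, hstep, smul_eq_mul]; ring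
  refine (Finset.sum_le_sum h1).trans (le_of_eq ?_)
  rw [Finset.sum_add_distrib, ← Finset.mul_sum, Finset.sum_const, Finset.card_range, nsmul_eq_mul]
  congr 1
  field_simp
  ring

theorem abs_eval_sub_eval_le {k : ℕ} {p : ℝ[X]} (hp : p.natDegree ≤ k) {B : ℝ}
    (hB : ∀ j ≤ k, |p.coeff j| ≤ B) {x y : ℝ} (hx : x ∈ Set.Icc (-1 : ℝ) 1)
    (hy : y ∈ Set.Icc (-1 : ℝ) 1) :
    |p.eval x - p.eval y| ≤ (k + 1) * k * B * |x - y| := by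
  rw [eval_eq_sum_range' (Nat.lt_succ_of_le hp), eval_eq_sum_range' (Nat.lt_succ_of_le hp),
    ← Finset.sum_sub_distrib]
  refine (Finset.abs_sum_le_sum_abs _ _).trans ?_
  refine (Finset.sum_le_card_nsmul _ _ (B * (|x - y| * k)) fun j hj => ?_).trans (le_of_eq ?_)
  · have hj' : j ≤ k := Nat.lt_succ_iff.1 (Finset.mem_range.1 hj)
    rw [← mul_sub, abs_mul]
    have hB0 : 0 ≤ B := (abs_nonneg _).trans (hB j hj')
    refine mul_le_mul (hB j hj') ?_ (abs_nonneg _) hB0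
    refine (abs_pow_sub_pow_le x y j).trans ?_
    have h1 : max |x| |y| ^ (j - 1) ≤ 1 :=
      pow_le_one₀ (le_max_of_le_left (abs_nonneg _)) (max_le (abs_le.2 hx) (abs_le.2 hy))
    have h2 : (j : ℝ) ≤ k := by exact_mod_cast hj'
    calc _ ≤ |x - y| * j * 1 := by gcongr
      _ ≤ _ := by rw [mul_one]; gcongr
  · rw [Finset.card_range, nsmul_eq_mul]; push_cast; ring

/-- The coefficients of a polynomial are controlled by its `L¹` norm on a fine lattice. -/
theorem abs_coeff_mul_pow_le {k r : ℕ} (hr : 8 * (2 * (k + 1)) ^ (k + 3) ≤ r) {q : ℝ[X]}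
    (hq : q.natDegree ≤ k) (j : ℕ) :
    |q.coeff j| * (r : ℝ) ^ j ≤ (k + 1) * (2 * ((k : ℝ) + 1)) ^ j *
      (4 / r * ∑ i ∈ Finset.range (r + 1), |q.eval (-(r : ℝ) + 2 * i)|) := by
  have hr0 : 0 < r := lt_of_lt_of_le (by positivity) hr
  have hr' : (0 : ℝ) < r := by exact_mod_cast hr0
  -- Rescaling the window to `[-1, 1]` multiplies the `j`-th coefficient by `r ^ j`.
  set p := q.comp (C (r : ℝ) * X) with hp
  have hcoeff : ∀ j, p.coeff j = q.coeff j * r ^ j := fun j => by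
    rw [hp, comp_C_mul_X_coeff]
  have heval : ∀ x, p.eval x = q.eval (r * x) := fun x => by simp [hp, eval_comp]
  have hdeg : p.natDegree ≤ k := by
    rw [natDegree_le_iff_coeff_eq_zero]
    intro N hN
    rw [hcoeff, coeff_eq_zero_of_natDegree_lt (by omega), zero_mul]
  set I := ∫ x in (-1 : ℝ)..1, |p.eval x| with hI
  have hI0 : 0 ≤ I := intervalIntegral.integral_nonneg (by norm_num) fun _ _ => abs_nonneg _
  have hc := abs_coeff_le_integral hdeg
  rw [← hI] at hc
  have hB : ∀ j ≤ k, |p.coeff j| ≤ (k + 1) * (2 * ((k : ℝ) + 1)) ^ k * I := fun j hj => by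
    refine (hc j).trans ?_
    have : (1 : ℝ) ≤ 2 * (k + 1) := by linarith [k.cast_nonneg (α := ℝ)]
    gcongr
  have hR := integral_abs_le_riemann (f := fun x => p.eval x) (by fun_prop) r hr0
    (K := (k + 1) * k * ((k + 1) * (2 * ((k : ℝ) + 1)) ^ k * I))
    (fun x hx y hy => abs_eval_sub_eval_le hdeg hB hx hy)
  rw [← hI] at hR
  have hK : (k + 1) * k * ((k + 1) * (2 * ((k : ℝ) + 1)) ^ k * I) ≤
      (2 * ((k : ℝ) + 1)) ^ (k + 3) * I := by
    have h1 : ((k : ℝ) + 1) * k * (k + 1) ≤ (2 * ((k : ℝ) + 1)) ^ 3 := by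
      have : (0 : ℝ) ≤ k := by positivity
      nlinarith [pow_nonneg this 2, pow_nonneg this 3]
    calc _ = (((k : ℝ) + 1) * k * (k + 1)) * ((2 * ((k : ℝ) + 1)) ^ k * I) := by ring
      _ ≤ (2 * ((k : ℝ) + 1)) ^ 3 * ((2 * ((k : ℝ) + 1)) ^ k * I) := by gcongr
      _ = _ := by rw [pow_add]; ring
  have hrr : 8 * (2 * ((k : ℝ) + 1)) ^ (k + 3) ≤ r := by exact_mod_cast hr
  -- The Lipschitz constant of `p` is itself controlled by its `L¹` norm `I`, so for `r` this large
  -- the discretisation error is at most `I / 2` and can be absorbed.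
  have herr : 4 * ((k + 1) * k * ((k + 1) * (2 * ((k : ℝ) + 1)) ^ k * I)) / r ≤ I / 2 := by
    rw [div_le_iff₀ hr']
    have : 8 * (2 * ((k : ℝ) + 1)) ^ (k + 3) * I ≤ r * I := by gcongr
    linarith
  have hsum : ∑ i ∈ Finset.range r, |p.eval (-1 + 2 * (i : ℝ) / r)| ≤
      ∑ i ∈ Finset.range (r + 1), |q.eval (-(r : ℝ) + 2 * i)| := by
    rw [Finset.sum_range_succ]
    refine le_add_of_le_of_nonneg (Finset.sum_le_sum fun i _ => ?_) (abs_nonneg _)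
    rw [heval]
    refine le_of_eq ?_
    congr 3
    field_simp
  have hfin : I ≤ 4 / r * ∑ i ∈ Finset.range (r + 1), |q.eval (-(r : ℝ) + 2 * i)| := by
    have h2 : 2 / (r : ℝ) * ∑ i ∈ Finset.range r, |p.eval (-1 + 2 * (i : ℝ) / r)| ≤
      2 / r * ∑ i ∈ Finset.range (r + 1), |q.eval (-(r : ℝ) + 2 * i)| := by gcongr
    have e : 4 / (r : ℝ) * ∑ i ∈ Finset.range (r + 1), |q.eval (-(r : ℝ) + 2 * i)| =
      2 * (2 / r * ∑ i ∈ Finset.range (r + 1), |q.eval (-(r : ℝ) + 2 * i)|) := by ring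
    rw [e]
    linarith
  calc |q.coeff j| * (r : ℝ) ^ j = |p.coeff j| := by rw [hcoeff, abs_mul, abs_pow, Nat.abs_cast]
    _ ≤ _ := (hc j).trans (by gcongr)

/-- The summands are dominated by a geometric series of ratio `1/2` with first term `2304 y`. In the
application `y = (k+1)^2 m / r^2` measures the window against the standard deviation, and `hyk`
becomes the requirement that `r^2` exceed a multiple of `(k+1)^3 m`. -/
theorem sum_moment_bound {k : ℕ} {y : ℝ} (hy : 0 ≤ y) (hyk : 384 * y * (k + 1) ≤ 1) :
    ∑ i ∈ Finset.Icc 1 (k / 2), (4 * y) ^ i * (12 * ((i : ℝ) + 1)) ^ (i + 1) ≤ 4608 * y := by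
  have h : ∀ i ∈ Finset.Icc 1 (k / 2), (4 * y) ^ i * (12 * ((i : ℝ) + 1)) ^ (i + 1) ≤
      2304 * y * (1 / 2) ^ (i - 1) := by
    intro i hi
    rw [Finset.mem_Icc] at hi
    obtain ⟨n, rfl⟩ : ∃ n, i = n + 1 := ⟨i - 1, by omega⟩
    have h1 : ((n + 1 : ℕ) : ℝ) + 1 ≤ k + 1 := by
      have : ((n + 1 : ℕ) : ℝ) ≤ k := by exact_mod_cast (by omega : n + 1 ≤ k)
      linarith
    have h2 : (((n + 1 : ℕ) : ℝ) + 1) ^ 2 ≤ 4 ^ (n + 1) := by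
      have : (n + 2 : ℕ) ≤ 2 ^ (n + 1) := Nat.lt_two_pow_self
      have h3 : ((n + 2 : ℕ) : ℝ) ≤ 2 ^ (n + 1) := by exact_mod_cast this
      calc (((n + 1 : ℕ) : ℝ) + 1) ^ 2 = ((n + 2 : ℕ) : ℝ) ^ 2 := by push_cast; ring
        _ ≤ (2 ^ (n + 1)) ^ 2 := by gcongr
        _ = 4 ^ (n + 1) := by rw [← pow_mul, mul_comm, pow_mul]; norm_num
    set t := ((n + 1 : ℕ) : ℝ) + 1 with ht
    have ht0 : 0 ≤ t := by positivity
    rw [show n + 1 - 1 = n by omega]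
    calc (4 * y) ^ (n + 1) * (12 * t) ^ (n + 1 + 1)
        = (4 * y) ^ (n + 1) * 12 ^ (n + 2) * (t ^ n * t ^ 2) := by
          rw [mul_pow 12, ← pow_add]; ring
      _ ≤ (4 * y) ^ (n + 1) * 12 ^ (n + 2) * ((k + 1) ^ n * 4 ^ (n + 1)) := by gcongr
      _ = 2304 * y * (192 * y * (k + 1)) ^ n := by
          have e : (192 : ℝ) ^ n = 4 ^ n * 12 ^ n * 4 ^ n := by
            rw [← mul_pow, ← mul_pow]; norm_num
          rw [mul_pow (192 * y), mul_pow 192 y, e, pow_succ, mul_pow 4 y]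
          ring
      _ ≤ 2304 * y * (1 / 2) ^ n := by
          gcongr
          linarith
  refine (Finset.sum_le_sum h).trans ?_
  rw [← Finset.mul_sum]
  have h2 : ∑ i ∈ Finset.Icc 1 (k / 2), (1 / 2 : ℝ) ^ (i - 1) ≤ 2 := by
    rw [← Finset.Ico_add_one_right_eq_Icc, Finset.sum_Ico_eq_sum_range]
    simp only [Nat.add_sub_cancel, Nat.add_sub_cancel_left]
    exact sum_geometric_two_le _
  nlinarith

/-- The defect functional of the clique Ising model is bounded by a small multiple of the `L¹` norm
on a central window of the lattice. -/
theorem abs_binE_tilt_sub_one_mul_eval_le {m k r : ℕ} {d : ℝ} (hm : 0 < m) (hd0 : 0 ≤ d)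
    (hd : d ≤ 1 / 36) (hr : 8 * (2 * (k + 1)) ^ (k + 3) ≤ r) (hr2 : 384 * (k + 1) ^ 3 * m ≤ r ^ 2)
    {q : ℝ[X]} (hq : q.natDegree ≤ k) :
    |binE m (fun s => (tilt m d s - 1) * q.eval s)| ≤
      92160 * d * (k + 1) ^ 3 * m / r ^ 3 *
        ∑ i ∈ Finset.range (r + 1), |q.eval (-(r : ℝ) + 2 * i)| := by
  have hm' : (0 : ℝ) < m := by exact_mod_cast hm
  have hr0 : (0 : ℝ) < r := by exact_mod_cast lt_of_lt_of_le (by positivity) hr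
  set N := 4 / (r : ℝ) * ∑ i ∈ Finset.range (r + 1), |q.eval (-(r : ℝ) + 2 * i)| with hN
  have hN0 : 0 ≤ N := by positivity
  have h1 : binE m (fun s => (tilt m d s - 1) * q.eval s) =
      ∑ j ∈ Finset.range (k + 1), q.coeff j * binE m (fun s => (tilt m d s - 1) * s ^ j) := by
    simp only [eval_eq_sum_range' (Nat.lt_succ_of_le hq), Finset.mul_sum]
    rw [binE_sum]
    refine Finset.sum_congr rfl fun j _ => ?_
    rw [← binE_const_mul]
    congr 1
    ext s
    ring
  -- Total mass and, by symmetry, the odd moments already agree with the uniform ones, so only the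
  -- positive even degrees contribute.
  have h0 : binE m (fun s => (tilt m d s - 1) * s ^ 0) = 0 := by
    simp only [pow_zero, mul_one]
    rw [binE_sub, binE_tilt hd0, binE_const, sub_self]
  have h2 : ∑ j ∈ Finset.range (k + 1), q.coeff j * binE m (fun s => (tilt m d s - 1) * s ^ j) =
      ∑ i ∈ Finset.Icc 1 (k / 2), q.coeff (2 * i) *
        binE m (fun s => (tilt m d s - 1) * s ^ (2 * i)) := by
    symm
    refine Finset.sum_of_injOn (fun i => 2 * i) (fun i _ j _ h => by simpa using h) ?_ ?_
      (fun _ _ => rfl)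
    · intro i hi
      simp only [Finset.coe_Icc, Set.mem_Icc, Finset.coe_range, Set.mem_Iio] at hi ⊢
      omega
    · intro j hj hj'
      rcases Nat.even_or_odd' j with ⟨i, rfl | rfl⟩
      · rcases Nat.eq_zero_or_pos i with rfl | hi
        · rw [mul_zero, h0, mul_zero]
        · refine absurd ⟨i, ?_, rfl⟩ hj'
          simp only [Finset.coe_Icc, Set.mem_Icc]
          rw [Finset.mem_range] at hj
          omega
      · rw [binE_tilt_sub_one_mul_pow_odd, mul_zero]
  rw [h1, h2]
  set y : ℝ := (k + 1) ^ 2 * m / r ^ 2 with hy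
  have hy0 : 0 ≤ y := by positivity
  have hyk : 384 * y * (k + 1) ≤ 1 := by
    have : 384 * ((k : ℝ) + 1) ^ 3 * m ≤ r ^ 2 := by exact_mod_cast hr2
    rw [hy, mul_div_assoc', div_mul_eq_mul_div, div_le_one (by positivity)]
    linarith
  have hterm : ∀ i ∈ Finset.Icc 1 (k / 2), |q.coeff (2 * i) *
      binE m (fun s => (tilt m d s - 1) * s ^ (2 * i))| ≤
      ((k + 1) * N * (5 * d)) * ((4 * y) ^ i * (12 * ((i : ℝ) + 1)) ^ (i + 1)) := by
    intro i _
    rw [abs_mul]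
    have h3 := abs_coeff_mul_pow_le hr hq (2 * i)
    rw [← hN] at h3
    have h4 := abs_binE_tilt_sub_one_mul_pow_le hm hd0 hd i
    have hrp : (0 : ℝ) < r ^ (2 * i) := by positivity
    rw [← le_div_iff₀ hrp] at h3
    refine (mul_le_mul h3 h4 (abs_nonneg _) (by positivity)).trans (le_of_eq ?_)
    rw [hy, pow_mul (2 * ((k : ℝ) + 1)) 2 i, pow_mul (r : ℝ) 2 i, mul_pow _ (m : ℝ) (i + 1),
      show (2 * ((k : ℝ) + 1)) ^ 2 = 4 * (k + 1) ^ 2 by ring, mul_pow 4 _ i, mul_pow 4 _ i, div_pow,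
      mul_pow _ (m : ℝ) i, pow_succ (m : ℝ) i]
    field_simp
  refine (Finset.abs_sum_le_sum_abs _ _).trans ((Finset.sum_le_sum hterm).trans ?_)
  rw [← Finset.mul_sum]
  refine (mul_le_mul_of_nonneg_left (sum_moment_bound hy0 hyk) (by positivity)).trans (le_of_eq ?_)
  rw [hN, hy]
  field_simp
  ring

end

section
open Polynomial

/-! ### A corruption of the clique Ising model that matches moments with the uniform distribution -/

/-- The defect functional is represented by weights `ν` on the window, and `g` is `-ν` divided by
the binomial mass. Hypothesis `hβ` says that the weights are at most half of that mass, whence the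
bound on `g`; the mass of the correction is at most `β` for each of the `r + 1` points. -/
theorem exists_correction {m k r i₀ : ℕ} {d : ℝ} (hm : m = r + 2 * i₀) (hrm : 4 * r ≤ m)
    (hd0 : 0 ≤ d) (hd : d ≤ 1 / 36) (hr : 8 * (2 * (k + 1)) ^ (k + 3) ≤ r)
    (hr2 : 384 * (k + 1) ^ 3 * m ≤ r ^ 2)
    (hβ : 92160 * d * (k + 1) ^ 3 * m / r ^ 3 ≤ Real.exp (-(2 * (r : ℝ) ^ 2 / m)) / (4 * √m)) :
    ∃ g : ℝ → ℝ, (∀ q : ℝ[X], q.natDegree ≤ k →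
        binE m (fun s => (tilt m d s - 1 + g s) * q.eval s) = 0) ∧ (∀ s, |g s| ≤ 1 / 2) ∧
      binE m (fun s => |g s|) ≤ (r + 1) * (92160 * d * (k + 1) ^ 3 * m / r ^ 3) := by
  have hr0 : 0 < r := lt_of_lt_of_le (by positivity) hr
  have hm0 : 0 < m := by omega
  set β := 92160 * d * (k + 1) ^ 3 * m / (r : ℝ) ^ 3 with hβdef
  have hβ0 : 0 ≤ β := by positivity
  let E : degreeLE ℝ (k : WithBot ℕ) →ₗ[ℝ] (Fin (r + 1) → ℝ) :=
    { toFun := fun q i => q.1.eval (-(r : ℝ) + 2 * (i : ℕ))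
      map_add' := fun p q => by ext i; simp
      map_smul' := fun c q => by ext i; simp }
  let Λ : degreeLE ℝ (k : WithBot ℕ) →ₗ[ℝ] ℝ :=
    { toFun := fun q => binE m (fun s => (tilt m d s - 1) * q.1.eval s)
      map_add' := fun p q => by
        rw [← binE_add]; congr 1; ext s; simp only [Submodule.coe_add, eval_add]; ring
      map_smul' := fun c q => by
        rw [RingHom.id_apply, smul_eq_mul, ← binE_const_mul]; congr 1; ext s
        simp only [Submodule.coe_smul, eval_smul, smul_eq_mul]; ring }
  have hdeg : ∀ q : degreeLE ℝ (k : WithBot ℕ), q.1.natDegree ≤ k := fun q =>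
    natDegree_le_iff_degree_le.2 (mem_degreeLE.1 q.2)
  obtain ⟨ν, hν, hνΛ⟩ := exists_weights E Λ hβ0 fun q => by
    have h := abs_binE_tilt_sub_one_mul_eval_le hm0 hd0 hd hr hr2 (hdeg q)
    rw [Finset.sum_range] at h
    exact h
  set U : ℕ → ℝ := fun i => (m.choose i : ℝ) / 2 ^ m with hU
  -- The index reversal matches the binomial index `i` with the spin sum: for `i = i₀ + r - j` the
  -- value `m - 2i` is `-r + 2j`.
  set w : ℕ → ℝ := fun i => if h : i₀ ≤ i ∧ i ≤ i₀ + r then ν ⟨i₀ + r - i, by omega⟩ else 0 with hw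
  have hwU : ∀ i, |w i| ≤ U i / 2 := fun i => by
    simp only [hw]
    split_ifs with h
    · have h1 := le_choose_div_two_pow (i := i) hm0 hrm (by omega) (by omega)
      refine (hν _).trans (hβ.trans ?_)
      have e : Real.exp (-(2 * (r : ℝ) ^ 2 / m)) / (4 * √m) =
        Real.exp (-(2 * (r : ℝ) ^ 2 / m)) / (2 * √m) / 2 := by
        rw [div_div]; congr 1; ring
      rw [e]
      simp only [hU]
      linarith
    · rw [abs_zero]; positivity
  -- The floor recovers `i` from `s = m - 2i`. Off the lattice the value is immaterial, but the
  -- bound `|g| ≤ 1/2` still holds there.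
  set g : ℝ → ℝ := fun s => -(w ⌊(m - s) / 2⌋₊ / U ⌊(m - s) / 2⌋₊) with hg
  have hfloor : ∀ i : ℕ, ⌊((m : ℝ) - (m - 2 * i)) / 2⌋₊ = i := fun i => by
    rw [show ((m : ℝ) - (m - 2 * i)) / 2 = i by ring, Nat.floor_natCast]
  have hUg : ∀ i ∈ Finset.range (m + 1), U i * g (m - 2 * i) = -w i := fun i hi => by
    have : U i ≠ 0 := by
      have := Nat.choose_pos (Nat.lt_succ_iff.1 (Finset.mem_range.1 hi))
      simp only [hU]; positivity
    simp only [hg, hfloor]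
    field_simp
  have hsum : ∀ F : ℕ → ℝ, (∀ i, w i = 0 → F i = 0) →
      ∑ i ∈ Finset.range (m + 1), F i = ∑ j : Fin (r + 1), F (i₀ + r - j) := by
    intro F hF
    symm
    refine Finset.sum_of_injOn (fun j : Fin (r + 1) => i₀ + r - j) ?_ ?_ ?_ (fun _ _ => rfl)
    · intro i _ j _ h
      simp only at h
      ext; omega
    · intro j _
      simp only [Finset.coe_range, Set.mem_Iio]
      omega
    · intro i _ hi
      refine hF i ?_
      simp only [hw]
      rw [dif_neg]
      intro h
      exact hi ⟨⟨i₀ + r - i, by omega⟩, by simp, by simp only; omega⟩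
  have hwν : ∀ j : Fin (r + 1), w (i₀ + r - j) = ν j := fun j => by
    simp only [hw]
    rw [dif_pos (by omega)]
    congr 1
    ext
    simp only
    omega
  refine ⟨g, fun q hq => ?_, fun s => ?_, ?_⟩
  · have h1 : binE m (fun s => g s * q.eval s) =
        -binE m (fun s => (tilt m d s - 1) * q.eval s) := by
      have h2 := hνΛ ⟨q, mem_degreeLE.2 (natDegree_le_iff_degree_le.1 hq)⟩
      change binE m (fun s => (tilt m d s - 1) * q.eval s) =
        ∑ j : Fin (r + 1), ν j * q.eval (-(r : ℝ) + 2 * (j : ℕ)) at h2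
      rw [h2, binE_eq_sum]
      rw [Finset.sum_congr rfl fun i hi => by
        rw [← mul_assoc, show (m.choose i : ℝ) / 2 ^ m * g (m - 2 * i) = -w i from hUg i hi]]
      rw [hsum _ (fun i hi => by rw [hi]; ring), ← Finset.sum_neg_distrib]
      refine Finset.sum_congr rfl fun j _ => ?_
      have hj : (j : ℕ) ≤ i₀ + r := by omega
      rw [hwν, Nat.cast_sub hj, hm]
      push_cast
      rw [show (r : ℝ) + 2 * i₀ - 2 * (i₀ + r - j) = -r + 2 * j by ring]
      ring
    simp only [add_mul]
    rw [binE_add, h1, add_neg_cancel]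
  · simp only [hg, abs_neg, abs_div]
    have h1 := hwU ⌊(m - s) / 2⌋₊
    have h2 : 0 ≤ U ⌊(m - s) / 2⌋₊ := by simp only [hU]; positivity
    rw [abs_of_nonneg h2]
    refine div_le_of_le_mul₀ h2 (by norm_num) ?_
    linarith
  · rw [binE_eq_sum]
    have h1 : ∀ i ∈ Finset.range (m + 1), (m.choose i : ℝ) / 2 ^ m * |g (m - 2 * i)| = |w i| := by
      intro i hi
      have h2 : 0 ≤ U i := by simp only [hU]; positivity
      rw [← abs_neg (w i), ← hUg i hi, abs_mul, abs_of_nonneg h2]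
    rw [Finset.sum_congr rfl h1, hsum _ (fun i hi => by rw [hi, abs_zero])]
    refine (Finset.sum_le_card_nsmul _ _ β fun j _ => ?_).trans (le_of_eq ?_)
    · rw [hwν]; exact hν j
    · rw [Finset.card_univ, Fintype.card_fin, nsmul_eq_mul]; push_cast; ring

/-- The half-width must have the parity of `m`, so it is either `⌈D/4⌉` or the next integer; `D ≥ 8`
leaves room for both below `D/2`. -/
theorem exists_window {m : ℕ} {D : ℝ} (hD : 8 ≤ D) (hDm : 2 * D ≤ m) :
    ∃ r i₀ : ℕ, m = r + 2 * i₀ ∧ D / 4 ≤ r ∧ (r : ℝ) ≤ D / 2 := by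
  set n := ⌈D / 4⌉₊ with hn
  have h1 : D / 4 ≤ n := Nat.le_ceil _
  have h2 : (n : ℝ) < D / 4 + 1 := Nat.ceil_lt_add_one (by linarith)
  have h3 : n + 1 ≤ m := by
    have : (n : ℝ) + 1 ≤ m := by linarith
    exact_mod_cast this
  rcases Nat.even_or_odd' (m - n) with ⟨i, hi | hi⟩
  · exact ⟨n, i, by omega, h1, by linarith⟩
  · exact ⟨n + 1, i, by omega, by push_cast; linarith, by push_cast; linarith⟩

theorem pow_le_exp_half {k : ℕ} {L : ℝ} (hk : 1 ≤ k) (hLk : 2 ^ 44 * (k : ℝ) ^ 3 ≤ L) :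
    32 * (2 * ((k : ℝ) + 1)) ^ (k + 3) ≤ Real.exp (L / 2) := by
  have hk' : (1 : ℝ) ≤ k := by exact_mod_cast hk
  have h2 : 2 * ((k : ℝ) + 1) ≤ Real.exp (4 * k) := by
    linarith [Real.add_one_le_exp (4 * (k : ℝ))]
  have h3 : (32 : ℝ) ≤ Real.exp 5 := by
    have := Real.exp_one_gt_d9
    calc (32 : ℝ) = 2 ^ 5 := by norm_num
      _ ≤ Real.exp 1 ^ 5 := by gcongr; linarith
      _ = Real.exp 5 := by rw [← Real.exp_nat_mul]; norm_num
  have h5 : 5 + ((k + 3 : ℕ) : ℝ) * (4 * k) ≤ L / 2 := by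
    push_cast
    have hk2 : (k : ℝ) ^ 2 ≤ k ^ 3 := pow_le_pow_right₀ hk' (by norm_num)
    have hk21 : (k : ℝ) ≤ k ^ 2 := by nlinarith
    linarith
  calc 32 * (2 * ((k : ℝ) + 1)) ^ (k + 3) ≤ Real.exp 5 * Real.exp (4 * k) ^ (k + 3) := by gcongr
    _ = Real.exp (5 + ((k + 3 : ℕ) : ℝ) * (4 * k)) := by
        rw [← Real.exp_nat_mul, ← Real.exp_add]
    _ ≤ Real.exp (L / 2) := Real.exp_le_exp.2 h5

set_option maxHeartbeats 800000 in
/-- The moment-matching corruption in the regime `ε ≤ 37 δ`. -/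
theorem exists_density {c ε δ : ℝ} {k m : ℕ} (hc0 : 0 < c) (hc : c ≤ 1 / 2 ^ 50) (hk : 1 ≤ k)
    (hε0 : 0 < ε) (hδ : δ = c * (ε * Real.log (1 / ε) / (k : ℝ) ^ 3))
    (hεδ : ε ≤ 37 * δ) (hm : 1 / ε ≤ m) :
    ∃ h : ℝ → ℝ, (∀ q : ℝ[X], q.natDegree ≤ k → binE m (fun s => h s * q.eval s) = 0) ∧
      (∀ s, 0 ≤ 1 + h s) ∧ binE m (fun s => |h s - (tilt m δ s - 1)|) ≤ ε ∧
      binE m (fun s => h s ^ 2) ≤ 38 * δ ∧ δ / 2 ^ 18 ≤ binE m (fun s => |h s|) := by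
  set L := Real.log (1 / ε) with hL
  have hk' : (1 : ℝ) ≤ k := by exact_mod_cast hk
  have hk3 : (1 : ℝ) ≤ (k : ℝ) ^ 3 := one_le_pow₀ hk'
  have hδ0 : 0 < δ := by linarith
  have hexpL : Real.exp L = 1 / ε := Real.exp_log (by positivity)
  -- Here `ε ≤ 37 * δ` enters: it reads `k^3 ≤ 37 * c * L`, and `c` is tiny.
  have hLk : 2 ^ 44 * (k : ℝ) ^ 3 ≤ L := by
    rw [hδ] at hεδ
    have h1 : 1 ≤ 37 * (c * (L / k ^ 3)) := by
      have : ε * 1 ≤ ε * (37 * (c * (L / k ^ 3))) := by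
        calc ε * 1 = ε := mul_one _
          _ ≤ _ := hεδ
          _ = _ := by ring
      exact le_of_mul_le_mul_left this hε0
    have h2 : (k : ℝ) ^ 3 ≤ 37 * (c * L) := by
      have : 37 * (c * (L / (k : ℝ) ^ 3)) = 37 * (c * L) / (k : ℝ) ^ 3 := by ring
      rw [this, le_div_iff₀ (by positivity)] at h1
      linarith
    have hL0 : 0 < L := by
      have : 0 < c * L := by linarith
      exact (mul_pos_iff_of_pos_left hc0).1 this
    have h3 : c * L ≤ 1 / 2 ^ 50 * L := by gcongr
    linarith
  have hL1 : 2 ^ 44 ≤ L := by linarith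
  have hmL : Real.exp L ≤ m := hexpL ▸ hm
  have hm0' : (0 : ℝ) < m := (Real.exp_pos L).trans_le hmL
  have hm0 : 0 < m := by exact_mod_cast hm0'
  have hδc : δ ≤ c := by
    have h1 := Real.add_one_le_exp L
    have h2 : ε * L ≤ 1 := by
      have : L ≤ 1 / ε := by rw [← hexpL]; linarith
      rw [le_div_iff₀ hε0] at this
      linarith
    rw [hδ]
    calc c * (ε * L / (k : ℝ) ^ 3) ≤ c * (1 / 1) := by gcongr
      _ = c := by ring
  have hL4 : 4 * L ≤ m := by
    refine le_trans ?_ hmL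
    have := Real.quadratic_le_exp_of_nonneg (by linarith : 0 ≤ L)
    nlinarith
  -- The window is wide enough to gain `m / r^2 ≤ 16 / L`, yet narrow enough that `2 * r^2 / m ≤ L /
  -- 2`, so the Gaussian factor on it stays above `ε`.
  set D := √(m * L) with hD
  have hD2 : D ^ 2 = m * L := Real.sq_sqrt (by positivity)
  have hDm : 2 * D ≤ m := by
    refine le_of_sq_le_sq ?_ hm0'.le
    rw [mul_pow, hD2]
    nlinarith
  have hDL : 2 * L ≤ D := by
    refine le_of_sq_le_sq ?_ (Real.sqrt_nonneg _)
    rw [mul_pow, hD2]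
    nlinarith
  have hmD : √m ≤ D := by
    apply Real.sqrt_le_sqrt
    nlinarith
  obtain ⟨r, i₀, hri, hr4, hr2⟩ := exists_window (by linarith : 8 ≤ D) hDm
  have hr0' : (0 : ℝ) < r := by linarith
  have hr16 : m * L / 16 ≤ (r : ℝ) ^ 2 := by
    rw [← hD2]
    calc D ^ 2 / 16 = (D / 4) ^ 2 := by ring
      _ ≤ _ := by gcongr
  have hmr : (m : ℝ) / r ^ 2 ≤ 16 / L := by
    rw [div_le_div_iff₀ (by positivity) (by linarith)]
    linarith
  have hrL : (r : ℝ) ^ 2 ≤ m * L / 4 := by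
    rw [← hD2]
    calc (r : ℝ) ^ 2 ≤ (D / 2) ^ 2 := by gcongr
      _ = _ := by ring
  have hkk : (k : ℝ) + 1 ≤ 2 * k := by linarith
  have hk1 : ((k : ℝ) + 1) ^ 3 ≤ 8 * k ^ 3 := by
    calc ((k : ℝ) + 1) ^ 3 ≤ (2 * k) ^ 3 := by gcongr
      _ = _ := by ring
  set β := 92160 * δ * (k + 1) ^ 3 * m / (r : ℝ) ^ 3 with hβ
  -- The factors `k^3` and `L` cancel exactly against those in `δ`.
  have hβr : r * β ≤ 2 ^ 24 * c * ε := by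
    calc r * β = 92160 * δ * (k + 1) ^ 3 * (m / (r : ℝ) ^ 2) := by rw [hβ]; field_simp
      _ ≤ 92160 * δ * (8 * k ^ 3) * (16 / L) := by gcongr
      _ = 92160 * 128 * c * ε := by
          have : L ≠ 0 := by linarith
          rw [hδ]; field_simp; ring
      _ ≤ _ := by
          have : 0 < c * ε := by positivity
          linarith
  have hβ0 : 0 ≤ β := by positivity
  have hr1 : (1 : ℝ) ≤ r := by linarith
  have hβr1 : (r + 1) * β ≤ 2 ^ 25 * c * ε := by
    have h1 : β ≤ r * β := le_mul_of_one_le_left hβ0 hr1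
    linarith
  obtain ⟨g, hg1, hg2, hg3⟩ := exists_correction (k := k) (d := δ) hri
    (by
      have : 4 * (r : ℝ) ≤ m := by linarith
      exact_mod_cast this) hδ0.le (by linarith)
    (by
      have h1 : 8 * (2 * ((k : ℝ) + 1)) ^ (k + 3) ≤ r := by
        have h4 : Real.exp (L / 2) ≤ √m := by
          apply Real.le_sqrt_of_sq_le
          rw [← Real.exp_nat_mul]
          push_cast
          rwa [mul_div_cancel₀ L (by norm_num : (2 : ℝ) ≠ 0)]
        have h6 := pow_le_exp_half hk hLk
        linarith
      exact_mod_cast h1)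
    (by
      have h1 : 384 * ((k : ℝ) + 1) ^ 3 * m ≤ r ^ 2 := by
        refine le_trans ?_ hr16
        have : 384 * ((k : ℝ) + 1) ^ 3 * m ≤ L / 16 * m :=
          mul_le_mul_of_nonneg_right (by linarith) hm0'.le
        linarith
      exact_mod_cast h1)
    (by
      rw [← hβ]
      have h1 : ε ≤ Real.exp (-(2 * (r : ℝ) ^ 2 / m)) := by
        have h2 : ε = Real.exp (-L) := by rw [Real.exp_neg, hexpL]; simp
        rw [h2, Real.exp_le_exp, neg_le_neg_iff, div_le_iff₀ hm0']
        have : 0 < L * m := by positivity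
        linarith
      have hs : 0 < √(m : ℝ) := Real.sqrt_pos.2 hm0'
      have h3 : β ≤ ε / (4 * √m) := by
        rw [le_div_iff₀ (by positivity)]
        have h4 : √(m : ℝ) ≤ 4 * r := by linarith
        have h5 : 2 ^ 24 * c * ε ≤ ε / 16 := by
          have : 2 ^ 24 * c * ε ≤ 1 / 16 * ε := mul_le_mul_of_nonneg_right (by linarith) hε0.le
          linarith
        calc β * (4 * √m) ≤ β * (4 * (4 * r)) := by gcongr
          _ = 16 * (r * β) := by ring
          _ ≤ ε := by linarith
      exact h3.trans (by gcongr))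
  rw [← hβ] at hg3
  have hgε : binE m (fun s => |g s|) ≤ ε / 2 ^ 25 := by
    refine (hg3.trans hβr1).trans ?_
    have : 2 ^ 25 * c * ε ≤ 1 / 2 ^ 25 * ε := mul_le_mul_of_nonneg_right (by linarith) hε0.le
    linarith
  refine ⟨fun s => tilt m δ s - 1 + g s, hg1, fun s => ?_, ?_, ?_, ?_⟩
  · have h1 := half_le_tilt hm0 hδ0.le (by linarith) s
    have h2 := (abs_le.1 (hg2 s)).1
    linarith
  · simp only [add_sub_cancel_left]
    linarith
  · have hpt : ∀ s, (tilt m δ s - 1 + g s) ^ 2 ≤ 2 * (tilt m δ s - 1) ^ 2 + |g s| := fun s => by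
      have h1 : g s ^ 2 ≤ 1 / 2 * |g s| := by
        rw [← sq_abs]
        nlinarith [hg2 s, abs_nonneg (g s)]
      nlinarith [sq_nonneg (tilt m δ s - 1 - g s)]
    refine (binE_mono hpt).trans ?_
    rw [binE_add, binE_const_mul]
    have h2 := binE_tilt_sub_one_sq_le hm0 hδ0.le (by linarith)
    have h3 : δ * δ ≤ 1 / 2 ^ 50 * δ := mul_le_mul_of_nonneg_right (by linarith) hδ0.le
    rw [← sq] at h3
    linarith
  · have hpt : ∀ s, |tilt m δ s - 1| - |g s| ≤ |tilt m δ s - 1 + g s| := fun s => by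
      have := abs_sub_abs_le_abs_sub (tilt m δ s - 1) (-g s)
      rwa [abs_neg, sub_neg_eq_add] at this
    have h1 := binE_mono (m := m) hpt
    rw [binE_sub] at h1
    have h2 := le_binE_abs_tilt_sub_one (m := m) (d := δ)
      (by have : (2 : ℝ) ≤ m := by linarith
          exact_mod_cast this) hδ0.le (by linarith)
    linarith

end

/-! ### Total variation distance -/

section
variable {α : Type} [Fintype α]

theorem abs_sum_sub_le_tvDist (p q : Distr α) (A : Finset α) :
    |∑ x ∈ A, p.1 x - ∑ x ∈ A, q.1 x| ≤ tvDist p q :=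
  le_ciSup (f := fun A : Finset α => |∑ x ∈ A, p.1 x - ∑ x ∈ A, q.1 x|)
    (Set.finite_range _).bddAbove A

theorem tvDist_le_sum_abs (p q : Distr α) : tvDist p q ≤ ∑ x, |p.1 x - q.1 x| :=
  ciSup_le fun A => by
    rw [← Finset.sum_sub_distrib]
    exact (Finset.abs_sum_le_sum_abs _ _).trans
      (Finset.sum_le_sum_of_subset_of_nonneg A.subset_univ fun _ _ _ => abs_nonneg _)

theorem tvDist_comm (p q : Distr α) : tvDist p q = tvDist q p := by
  unfold tvDist
  simp only [abs_sub_comm]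

theorem tvDist_triangle (p q r : Distr α) : tvDist p r ≤ tvDist p q + tvDist q r :=
  ciSup_le fun A => (abs_sub_le _ _ _).trans
    (add_le_add (abs_sum_sub_le_tvDist p q A) (abs_sum_sub_le_tvDist q r A))

/-- The positive and negative parts of `p - q` have equal mass, at most the total variation
distance. -/
theorem sum_mul_sub_le_two_mul_tvDist (p q : Distr α) {f : α → ℝ} (hf : ∀ x, |f x| ≤ 1) :
    ∑ x, f x * (p.1 x - q.1 x) ≤ 2 * tvDist p q := by
  classical
  set A : Finset α := Finset.univ.filter fun x => q.1 x ≤ p.1 x with hA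
  have h0 : ∑ x, (p.1 x - q.1 x) = 0 := by
    rw [Finset.sum_sub_distrib, p.2.2, q.2.2, sub_self]
  have h1 : ∑ x ∈ A, (p.1 x - q.1 x) ≤ tvDist p q := by
    rw [Finset.sum_sub_distrib]
    exact (le_abs_self _).trans (abs_sum_sub_le_tvDist p q A)
  have h2 := Finset.sum_filter_add_sum_filter_not Finset.univ (fun x => q.1 x ≤ p.1 x)
    (fun x => p.1 x - q.1 x)
  have h3 := Finset.sum_filter_add_sum_filter_not Finset.univ (fun x => q.1 x ≤ p.1 x)
    (fun x => |p.1 x - q.1 x|)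
  have h4 : ∑ x ∈ Finset.univ.filter (fun x => q.1 x ≤ p.1 x), |p.1 x - q.1 x| =
      ∑ x ∈ Finset.univ.filter (fun x => q.1 x ≤ p.1 x), (p.1 x - q.1 x) :=
    Finset.sum_congr rfl fun x hx => abs_of_nonneg (by linarith [(Finset.mem_filter.1 hx).2])
  have h5 : ∑ x ∈ Finset.univ.filter (fun x => ¬ q.1 x ≤ p.1 x), |p.1 x - q.1 x| =
      -∑ x ∈ Finset.univ.filter (fun x => ¬ q.1 x ≤ p.1 x), (p.1 x - q.1 x) := by
    rw [← Finset.sum_neg_distrib]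
    exact Finset.sum_congr rfl fun x hx =>
      abs_of_nonpos (by linarith [not_le.1 (Finset.mem_filter.1 hx).2])
  have h6 : ∑ x, f x * (p.1 x - q.1 x) ≤ ∑ x, |p.1 x - q.1 x| :=
    Finset.sum_le_sum fun x _ => by
      refine (le_abs_self _).trans ?_
      rw [abs_mul]
      exact mul_le_of_le_one_left (abs_nonneg _) (hf x)
  linarith

end

/-! ### Statistical query algorithms on nearly uncorrelated families -/

/-- If every query of sufficient tolerance is answered uninformatively by all but few of the oracles,
then a short computation has the same output for most of the oracles. -/
theorem exists_common_output {α β ι : Type} [Fintype ι] (O : ι → StatQuery α → ℝ)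
    (O₀ : StatQuery α → ℝ) {t₀ B : ℝ} [∀ q, DecidablePred fun i => O i q = O₀ q] (hB : 0 ≤ B)
    (hO : ∀ q : StatQuery α, t₀ ≤ q.tol →
      ((Finset.univ.filter fun i => ¬ O i q = O₀ q).card : ℝ) ≤ B)
    (A : SQTree α β) (s : Finset ι) (L : ℝ) (hL : 0 ≤ L)
    (h : ∀ i ∈ s, (∀ q ∈ A.queries (O i), t₀ ≤ q.tol) ∧ ((A.queries (O i)).length : ℝ) ≤ L) :
    ∃ s' ⊆ s, (∀ i ∈ s', ∀ j ∈ s', A.run (O i) = A.run (O j)) ∧ (s.card : ℝ) - L * B ≤ s'.card := by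
  induction A generalizing s L with
  | output b =>
    exact ⟨s, subset_rfl, fun _ _ _ _ => rfl, by linarith [mul_nonneg hL hB]⟩
  | ask q next ih =>
    rcases s.eq_empty_or_nonempty with rfl | ⟨i₀, hi₀⟩
    · exact ⟨∅, subset_rfl, by simp, by simp; positivity⟩
    have hq : t₀ ≤ q.tol := (h i₀ hi₀).1 q (by simp [SQTree.queries])
    have hL1 : 0 ≤ L - 1 := by
      have := (h i₀ hi₀).2
      simp only [SQTree.queries, List.length_cons] at this
      push_cast at this
      linarith [((next (O i₀ q)).queries (O i₀)).length.cast_nonneg (α := ℝ)]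
    -- All oracles that answer `O₀ q` continue in the same branch; at most `B` of them are lost
    -- here.
    obtain ⟨s', hs', hrun, hcard⟩ := ih (O₀ q) (s.filter fun i => O i q = O₀ q) (L - 1) hL1 <| by
      intro i hi
      obtain ⟨his, hi⟩ := Finset.mem_filter.1 hi
      have h1 := h i his
      simp only [SQTree.queries, List.mem_cons, forall_eq_or_imp, List.length_cons, hi] at h1
      push_cast at h1
      exact ⟨h1.1.2, by linarith [h1.2]⟩
    refine ⟨s', hs'.trans (Finset.filter_subset _ _), fun i hi j hj => ?_, ?_⟩
    · have hi' := (Finset.mem_filter.1 (hs' hi)).2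
      have hj' := (Finset.mem_filter.1 (hs' hj)).2
      simp only [SQTree.run, hi', hj']
      exact hrun i hi j hj
    · have h1 := Finset.card_filter_add_card_filter_not (s := s) (fun i => O i q = O₀ q)
      have h2 : (s.filter fun i => ¬ O i q = O₀ q).card ≤
          (Finset.univ.filter fun i => ¬ O i q = O₀ q).card :=
        Finset.card_le_card (Finset.filter_subset_filter _ s.subset_univ)
      have h3 : (s.card : ℝ) = (s.filter fun i => O i q = O₀ q).card +
        (s.filter fun i => ¬ O i q = O₀ q).card := by exact_mod_cast h1.symm
      have h4 : ((s.filter fun i => ¬ O i q = O₀ q).card : ℝ) ≤ B :=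
        (by exact_mod_cast h2 : ((s.filter fun i => ¬ O i q = O₀ q).card : ℝ) ≤ _).trans (hO q hq)
      linarith

section
variable {M : ℕ} {ι : Type} [DecidableEq ι]

/-- A bounded query is correlated with few members of a nearly uncorrelated family. -/
theorem card_correlated_le {H : ι → Cube M → ℝ} {T : ι → Finset ι} {τ X B : ℝ} (hτ : 0 < τ)
    (hX : ∀ i j, |avg fun x => H i x * H j x| ≤ X)
    (hcorr : ∀ i j, j ∉ T i → |avg fun x => H i x * H j x| ≤ τ)
    (hB : 0 ≤ B) (hT : ∀ i, ((T i).card : ℝ) * X ≤ B) {f : Cube M → ℝ} (hf : ∀ x, |f x| ≤ 1) {t : ℝ}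
    (ht : √(2 * τ) ≤ t) (D : Finset ι) (hD : ∀ i ∈ D, t < |avg fun x => f x * H i x|) :
    (D.card : ℝ) * τ ≤ B := by
  rcases D.eq_empty_or_nonempty with rfl | ⟨i₀, hi₀⟩
  · simpa using hB
  have hDpos : (0 : ℝ) < D.card := by exact_mod_cast Finset.card_pos.2 ⟨i₀, hi₀⟩
  have ht0 : 0 ≤ t := (Real.sqrt_nonneg _).trans ht
  have ht2 : 2 * τ ≤ t ^ 2 := by
    rw [← Real.sq_sqrt (by positivity : 0 ≤ 2 * τ)]
    gcongr
  -- The signs align the correlations of `f` with the members, so that they add up in `G`.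
  set e : ι → ℝ := fun i => SignType.sign (avg fun x => f x * H i x) with he
  have he1 : ∀ i, |e i| ≤ 1 := fun i => by
    simp only [he]
    rcases SignType.trichotomy (SignType.sign (avg fun x => f x * H i x)) with h | h | h <;>
      rw [h] <;> norm_num
  set G : Cube M → ℝ := fun x => ∑ i ∈ D, e i * H i x with hG
  have h1 : (D.card : ℝ) * t ≤ avg fun x => f x * G x := by
    have e1 : (fun x => f x * G x) = fun x => ∑ i ∈ D, e i * (f x * H i x) := by
      ext x; simp only [hG, Finset.mul_sum]; exact Finset.sum_congr rfl fun i _ => by ring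
    rw [e1, avg_sum, ← nsmul_eq_mul]
    refine Finset.card_nsmul_le_sum _ _ _ fun i hi => ?_
    rw [avg_const_mul]
    simp only [he]
    rw [sign_mul_self]
    exact (hD i hi).le
  have h2 : avg (fun x => G x ^ 2) ≤ D.card * (D.card * τ + B) := by
    have e1 : (fun x => G x ^ 2) = fun x => ∑ i ∈ D, ∑ j ∈ D, e i * e j * (H i x * H j x) := by
      ext x
      simp only [hG, sq, Finset.sum_mul_sum]
      exact Finset.sum_congr rfl fun i _ => Finset.sum_congr rfl fun j _ => by ring
    rw [e1, avg_sum, ← nsmul_eq_mul]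
    refine Finset.sum_le_card_nsmul _ _ _ fun i _ => ?_
    rw [avg_sum]
    have h3 : ∀ j ∈ D, avg (fun x => e i * e j * (H i x * H j x)) ≤
        τ + if j ∈ T i then X else 0 := by
      intro j _
      rw [avg_const_mul]
      have h4 : e i * e j * (avg fun x => H i x * H j x) ≤ |avg fun x => H i x * H j x| := by
        refine (le_abs_self _).trans ?_
        rw [abs_mul, abs_mul]
        refine mul_le_of_le_one_left (abs_nonneg _) ?_
        exact mul_le_one₀ (he1 i) (abs_nonneg _) (he1 j)
      split_ifs with hj
      · linarith [hX i j]
      · linarith [hcorr i j hj]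
    refine (Finset.sum_le_sum h3).trans ?_
    rw [Finset.sum_add_distrib, Finset.sum_const, nsmul_eq_mul, ← Finset.sum_filter,
      Finset.sum_const, nsmul_eq_mul]
    gcongr
    refine le_trans ?_ (hT i)
    have : 0 ≤ X := (abs_nonneg _).trans (hX i i)
    gcongr
    intro j hj
    exact (Finset.mem_filter.1 hj).2
  have h3 : (avg fun x => f x * G x) ^ 2 ≤ avg (fun x => G x ^ 2) := by
    refine (avg_mul_sq_le f G).trans ?_
    have h4 : avg (fun x => f x ^ 2) ≤ 1 := by
      rw [← avg_const (M := M) 1]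
      exact avg_mono fun x => by rw [← sq_abs]; exact pow_le_one₀ (abs_nonneg _) (hf x)
    exact mul_le_of_le_one_left (avg_nonneg fun x => sq_nonneg _) h4
  have h4 : ((D.card : ℝ) * t) ^ 2 ≤ D.card * (D.card * τ + B) :=
    (pow_le_pow_left₀ (by positivity) h1 2).trans (h3.trans h2)
  -- Because `t^2 ≥ 2τ`, half of the left side absorbs the off-diagonal term `D.card * τ`.
  have h5 : (D.card : ℝ) * (D.card * (2 * τ)) ≤ D.card * (D.card * τ + B) := by
    refine le_trans ?_ h4
    rw [mul_pow, sq (D.card : ℝ), mul_assoc]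
    gcongr
  have h6 := le_of_mul_le_mul_left h5 hDpos
  linarith

/-- Statistical query lower bound: an algorithm that learns every member of a separated, nearly
uncorrelated family of distributions needs many queries or a query of small tolerance. -/
theorem exists_hard_input [Fintype ι] [Nonempty ι] {H : ι → Cube M → ℝ} {P : ι → Distr (Cube M)}
    (hP : ∀ i x, (P i).1 x = (1 + H i x) / 2 ^ M) {T : ι → Finset ι} {τ X B q r : ℝ} (hτ : 0 < τ)
    (hX : ∀ i j, |avg fun x => H i x * H j x| ≤ X)
    (hcorr : ∀ i j, j ∉ T i → |avg fun x => H i x * H j x| ≤ τ)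
    (hT : ∀ i, ((T i).card : ℝ) * X ≤ B) (hT' : ∀ i, 3 * (T i).card < Fintype.card ι)
    (hsep : ∀ i j, j ∉ T i → 2 * r < tvDist (P i) (P j)) (hq0 : 0 ≤ q)
    (hq : 3 * (q * B) ≤ Fintype.card ι * τ)
    {Ω : Type*} [MeasurableSpace Ω] (μ : Measure Ω) [IsProbabilityMeasure μ]
    (A : Ω → SQTree (Cube M) (Distr (Cube M)))
    (hA : ∀ i O, IsStatOracle (P i) O → μ {ω | ¬ tvDist ((A ω).run O) (P i) ≤ r} ≤ 1 / 3) :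
    ∃ i O, IsStatOracle (P i) O ∧ ∃ᵐ ω ∂μ, (∃ s ∈ (A ω).queries O, s.tol < √(2 * τ)) ∨
      q ≤ (((A ω).queries O).length : ℝ) := by
  classical
  by_contra hcon
  push Not at hcon
  set O₀ : StatQuery (Cube M) → ℝ := fun s => avg s.f with hO₀
  -- The least informative admissible oracle: it answers as for the uniform distribution whenever
  -- the tolerance allows.
  set O : ι → StatQuery (Cube M) → ℝ := fun i s =>
    if |avg fun x => s.f x * H i x| ≤ s.tol then O₀ s else ∑ x, (P i).1 x * s.f x with hOdef
  have hexp : ∀ i (s : StatQuery (Cube M)), ∑ x, (P i).1 x * s.f x =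
      avg s.f + avg fun x => s.f x * H i x := fun i s => by
    rw [← avg_add, avg, Finset.sum_div]
    exact Finset.sum_congr rfl fun x _ => by rw [hP]; ring
  have hO : ∀ i, IsStatOracle (P i) (O i) := fun i s => by
    simp only [hOdef]
    split_ifs with h
    · rw [hexp, hO₀, sub_add_cancel_left, abs_neg]; exact h
    · rw [sub_self, abs_zero]; exact s.tol_pos.le
  have hB0 : 0 ≤ B := by
    obtain ⟨i⟩ := ‹Nonempty ι›
    exact le_trans (mul_nonneg (by positivity) ((abs_nonneg _).trans (hX i i))) (hT i)
  have hbad : ∀ s : StatQuery (Cube M), √(2 * τ) ≤ s.tol →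
      ((Finset.univ.filter fun i => ¬ O i s = O₀ s).card : ℝ) ≤ B / τ := fun s hs => by
    rw [le_div_iff₀ hτ]
    refine card_correlated_le hτ hX hcorr hB0 hT (fun x => abs_le.2 (s.f_mem x)) hs _ fun i hi => ?_
    have h := (Finset.mem_filter.1 hi).2
    simp only [hOdef] at h
    by_contra hc
    exact h (if_pos (not_lt.1 hc))
  -- Failure events need not be measurable, so they are replaced by measurable hulls of the same
  -- outer measure.
  set bad : ι → Set Ω := fun i =>
    toMeasurable μ {ω | ¬ tvDist ((A ω).run (O i)) (P i) ≤ r} with hbaddef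
  have hmeas : ∀ i, MeasurableSet (bad i) := fun i => measurableSet_toMeasurable _ _
  set F : Ω → ENNReal := fun ω => ∑ i, (bad i).indicator 1 ω with hF
  have hFm : Measurable F :=
    Finset.measurable_sum _ fun i _ => measurable_one.indicator (hmeas i)
  have hFint : ∫⁻ ω, F ω ∂μ ≤ Fintype.card ι * (1 / 3) := by
    rw [lintegral_finsetSum _ fun i _ => measurable_one.indicator (hmeas i)]
    simp only [lintegral_indicator_one (hmeas _)]
    refine (Finset.sum_le_card_nsmul _ _ (1 / 3) fun i _ => ?_).trans (le_of_eq ?_)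
    · rw [hbaddef, measure_toMeasurable]
      exact hA i (O i) (hO i)
    · rw [nsmul_eq_mul, Finset.card_univ]
  have hae : ∀ᵐ ω ∂μ, ∀ i, (∀ s ∈ (A ω).queries (O i), √(2 * τ) ≤ s.tol) ∧
      (((A ω).queries (O i)).length : ℝ) < q := by
    rw [ae_all_iff]
    intro i
    have h := hcon i (O i) (hO i)
    simpa [Filter.not_frequently, not_or] using h
  -- Averaging over the randomness fixes one deterministic algorithm that makes few queries on every
  -- member and fails on at most a third of them.
  obtain ⟨ω, hω, hFω⟩ := exists_notMem_null_le_lintegral hFm.aemeasurable (ae_iff.1 hae)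
  simp only [Set.mem_ofPred_eq, not_not] at hω
  set s : Finset ι := Finset.univ.filter fun i => tvDist ((A ω).run (O i)) (P i) ≤ r with hs
  have hscard : 2 * (Fintype.card ι : ℝ) ≤ 3 * s.card := by
    have h1 : ((Finset.univ.filter fun i => ¬ tvDist ((A ω).run (O i)) (P i) ≤ r).card : ENNReal) ≤
        F ω := by
      rw [Finset.card_filter, Nat.cast_sum]
      refine Finset.sum_le_sum fun i _ => ?_
      split_ifs with h
      · simp
      · rw [Set.indicator_of_mem (subset_toMeasurable _ _ h)]; simp
    have h2 := h1.trans (hFω.trans hFint)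
    have h3 := Finset.card_filter_add_card_filter_not (s := (Finset.univ : Finset ι))
      (fun i => tvDist ((A ω).run (O i)) (P i) ≤ r)
    rw [Finset.card_univ] at h3
    have h4 : 3 * ((Finset.univ.filter fun i => ¬ tvDist ((A ω).run (O i)) (P i) ≤ r).card : ENNReal)
        ≤ Fintype.card ι := by
      calc _ ≤ 3 * ((Fintype.card ι : ENNReal) * (1 / 3)) := by gcongr
        _ = Fintype.card ι := by
          rw [mul_comm, mul_assoc, ENNReal.div_mul_cancel (by norm_num) (by norm_num), mul_one]
    have h5 : 3 * (Finset.univ.filter fun i => ¬ tvDist ((A ω).run (O i)) (P i) ≤ r).card ≤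
      Fintype.card ι := by exact_mod_cast h4
    have h6 : 2 * Fintype.card ι ≤ 3 * s.card := by
      rw [← hs] at h3; omega
    exact_mod_cast h6
  obtain ⟨s', hs', hrun, hcard⟩ := exists_common_output O O₀ (by positivity) hbad (A ω) s q hq0
    fun i _ => ⟨(hω i).1, (hω i).2.le⟩
  have hqB : 3 * (q * (B / τ)) ≤ Fintype.card ι := by
    rw [mul_div_assoc', mul_div_assoc', div_le_iff₀ hτ]
    exact hq
  -- At least two thirds succeed and the queries eliminate at most one third. The remaining third is
  -- larger than any `T i`, so it contains two separated members with a common output.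
  have hs'card : (Fintype.card ι : ℝ) ≤ 3 * s'.card := by linarith
  have hs'card' : Fintype.card ι ≤ 3 * s'.card := by exact_mod_cast hs'card
  obtain ⟨i, hi⟩ : s'.Nonempty := by
    rw [← Finset.card_pos]
    have := Fintype.card_pos (α := ι)
    omega
  obtain ⟨j, hj, hjT⟩ : ∃ j ∈ s', j ∉ T i := by
    by_contra hc
    push Not at hc
    have := Finset.card_le_card (show s' ⊆ T i from hc)
    have := hT' i
    omega
  have h1 := (Finset.mem_filter.1 (hs' hi)).2
  have h2 := (Finset.mem_filter.1 (hs' hj)).2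
  rw [← hrun i hi j hj] at h2
  rw [tvDist_comm] at h1
  have h3 := hsep i j hjT
  have h4 := tvDist_triangle (P i) ((A ω).run (O i)) (P j)
  linarith

end

section
variable {M : ℕ}

/-! ### The clique Ising model as a function of the spin sum -/

/-- The full double sum over `S` is the square of the spin sum; the excluded diagonal subtracts one
for each element of `S`. -/
theorem sum_cliqueInteraction (S : Finset (Fin M)) (d : ℝ) (x : Cube M) :
    ∑ i, ∑ j, (-1 : ℝ) ^ ((x i : ℕ) + (x j : ℕ)) * cliqueInteraction S d i j =
      d * (spinSum S x ^ 2 - S.card) := by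
  have h1 : ∀ i j, (-1 : ℝ) ^ ((x i : ℕ) + (x j : ℕ)) * cliqueInteraction S d i j =
      (if i ∈ S then (if j ∈ S then d * (spin i x * spin j x) else 0) else 0) -
        (if j = i then (if i ∈ S then d else 0) else 0) := by
    intro i j
    rw [pow_add, cliqueInteraction, Matrix.of_apply]
    change spin i x * spin j x * _ = _
    by_cases hij : j = i
    · subst hij
      by_cases hj : j ∈ S <;> simp [hj, spin_sq]
    · by_cases hi : i ∈ S <;> by_cases hj : j ∈ S <;> simp [hi, hj, hij, Ne.symm hij]
      ring
  simp only [h1, Finset.sum_sub_distrib, Finset.sum_ite_eq', Finset.mem_univ, if_true]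
  have h2 : ∀ i, ∑ j, (if i ∈ S then (if j ∈ S then d * (spin i x * spin j x) else 0) else 0) =
      if i ∈ S then d * (spin i x * spinSum S x) else 0 := fun i => by
    split_ifs
    · rw [← Finset.sum_filter, Finset.filter_mem_eq_inter, Finset.univ_inter, ← Finset.mul_sum,
        ← Finset.mul_sum, spinSum]
    · simp
  simp only [h2]
  rw [← Finset.sum_filter, ← Finset.sum_filter, Finset.filter_mem_eq_inter, Finset.univ_inter,
    ← Finset.mul_sum, ← Finset.sum_mul, Finset.sum_const, nsmul_eq_mul]
  change d * (spinSum S x * spinSum S x) - _ = _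
  ring

theorem Q_apply {m : ℕ} (hm : 0 < m) {S : Finset (Fin M)} (hS : S.card = m) (d : ℝ) (x : Cube M) :
    (Q S (d / m)).1 x = tilt m d (spinSum S x) / 2 ^ M := by
  have hm' : (m : ℝ) ≠ 0 := by exact_mod_cast hm.ne'
  have hw : ∀ y : Cube M, isingWeight (cliqueInteraction S (d / m)) y =
      Real.exp (-(d / 2)) * Real.exp (d * (spinSum S y ^ 2 / m) / 2) := fun y => by
    rw [isingWeight, sum_cliqueInteraction, hS, ← Real.exp_add]
    congr 1
    field_simp
    ring
  have hZ : partitionFn (cliqueInteraction S (d / m)) =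
      Real.exp (-(d / 2)) * (2 ^ M * tiltZ m d) := by
    have h := avg_spinSum (fun s => Real.exp (d * (s ^ 2 / m) / 2)) S
    rw [hS] at h
    rw [partitionFn, tiltZ, ← h, avg, mul_div_cancel₀ _ (by positivity), Finset.mul_sum]
    exact Finset.sum_congr rfl fun y _ => hw y
  change isingWeight _ x / partitionFn _ = _
  rw [hw, hZ, tilt, mul_div_mul_left _ _ (Real.exp_pos _).ne', div_div, mul_comm (tiltZ m d)]

/-- The distribution with density `1 + H` with respect to the uniform distribution. -/
noncomputable def withDensity (H : Cube M → ℝ) (h0 : ∀ x, 0 ≤ 1 + H x) (h1 : avg H = 0) :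
    Distr (Cube M) :=
  ⟨fun x => (1 + H x) / 2 ^ M, fun x => div_nonneg (h0 x) (by positivity), by
    change ∑ x, (1 + H x) / 2 ^ M = 1
    rw [← Finset.sum_div]
    change avg (fun x => 1 + H x) = 1
    rw [avg_add, h1, avg_const, add_zero]⟩

theorem tvDist_withDensity_Q_le {m : ℕ} (hm : 0 < m) {S : Finset (Fin M)} (hS : S.card = m) (d : ℝ)
    {H : Cube M → ℝ} (h0 : ∀ x, 0 ≤ 1 + H x) (h1 : avg H = 0) :
    tvDist (withDensity H h0 h1) (Q S (d / m)) ≤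
      avg fun x => |H x - (tilt m d (spinSum S x) - 1)| := by
  refine (tvDist_le_sum_abs _ _).trans (le_of_eq ?_)
  rw [avg, Finset.sum_div]
  refine Finset.sum_congr rfl fun x _ => ?_
  rw [Q_apply hm hS]
  change |(1 + H x) / 2 ^ M - _| = _
  rw [← sub_div, abs_div, abs_of_pos (by positivity : (0 : ℝ) < 2 ^ M)]
  congr 2
  ring

theorem avg_mul_sub_le_two_mul_tvDist {H G f : Cube M → ℝ} (h0 : ∀ x, 0 ≤ 1 + H x)
    (h1 : avg H = 0) (g0 : ∀ x, 0 ≤ 1 + G x) (g1 : avg G = 0) (hf : ∀ x, |f x| ≤ 1) :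
    avg (fun x => f x * H x) - avg (fun x => f x * G x) ≤
      2 * tvDist (withDensity H h0 h1) (withDensity G g0 g1) := by
  refine le_trans (le_of_eq ?_) (sum_mul_sub_le_two_mul_tvDist _ _ hf)
  rw [← avg_sub, avg, Finset.sum_div]
  refine Finset.sum_congr rfl fun x _ => ?_
  change _ = f x * ((1 + H x) / 2 ^ M - (1 + G x) / 2 ^ M)
  ring

end

/-! ### Graphs of functions as a family of nearly disjoint sets -/

section
variable {m n : ℕ}

/-- The graph of a function `Fin m → Fin n`, as a set of `m` elements of `Fin (m * n)`. -/
def graphSet (φ : Fin m → Fin n) : Finset (Fin (m * n)) :=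
  Finset.univ.map ⟨fun i => finProdFinEquiv (i, φ i), fun i j h => by
    have := finProdFinEquiv.injective h
    exact (Prod.ext_iff.1 this).1⟩

/-- The number of agreements of two functions. -/
def agreements (φ ψ : Fin m → Fin n) : ℕ := (Finset.univ.filter fun i => φ i = ψ i).card

theorem card_graphSet (φ : Fin m → Fin n) : (graphSet φ).card = m := by simp [graphSet]

theorem card_graphSet_inter (φ ψ : Fin m → Fin n) :
    (graphSet φ ∩ graphSet ψ).card = agreements φ ψ := by
  have : graphSet φ ∩ graphSet ψ = (Finset.univ.filter fun i => φ i = ψ i).map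
      ⟨fun i => finProdFinEquiv (i, φ i), fun i j h => by
        have := finProdFinEquiv.injective h
        exact (Prod.ext_iff.1 this).1⟩ := by
    ext a
    simp only [graphSet, Finset.mem_inter, Finset.mem_map, Finset.mem_univ, true_and,
      Finset.mem_filter]
    constructor
    · rintro ⟨⟨i, rfl⟩, j, hj⟩
      have := finProdFinEquiv.injective hj
      rw [Prod.mk.injEq] at this
      obtain ⟨rfl, h⟩ := this
      exact ⟨j, h.symm, rfl⟩
    · rintro ⟨i, h, rfl⟩
      refine ⟨⟨i, rfl⟩, i, ?_⟩
      change finProdFinEquiv (i, ψ i) = finProdFinEquiv (i, φ i)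
      rw [h]
  rw [this, Finset.card_map, agreements]

/-- The coordinates of `ψ` are independent, so the sum factorises; divided by `n ^ m` it is the
exponential moment needed for the Chernoff bound. -/
theorem sum_two_pow_agreements (φ : Fin m → Fin n) :
    ∑ ψ : Fin m → Fin n, (2 : ℝ) ^ agreements φ ψ = ((n : ℝ) + 1) ^ m := by
  have h1 : ∀ ψ : Fin m → Fin n, (2 : ℝ) ^ agreements φ ψ =
      ∏ i, (if φ i = ψ i then (2 : ℝ) else 1) := fun ψ => by
    rw [agreements, Finset.prod_ite, Finset.prod_const, Finset.prod_const_one, mul_one]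
  simp only [h1]
  rw [← Fintype.piFinset_univ, ← Finset.prod_univ_sum (fun _ => Finset.univ)
    (fun i j => if φ i = j then (2 : ℝ) else 1)]
  have h2 : ∀ i, ∑ j, (if φ i = j then (2 : ℝ) else 1) = n + 1 := fun i => by
    have : ∀ j, (if φ i = j then (2 : ℝ) else 1) = 1 + if φ i = j then 1 else 0 := fun j => by
      split_ifs <;> norm_num
    simp only [this, Finset.sum_add_distrib, Finset.sum_ite_eq, Finset.mem_univ, if_true]
    simp
  simp only [h2, Finset.prod_const, Finset.card_univ, Fintype.card_fin]

/-- Few functions agree with a given one much more often than expected. -/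
theorem card_agreements_gt_le {b : ℕ} (hb : 1 ≤ b) (φ : Fin (b ^ 4) → Fin (3 * b)) :
    ((Finset.univ.filter fun ψ => 2 * b ^ 3 < 3 * agreements φ ψ).card : ℝ) ≤
      Fintype.card (Fin (b ^ 4) → Fin (3 * b)) * Real.exp (-(b : ℝ) ^ 3 / 8) := by
  have hb' : (0 : ℝ) < b := by exact_mod_cast hb
  -- Markov's inequality for `2 ^ agreements` at twice the mean `b^3/3`. The final exponent is `1/3
  -- - (2/3) log 2`, which is below `-1/8`.
  have h1 : ((Finset.univ.filter fun ψ => 2 * b ^ 3 < 3 * agreements φ ψ).card : ℝ) *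
      Real.exp (2 / 3 * (b : ℝ) ^ 3 * Real.log 2) ≤ ((3 * b : ℕ) + 1 : ℝ) ^ (b ^ 4) := by
    rw [← sum_two_pow_agreements φ, ← nsmul_eq_mul]
    refine (Finset.card_nsmul_le_sum _ (fun ψ => (2 : ℝ) ^ agreements φ ψ) _ fun ψ hψ => ?_).trans
      (Finset.sum_le_sum_of_subset_of_nonneg (Finset.filter_subset _ _)
        fun _ _ _ => by positivity)
    have h2 : 2 * (b : ℝ) ^ 3 < 3 * agreements φ ψ := by
      exact_mod_cast (Finset.mem_filter.1 hψ).2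
    have h3 : (2 : ℝ) ^ agreements φ ψ = Real.exp (agreements φ ψ * Real.log 2) := by
      rw [Real.exp_nat_mul, Real.exp_log two_pos]
    rw [h3]
    apply Real.exp_le_exp.2
    have : 0 < Real.log 2 := Real.log_pos one_lt_two
    gcongr
    linarith
  have h2 : ((3 * b : ℕ) + 1 : ℝ) ^ (b ^ 4) ≤
      (3 * b : ℝ) ^ (b ^ 4) * Real.exp ((b : ℝ) ^ 3 / 3) := by
    have h3 : ((3 * b : ℕ) + 1 : ℝ) ≤ 3 * b * Real.exp (1 / (3 * b)) := by
      have := Real.add_one_le_exp (1 / (3 * (b : ℝ)))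
      calc ((3 * b : ℕ) + 1 : ℝ) = 3 * b * (1 / (3 * b) + 1) := by push_cast; field_simp; ring
        _ ≤ _ := by gcongr
    calc _ ≤ (3 * b * Real.exp (1 / (3 * b)) : ℝ) ^ (b ^ 4) := by gcongr
      _ = _ := by
        rw [mul_pow, ← Real.exp_nat_mul]
        congr 2
        push_cast
        field_simp
  have h3 : (Fintype.card (Fin (b ^ 4) → Fin (3 * b)) : ℝ) = (3 * b : ℝ) ^ (b ^ 4) := by
    simp
  rw [h3]
  rw [← le_div_iff₀ (Real.exp_pos _)] at h1
  refine h1.trans ((div_le_div_of_nonneg_right h2 (Real.exp_pos _).le).trans ?_)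
  rw [mul_div_assoc, ← Real.exp_sub]
  gcongr
  have := Real.log_two_gt_d9
  have hb3 : 0 < (b : ℝ) ^ 3 := by positivity
  nlinarith

end

/-- From `M^4 = 81 m^5` follows `3 ∣ M`, then `(M/3)^4 = m^5` is divisible by `m^4`, so `m` divides
`M/3`; the quotient `b` has fourth power `m`. -/
theorem exists_eq_pow_of_rpow {m M : ℕ} (hm : 0 < m) (h : (M : ℝ) = 3 * (m : ℝ) ^ (5 / 4 : ℝ)) :
    ∃ b : ℕ, 0 < b ∧ m = b ^ 4 ∧ M = b ^ 4 * (3 * b) := by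
  have h4 : M ^ 4 = 3 ^ 4 * m ^ 5 := by
    have : (M : ℝ) ^ 4 = 3 ^ 4 * m ^ 5 := by
      rw [h, mul_pow, ← Real.rpow_natCast ((m : ℝ) ^ (5 / 4 : ℝ)), ← Real.rpow_mul (by positivity)]
      norm_num
    exact_mod_cast this
  obtain ⟨M', rfl⟩ : 3 ∣ M :=
    Nat.Prime.dvd_of_dvd_pow Nat.prime_three (n := 4) 
      (h4 ▸ Dvd.dvd.mul_right (dvd_pow_self 3 (by norm_num)) _)
  have h5 : M' ^ 4 = m ^ 5 := by
    rw [mul_pow] at h4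
    exact Nat.eq_of_mul_eq_mul_left (by norm_num) h4
  obtain ⟨b, rfl⟩ : m ∣ M' :=
    (Nat.pow_dvd_pow_iff (by norm_num : 4 ≠ 0)).1 (h5 ▸ pow_dvd_pow m (by norm_num))
  have h6 : b ^ 4 = m := by
    refine Nat.eq_of_mul_eq_mul_left (pow_pos hm 4) ?_
    rw [← mul_pow, h5]; ring
  refine ⟨b, ?_, h6.symm, by rw [← h6]; ring⟩
  rcases Nat.eq_zero_or_pos b with rfl | hb
  · simp at h6; omega
  · exact hb


/-! ### The lower bound -/

theorem rpow_two_fifths_le (b : ℕ) :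
    ((b ^ 4 * (3 * b) : ℕ) : ℝ) ^ (2 / 5 : ℝ) ≤ 4 * (b : ℝ) ^ 2 := by
  have hb0 : (0 : ℝ) ≤ b := by positivity
  calc ((b ^ 4 * (3 * b) : ℕ) : ℝ) ^ (2 / 5 : ℝ) ≤ ((2 * (b : ℝ)) ^ 5) ^ (2 / 5 : ℝ) := by
        gcongr
        push_cast
        nlinarith [pow_nonneg hb0 5]
    _ = 4 * (b : ℝ) ^ 2 := by
        rw [← Real.rpow_natCast (2 * (b : ℝ)), ← Real.rpow_mul (by positivity)]
        norm_num
        ring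

/-- The constant satisfies `3 ≤ (5/4)^5`. It is also below `3/2`, so comparing `2/(3b)` with
`4/(5b)` leaves the factor `(5/6)^(k+1)`, which beats the constant `38 / a` for large `k`. -/
theorem inv_pow_le_rpow {b : ℕ} (hb : 0 < b) (k : ℕ) :
    ((5 / 4 * (b : ℝ)) ^ (k + 1))⁻¹ ≤
      ((b ^ 4 * (3 * b) : ℕ) : ℝ) ^ (-((k : ℝ) + 1) / 5) := by
  have hb' : (0 : ℝ) < b := by exact_mod_cast hb
  have h0 : (0 : ℝ) < ((b ^ 4 * (3 * b) : ℕ) : ℝ) := by push_cast; positivity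
  have h1 : ((b ^ 4 * (3 * b) : ℕ) : ℝ) ≤ (5 / 4 * (b : ℝ)) ^ 5 := by
    push_cast
    nlinarith [pow_pos hb' 5]
  refine le_trans (le_of_eq ?_) (Real.rpow_le_rpow_of_nonpos h0 h1 ?_)
  · rw [← Real.rpow_natCast _ 5, ← Real.rpow_mul (by positivity), ← Real.rpow_natCast,
      ← Real.rpow_neg (by positivity)]
    congr 1
    push_cast
    ring
  · have : (0 : ℝ) ≤ k := by positivity
    linarith

/-- The lower bound, given a suitable family of corruptions of the clique Ising models. -/
theorem lower_bound_of_family {a ε δ τ r : ℝ} {b k : ℕ} (hb : 0 < b) (ha : 0 < a) (hδ : 0 < δ)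
    (hk : 38 * (5 / 6 : ℝ) ^ (k + 1) ≤ a) (hba : 1824 / a ≤ b) (hb17 : 17 ≤ b)
    (hτ : a * (((b ^ 4 * (3 * b) : ℕ) : ℝ) ^ (-((k : ℝ) + 1) / 5) * δ) ≤ τ)
    (H : (Fin (b ^ 4) → Fin (3 * b)) → Cube (b ^ 4 * (3 * b)) → ℝ) (h0 : ∀ φ x, 0 ≤ 1 + H φ x)
    (h1 : ∀ φ, avg (H φ) = 0)
    (hnear : ∀ φ, avg (fun x => |H φ x - (tilt (b ^ 4) δ (spinSum (graphSet φ) x) - 1)|) ≤ ε)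
    (hX : ∀ φ ψ, |avg fun x => H φ x * H ψ x| ≤ 38 * δ)
    (hcorr : ∀ φ ψ, 3 * agreements φ ψ ≤ 2 * b ^ 3 →
      |avg fun x => H φ x * H ψ x| ≤ (2 / (3 * (b : ℝ))) ^ (k + 1) * (38 * δ))
    (hsep : ∀ φ ψ, 3 * agreements φ ψ ≤ 2 * b ^ 3 →
      2 * r < tvDist (withDensity (H φ) (h0 φ) (h1 φ)) (withDensity (H ψ) (h0 ψ) (h1 ψ)))
    {Ω : Type*} [MeasurableSpace Ω] (μ : Measure Ω) [IsProbabilityMeasure μ]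
    (A : Ω → SQTree (Cube (b ^ 4 * (3 * b))) (Distr (Cube (b ^ 4 * (3 * b)))))
    (hA : Learns μ A (b ^ 4) ε (δ / (b ^ 4 : ℕ)) r) :
    ∃ S P O, IsInput (b ^ 4) ε (δ / (b ^ 4 : ℕ)) S P O ∧
      ∃ᵐ ω ∂μ, (∃ q ∈ (A ω).queries O, q.tol < √(2 * τ)) ∨
        (2 : ℝ) ^ (1 / 64 * ((b ^ 4 * (3 * b) : ℕ) : ℝ) ^ (2 / 5 : ℝ)) *
          ((b ^ 4 * (3 * b) : ℕ) : ℝ) ^ (-((k : ℝ) + 1) / 5) ≤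
          (((A ω).queries O).length : ℝ) := by
  have hb' : (0 : ℝ) < b := by exact_mod_cast hb
  have hb17' : (17 : ℝ) ≤ b := by exact_mod_cast hb17
  set ρ := ((b ^ 4 * (3 * b) : ℕ) : ℝ) ^ (-((k : ℝ) + 1) / 5) with hρ
  have hρ0 : 0 < ρ := Real.rpow_pos_of_pos (by push_cast; positivity) _
  have hτ0 : 0 < τ := lt_of_lt_of_le (by positivity) hτ
  set N : ℝ := (Fintype.card (Fin (b ^ 4) → Fin (3 * b)) : ℝ) with hN
  have : NeZero (3 * b) := ⟨by omega⟩
  have hN0 : 0 < N := by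
    rw [hN]; exact_mod_cast Fintype.card_pos
  set p := Real.exp (-(b : ℝ) ^ 3 / 8) with hp
  have hb3 : (b : ℝ) ≤ b ^ 3 := le_self_pow₀ (by linarith) (by norm_num)
  set T : (Fin (b ^ 4) → Fin (3 * b)) → Finset (Fin (b ^ 4) → Fin (3 * b)) :=
    fun φ => Finset.univ.filter fun ψ => 2 * b ^ 3 < 3 * agreements φ ψ with hTdef
  have hTcard : ∀ φ, ((T φ).card : ℝ) ≤ N * p := fun φ => card_agreements_gt_le hb φ
  have hTmem : ∀ φ ψ, ψ ∉ T φ → 3 * agreements φ ψ ≤ 2 * b ^ 3 := fun φ ψ h => by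
    simpa [hTdef] using h
  have hinput : ∀ φ O, IsStatOracle (withDensity (H φ) (h0 φ) (h1 φ)) O →
      IsInput (b ^ 4) ε (δ / (b ^ 4 : ℕ)) (graphSet φ) (withDensity (H φ) (h0 φ) (h1 φ)) O :=
    fun φ O hO => ⟨card_graphSet φ,
      (tvDist_withDensity_Q_le (pow_pos hb 4) (card_graphSet φ) δ (h0 φ) (h1 φ)).trans (hnear φ), hO⟩
  obtain ⟨φ, O, hO, hω⟩ := exists_hard_input
    (P := fun φ => withDensity (H φ) (h0 φ) (h1 φ)) (fun φ x => rfl) (T := T) (τ := τ) (X := 38 * δ)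
    (B := N * p * (38 * δ)) (r := r)
    (q := (2 : ℝ) ^ (1 / 64 * ((b ^ 4 * (3 * b) : ℕ) : ℝ) ^ (2 / 5 : ℝ)) * ρ) hτ0 hX
    (fun φ ψ h => by
      refine (hcorr φ ψ (hTmem φ ψ h)).trans (le_trans ?_ hτ)
      have h2 := inv_pow_le_rpow hb k
      rw [← hρ] at h2
      have e : (2 / (3 * (b : ℝ))) ^ (k + 1) =
          (5 / 6) ^ (k + 1) * ((5 / 4 * (b : ℝ)) ^ (k + 1))⁻¹ := by
        rw [← inv_pow, ← mul_pow]
        congr 1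
        field_simp
        norm_num
      calc _ = 38 * (5 / 6 : ℝ) ^ (k + 1) * (((5 / 4 * (b : ℝ)) ^ (k + 1))⁻¹ * δ) := by rw [e]; ring
        _ ≤ a * (ρ * δ) := by gcongr)
    (fun φ => by gcongr; exact hTcard φ)
    (fun φ => by
      have h2 : p * 3 < 1 := by
        have h3 := Real.add_one_le_exp ((b : ℝ) ^ 3 / 8)
        rw [hp, neg_div, Real.exp_neg, inv_mul_lt_iff₀ (Real.exp_pos _)]
        linarith
      have h4 : 3 * ((T φ).card : ℝ) < N := by
        have := hTcard φ
        nlinarith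
      rw [hN] at h4
      exact_mod_cast h4)
    (fun φ ψ h => hsep φ ψ (hTmem φ ψ h)) (by positivity)
    (by
      -- Since `M^(2/5) ≤ 4b^2`, the query count costs at most `exp(b^3/16)`. This leaves
      -- `exp(-b^3/16)` from the rarity of large overlaps, enough to absorb `114 / a` because `b ≥
      -- 1824 / a = 16 * 114 / a`.
      have h2 : (2 : ℝ) ^ (1 / 64 * ((b ^ 4 * (3 * b) : ℕ) : ℝ) ^ (2 / 5 : ℝ)) ≤
          Real.exp ((b : ℝ) ^ 3 / 16) := by
        rw [Real.rpow_def_of_pos two_pos]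
        apply Real.exp_le_exp.2
        have h3 := rpow_two_fifths_le b
        have h4 : Real.log 2 ≤ 1 := by linarith [Real.log_two_lt_d9]
        have h5 : (b : ℝ) ^ 2 ≤ b ^ 3 := pow_le_pow_right₀ (by linarith) (by norm_num)
        have h6 : 0 ≤ 1 / 64 * ((b ^ 4 * (3 * b) : ℕ) : ℝ) ^ (2 / 5 : ℝ) := by positivity
        calc _ ≤ 1 * (1 / 64 * ((b ^ 4 * (3 * b) : ℕ) : ℝ) ^ (2 / 5 : ℝ)) := by gcongr
          _ ≤ _ := by linarith
      have h3 : 114 * (Real.exp ((b : ℝ) ^ 3 / 16) * p) ≤ a := by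
        rw [hp, ← Real.exp_add, show (b : ℝ) ^ 3 / 16 + -(b : ℝ) ^ 3 / 8 = -((b : ℝ) ^ 3 / 16) by
          ring, Real.exp_neg, ← div_eq_mul_inv, div_le_iff₀ (Real.exp_pos _)]
        have h4 := Real.add_one_le_exp ((b : ℝ) ^ 3 / 16)
        have h5 : 1824 ≤ a * b := by
          rw [div_le_iff₀ ha] at hba; linarith
        have h6 : a * (b : ℝ) ≤ a * (16 * Real.exp ((b : ℝ) ^ 3 / 16)) := by
          gcongr; linarith
        linarith
      have hp0 : 0 < p := Real.exp_pos _
      calc _ ≤ 3 * (Real.exp ((b : ℝ) ^ 3 / 16) * ρ * (N * p * (38 * δ))) := by gcongr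
        _ = N * (114 * (Real.exp ((b : ℝ) ^ 3 / 16) * p) * (ρ * δ)) := by ring
        _ ≤ N * τ := by
            gcongr
            refine le_trans ?_ hτ
            gcongr)
    μ A (fun φ O hO => hA _ _ _ (hinput φ O hO))
  exact ⟨graphSet φ, _, O, hinput φ O hO, hω⟩

open Polynomial in
/-- The family of corruptions if `ε` is small compared to `δ`: the moment-matching densities. -/
theorem lower_bound_of_le {a c ε δ τ : ℝ} {b k : ℕ} (hb : 0 < b) (ha : 0 < a) (hc0 : 0 < c)
    (hc : c ≤ 1 / 2 ^ 50) (hε0 : 0 < ε)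
    (hδ : δ = c * (ε * Real.log (1 / ε) / (k : ℝ) ^ 3)) (hδ1 : 38 * δ ≤ 1)
    (hk3 : 3 ≤ k) (hk : 38 * (5 / 6 : ℝ) ^ (k + 1) ≤ a) (hba : 1824 / a ≤ b) (hb17 : 17 ≤ b)
    (hbε : 2 ^ 25 / ε ≤ (b : ℝ) ^ 4) (hεδ : ε ≤ 37 * δ)
    (hτ : a * (((b ^ 4 * (3 * b) : ℕ) : ℝ) ^ (-((k : ℝ) + 1) / 5) * δ) ≤ τ)
    {Ω : Type*} [MeasurableSpace Ω] (μ : Measure Ω) [IsProbabilityMeasure μ]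
    (A : Ω → SQTree (Cube (b ^ 4 * (3 * b))) (Distr (Cube (b ^ 4 * (3 * b)))))
    (hA : Learns μ A (b ^ 4) ε (δ / (b ^ 4 : ℕ)) (1 / 2 ^ 22 * δ)) :
    ∃ S P O, IsInput (b ^ 4) ε (δ / (b ^ 4 : ℕ)) S P O ∧
      ∃ᵐ ω ∂μ, (∃ q ∈ (A ω).queries O, q.tol < √(2 * τ)) ∨
        (2 : ℝ) ^ (1 / 64 * ((b ^ 4 * (3 * b) : ℕ) : ℝ) ^ (2 / 5 : ℝ)) *
          ((b ^ 4 * (3 * b) : ℕ) : ℝ) ^ (-((k : ℝ) + 1) / 5) ≤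
          (((A ω).queries O).length : ℝ) := by
  have hb' : (0 : ℝ) < b := by exact_mod_cast hb
  have hb1 : (1 : ℝ) ≤ b := by exact_mod_cast hb
  have hδ0 : 0 < δ := by linarith
  have hm : 1 / ε ≤ (b ^ 4 : ℕ) := by
    push_cast
    refine le_trans ?_ hbε
    gcongr
    norm_num
  obtain ⟨h, hmom, hpos, hnear, hsq, hlow⟩ := exists_density hc0 hc (by omega) hε0 hδ hεδ hm
  have hav : ∀ (F : ℝ → ℝ) (φ : Fin (b ^ 4) → Fin (3 * b)),
      avg (fun x => F (spinSum (graphSet φ) x)) = binE (b ^ 4) F := fun F φ => by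
    rw [avg_spinSum, card_graphSet]
  have hmom' : ∀ (φ : Fin (b ^ 4) → Fin (3 * b)) (q : ℝ[X]), q.natDegree ≤ k →
      avg (fun x => h (spinSum (graphSet φ) x) * q.eval (spinSum (graphSet φ) x)) = 0 :=
    fun φ q hq => (hav (fun s => h s * q.eval s) φ).trans (hmom q hq)
  have hmain := fun (F : ℝ → ℝ) (φ ψ : Fin (b ^ 4) → Fin (3 * b)) =>
    abs_avg_mul_le (k := k) F h (pow_pos hb 4) (card_graphSet φ) (card_graphSet ψ) (hmom' ψ)
  simp only [card_graphSet_inter] at hmain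
  have hr : ∀ φ ψ : Fin (b ^ 4) → Fin (3 * b), 3 * agreements φ ψ ≤ 2 * b ^ 3 →
      (agreements φ ψ : ℝ) / (b ^ 4 : ℕ) ≤ 2 / (3 * b) := fun φ ψ hag => by
    have h2 : 3 * (agreements φ ψ : ℝ) ≤ 2 * (b : ℝ) ^ 3 := by exact_mod_cast hag
    push_cast
    rw [div_le_div_iff₀ (by positivity) (by positivity)]
    calc (agreements φ ψ : ℝ) * (3 * b) = 3 * agreements φ ψ * b := by ring
      _ ≤ 2 * (b : ℝ) ^ 3 * b := by gcongr
      _ = _ := by ring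
  have hr1 : ∀ φ ψ : Fin (b ^ 4) → Fin (3 * b), (agreements φ ψ : ℝ) / (b ^ 4 : ℕ) ≤ 1 :=
    fun φ ψ => by
      refine div_le_one_of_le₀ ?_ (by positivity)
      have := card_graphSet_inter φ ψ
      have h2 := Finset.card_le_card (Finset.inter_subset_left (s₁ := graphSet φ) (s₂ := graphSet ψ))
      rw [card_graphSet, this] at h2
      exact_mod_cast h2
  have hsq' : ∀ φ ψ : Fin (b ^ 4) → Fin (3 * b),
      √(avg fun x => h (spinSum (graphSet φ) x) ^ 2) *
        √(avg fun x => h (spinSum (graphSet ψ) x) ^ 2) ≤ 38 * δ := fun φ ψ => by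
    have e := fun φ => hav (fun s => h s ^ 2) φ
    rw [e, e, Real.mul_self_sqrt (binE_nonneg fun s => sq_nonneg _)]
    exact hsq
  refine lower_bound_of_family hb ha hδ0 hk hba hb17 hτ (fun φ x => h (spinSum (graphSet φ) x))
    (fun φ x => hpos _) (fun φ => ?_) (fun φ => ?_) (fun φ ψ => ?_) (fun φ ψ hag => ?_)
    (fun φ ψ hag => ?_) μ A hA
  · simpa using hmom' φ 1 (by simp)
  · rw [hav (fun s => |h s - (tilt (b ^ 4) δ s - 1)|)]
    exact hnear
  · refine (hmain h φ ψ).trans ((mul_le_of_le_one_left (by positivity) ?_).trans (hsq' φ ψ))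
    exact pow_le_one₀ (by positivity) (hr1 φ ψ)
  · refine (hmain h φ ψ).trans ?_
    have := hr φ ψ hag
    refine mul_le_mul ?_ (hsq' φ ψ) (by positivity) (by positivity)
    gcongr
  -- The sign of the perturbation over the first clique is the test function. It sees `E|h| ≥
  -- δ/2^18` on its own member, but at most `δ/2^19` on the other, as `abs_avg_mul_le` needs
  -- orthogonality of only one factor. The gap exceeds `4r = δ/2^20`.
  · set f : ℝ → ℝ := fun s => SignType.sign (h s) with hf
    have hf1 : ∀ s, |f s| ≤ 1 := fun s => by
      simp only [hf]
      rcases SignType.trichotomy (SignType.sign (h s)) with h | h | h <;> rw [h] <;> norm_num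
    have h1 := avg_mul_sub_le_two_mul_tvDist (fun x => hpos (spinSum (graphSet φ) x))
      (by simpa using hmom' φ 1 (by simp)) (fun x => hpos (spinSum (graphSet ψ) x))
      (by simpa using hmom' ψ 1 (by simp)) (f := fun x => f (spinSum (graphSet φ) x))
      (fun x => hf1 _)
    have h2 : avg (fun x => f (spinSum (graphSet φ) x) * h (spinSum (graphSet φ) x)) =
        binE (b ^ 4) fun s => |h s| := by
      rw [← hav _ φ]
      congr 1
      ext x
      exact sign_mul_self _
    have h3 : avg (fun x => f (spinSum (graphSet φ) x) * h (spinSum (graphSet ψ) x)) ≤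
        δ / 2 ^ 19 := by
      have hF : √(avg fun x => f (spinSum (graphSet φ) x) ^ 2) ≤ 1 := by
        rw [Real.sqrt_le_one, ← avg_const (M := b ^ 4 * (3 * b)) 1]
        exact avg_mono fun x => by rw [← sq_abs]; exact pow_le_one₀ (abs_nonneg _) (hf1 _)
      have hH : √(avg fun x => h (spinSum (graphSet ψ) x) ^ 2) ≤ 1 := by
        rw [Real.sqrt_le_one, hav (fun s => h s ^ 2)]
        exact hsq.trans hδ1
      have h4 := hr φ ψ hag
      calc _ ≤ _ := le_abs_self _
        _ ≤ _ := hmain f φ ψ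
        _ ≤ (2 / (3 * (b : ℝ))) ^ (k + 1) * (1 * 1) := by gcongr
        _ ≤ (1 / (b : ℝ)) ^ (k + 1) * (1 * 1) := by
            gcongr ?_ ^ _ * _
            rw [div_le_div_iff₀ (by positivity) hb']
            linarith
        -- Here `k ≥ 3` turns the correlation bound into `1/b^4 = 1/m`, which is small compared with
        -- `ε`.
        _ ≤ (1 / (b : ℝ)) ^ 4 := by
            rw [mul_one, mul_one]
            exact pow_le_pow_of_le_one (by positivity) (by rw [div_le_one hb']; exact hb1) (by omega)
        _ ≤ ε / 2 ^ 25 := by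
            rw [div_pow, one_pow, div_le_div_iff₀ (by positivity) (by positivity), one_mul]
            rw [div_le_iff₀ hε0] at hbε
            linarith
        _ ≤ δ / 2 ^ 19 := by linarith
    rw [h2] at h1
    linarith

/-- The family of corruptions if `ε` is large compared to `δ`: perturbations of the uniform
distribution by a parity. -/
theorem lower_bound_of_lt {a ε δ τ : ℝ} {b k : ℕ} (hb : 0 < b) (ha : 0 < a) (hδ0 : 0 < δ)
    (hδ1 : δ ≤ 1 / 36) (hk : 38 * (5 / 6 : ℝ) ^ (k + 1) ≤ a) (hba : 1824 / a ≤ b) (hb17 : 17 ≤ b)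
    (hεδ : 37 * δ ≤ ε)
    (hτ : a * (((b ^ 4 * (3 * b) : ℕ) : ℝ) ^ (-((k : ℝ) + 1) / 5) * δ) ≤ τ)
    {Ω : Type*} [MeasurableSpace Ω] (μ : Measure Ω) [IsProbabilityMeasure μ]
    (A : Ω → SQTree (Cube (b ^ 4 * (3 * b))) (Distr (Cube (b ^ 4 * (3 * b)))))
    (hA : Learns μ A (b ^ 4) ε (δ / (b ^ 4 : ℕ)) (1 / 2 ^ 22 * δ)) :
    ∃ S P O, IsInput (b ^ 4) ε (δ / (b ^ 4 : ℕ)) S P O ∧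
      ∃ᵐ ω ∂μ, (∃ q ∈ (A ω).queries O, q.tol < √(2 * τ)) ∨
        (2 : ℝ) ^ (1 / 64 * ((b ^ 4 * (3 * b) : ℕ) : ℝ) ^ (2 / 5 : ℝ)) *
          ((b ^ 4 * (3 * b) : ℕ) : ℝ) ^ (-((k : ℝ) + 1) / 5) ≤
          (((A ω).queries O).length : ℝ) := by
  have hb4 : 0 < b ^ 4 := pow_pos hb 4
  have hpos : ∀ (φ : Fin (b ^ 4) → Fin (3 * b)) x, 0 ≤ 1 + δ * chi (graphSet φ) x := fun φ x => by
    have h := (abs_le.1 (abs_chi (graphSet φ) x).le).1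
    nlinarith
  have havg : ∀ φ : Fin (b ^ 4) → Fin (3 * b), avg (fun x => δ * chi (graphSet φ) x) = 0 :=
    fun φ => by
      have h := avg_chi_mul_chi (graphSet φ) ∅
      rw [if_neg (fun h => by
        have := card_graphSet φ
        rw [h, Finset.card_empty] at this
        omega)] at h
      rw [avg_const_mul]
      have h2 : ∀ x : Cube (b ^ 4 * (3 * b)), chi ∅ x = 1 := fun x => Finset.prod_empty
      simp only [h2, mul_one] at h
      rw [h, mul_zero]
  have hne : ∀ φ ψ : Fin (b ^ 4) → Fin (3 * b), 3 * agreements φ ψ ≤ 2 * b ^ 3 →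
      graphSet φ ≠ graphSet ψ := fun φ ψ hag h => by
    have h1 := card_graphSet_inter φ ψ
    rw [h, Finset.inter_self, card_graphSet] at h1
    rw [← h1] at hag
    have : 2 * b ^ 3 < 3 * b ^ 4 := by
      rw [pow_succ b 3]
      nlinarith [pow_pos hb 3]
    omega
  have hprod : ∀ φ ψ : Fin (b ^ 4) → Fin (3 * b),
      avg (fun x => δ * chi (graphSet φ) x * (δ * chi (graphSet ψ) x)) =
        δ ^ 2 * if graphSet φ = graphSet ψ then 1 else 0 := fun φ ψ => by
    rw [← avg_chi_mul_chi, ← avg_const_mul]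
    congr 1
    ext x
    ring
  refine lower_bound_of_family hb ha hδ0 hk hba hb17 hτ (fun φ x => δ * chi (graphSet φ) x)
    hpos havg (fun φ => ?_) (fun φ ψ => ?_) (fun φ ψ hag => ?_) (fun φ ψ hag => ?_) μ A hA
  -- The parity costs `δ` and the clique model is within `36 * δ` of uniform, together `37 * δ ≤ ε`.
  · refine (avg_mono (G := fun x => δ + |tilt (b ^ 4) δ (spinSum (graphSet φ) x) - 1|)
      fun x => ?_).trans ?_
    · refine (abs_sub _ _).trans ?_
      rw [abs_mul, abs_chi, mul_one, abs_of_pos hδ0]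
    · have h := binE_abs_tilt_sub_one_le hb4 hδ0.le hδ1
      rw [avg_add, avg_const, avg_spinSum (fun s => |tilt (b ^ 4) δ s - 1|), card_graphSet]
      linarith
  · rw [hprod, abs_of_nonneg (by positivity)]
    split_ifs <;> nlinarith
  · rw [hprod, if_neg (hne φ ψ hag), mul_zero, abs_zero]
    positivity
  -- The parity of the first clique has expectation `δ` under its own member and `0` under the
  -- other.
  · have h1 := avg_mul_sub_le_two_mul_tvDist (hpos φ) (havg φ) (hpos ψ) (havg ψ)
      (f := chi (graphSet φ)) (fun x => (abs_chi _ x).le)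
    have h2 : ∀ χ : Fin (b ^ 4) → Fin (3 * b),
        avg (fun x => chi (graphSet φ) x * (δ * chi (graphSet χ) x)) =
          δ * if graphSet φ = graphSet χ then 1 else 0 := fun χ => by
      rw [← avg_chi_mul_chi, ← avg_const_mul]
      congr 1
      ext x
      ring
    rw [h2, h2, if_pos rfl, if_neg (hne φ ψ hag)] at h1
    linarith

end SQIsing

/-! ### Choice of the constants and the two regimes -/

open SQIsing
theorem theoremC1 :
    ∃ c₀ c₁ c₂ : ℝ, 0 < c₀ ∧ 0 < c₁ ∧ 0 < c₂ ∧
      ∀ a : ℝ, 0 < a → ∃ k₀ : ℕ,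
      ∀ c : ℝ, 0 < c → c ≤ c₀ → ∃ C' : ℝ, 0 < C' ∧
      ∀ k : ℕ, k₀ ≤ k → ∀ ε δ : ℝ, 0 < ε → ε < 1 / 2 →
        δ = c * (ε * Real.log (1 / ε) / (k : ℝ) ^ 3) →
      ∀ m M : ℕ, (M : ℝ) = 3 * (m : ℝ) ^ (5 / 4 : ℝ) →
        max (C' / ε) ((k : ℝ) ^ 2 / Real.log (1 / δ)) < (m : ℝ) →
      ∀ τ : ℝ, a * ((M : ℝ) ^ (-((k : ℝ) + 1) / 5) * δ) ≤ τ →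
      ∀ (Ω : Type*) [MeasurableSpace Ω] (μ : Measure Ω) [IsProbabilityMeasure μ]
        (A : Ω → SQTree (Cube M) (Distr (Cube M))),
        Learns μ A m ε (δ / m) (c₁ * δ) →
        ∃ S P O, IsInput m ε (δ / m) S P O ∧
          ∃ᵐ ω ∂μ, (∃ q ∈ (A ω).queries O, q.tol < √(2 * τ)) ∨
            (2 : ℝ) ^ (c₂ * (M : ℝ) ^ (2 / 5 : ℝ)) * (M : ℝ) ^ (-((k : ℝ) + 1) / 5) ≤
              (((A ω).queries O).length : ℝ) := by
  refine ⟨1 / 2 ^ 50, 1 / 2 ^ 22, 1 / 64, by norm_num, by norm_num, by norm_num, fun a ha => ?_⟩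
  obtain ⟨n, hn⟩ := exists_pow_lt_of_lt_one (by positivity : 0 < a / 38)
    (by norm_num : (5 / 6 : ℝ) < 1)
  -- The shift by `3` ensures `k ≥ 3`. In `C'`, the term `2^25` makes `1/m` small against `ε`, and
  -- the fourth power, compared with `m = b^4`, forces `b > 17 + 1824 / a`.
  refine ⟨n + 3, fun c hc0 hc => ⟨2 ^ 25 + (17 + 1824 / a) ^ 4, by positivity, ?_⟩⟩
  intro k hk ε δ hε0 hε hδ m M hM hm τ hτ Ω _ μ _ A hA
  have hC' := (le_max_left _ _).trans_lt hm
  have hm0 : (0 : ℝ) < m := lt_of_le_of_lt (by positivity) hC'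
  obtain ⟨b, hb, rfl, rfl⟩ := exists_eq_pow_of_rpow (by exact_mod_cast hm0) hM
  have hlog : 0 < Real.log (1 / ε) := Real.log_pos (by rw [lt_div_iff₀ hε0]; linarith)
  have hk1 : (1 : ℝ) ≤ k := by exact_mod_cast (by omega : 1 ≤ k)
  have hδ0 : 0 < δ := by rw [hδ]; positivity
  have hδc : δ ≤ 1 / 2 ^ 50 := by
    have h1 : ε * Real.log (1 / ε) ≤ 1 := by
      have h2 := Real.log_le_sub_one_of_pos (by positivity : 0 < 1 / ε)
      have h3 : ε * Real.log (1 / ε) ≤ ε * (1 / ε - 1) := by gcongr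
      have h4 : ε * (1 / ε - 1) = 1 - ε := by field_simp
      linarith
    have h2 : ε * Real.log (1 / ε) / (k : ℝ) ^ 3 ≤ 1 :=
      div_le_one_of_le₀ (h1.trans (one_le_pow₀ hk1)) (by positivity)
    rw [hδ]
    calc c * (ε * Real.log (1 / ε) / (k : ℝ) ^ 3) ≤ 1 / 2 ^ 50 * 1 := by gcongr
      _ = _ := mul_one _
  have hka : 38 * (5 / 6 : ℝ) ^ (k + 1) ≤ a := by
    have h1 : (5 / 6 : ℝ) ^ (k + 1) ≤ (5 / 6) ^ n :=
      pow_le_pow_of_le_one (by norm_num) (by norm_num) (by omega)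
    linarith
  have hb4 : 2 ^ 25 / ε + (17 + 1824 / a) ^ 4 < (b : ℝ) ^ 4 := by
    push_cast at hC'
    refine lt_of_le_of_lt ?_ hC'
    rw [add_div]
    gcongr
    rw [le_div_iff₀ hε0]
    exact mul_le_of_le_one_right (by positivity) (by linarith)
  have hbK : 17 + 1824 / a < b := by
    refine lt_of_pow_lt_pow_left₀ 4 (by positivity) ?_
    have : 0 < 2 ^ 25 / ε := by positivity
    linarith
  have ha' : 0 < 1824 / a := by positivity
  have hb17 : 17 ≤ b := by
    have : (17 : ℝ) ≤ b := by linarith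
    exact_mod_cast this
  have hba : 1824 / a ≤ b := by linarith
  -- Moment matching is possible when `ε` is small against `δ`; otherwise parities suffice.
  rcases le_total ε (37 * δ) with hεδ | hεδ
  · refine lower_bound_of_le hb ha hc0 hc hε0 hδ (by linarith) (by omega) hka hba hb17 ?_ hεδ hτ μ A hA
    have : 0 ≤ (17 + 1824 / a) ^ 4 := by positivity
    linarith
  · exact lower_bound_of_lt hb ha hδ0 (by linarith) hka hba hb17 hεδ hτ μ A hA
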